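/- Setting. Write $\Delta=\tfrac14(\partial_x^2+\partial_y^2)=\partial\bar\partial$, let $dA$ be Lebesgue measure on $\mathbb C$ and $B(z,r)$ the open disk. A set with multiplicities $(\Lambda,m_\Lambda)$ is a set $\Lambda\subseteq\mathbb C$ with a bounded function $m_\Lambda:\Lambda\to\{1,2,\dots\}$. It is separated if $\inf\{|\lambda-\lambda'|:\lambda\ne\lambda'\in\Lambda\}>0$. Put $n_\Lambda=\sup_{\lambda\in\Lambda}m_\Lambda(\lambda)-1$. Let $\phi:\mathbb C\to\mathbb R$ be subharmonic, with distributional Laplacian $\Delta\phi$ a locally integrable function. $(\Lambda,m_\Lambda)$ and $\phi$ are compatible if $m<\Delta\phi<M$ almost everywhere for some positive constants $m,M$ and, in case $n_\Lambda\ge2$, in addition $\phi\in C^{n_\Lambda+1}(\mathbb C)$ and $\sup_{z\in\mathbb C}|\partial_z^j\Delta\phi(z)|<\infty$ for $j=1,\dots,n_\Lambda-1$. (Such a $\phi$ is always of class $C^1$.) Let $$\mathcal F_\phi=\Big\{f:\mathbb C\to\mathbb C \text{ entire}:\ \|f\|_\phi^2=\int_{\mathbb C}|f|^2e^{-\phi}\,dA<\infty\Big\},\qquad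 \bar\partial^*_\phi f=-e^{\phi}\,\partial\big(e^{-\phi}f\big),$$ and let $(\bar\partial^*_\phi)^{j}$ be the $j$-fold iterate. $(\Lambda,m_\Lambda)$ is sampling for $\mathcal F_\phi$ if there are $A,B>0$ with $$A\|f\|_\phi^2\le\sum_{\lambda\in\Lambda}\sum_{j=0}^{m_\Lambda(\lambda)-1}\big|(\bar\partial^*_\phi)^{j}f(\lambda)\big|^2e^{-\phi(\lambda)}\le B\|f\|_\phi^2\qquad\text{for all } f\in\mathcal F_\phi .$$ With $n(z,r)=\sum_{\lambda\in\Lambda\cap B(z,r)}m_\Lambda(\lambda)$, the densities are $$D^-_\phi(\Lambda,m_\Lambda)=\liminf_{r\to\infty}\inf_{z\in\mathbb C}\frac{n(z,r)}{\int_{B(z,r)}\Delta\phi\,dA},\qquad D^+_\phi(\Lambda,m_\Lambda)=\limsup_{r\to\infty}\sup_{z\in\mathbb C}\frac{n(z,r)}{\int_{B(z,r)}\Delta\phi\,dA}.$$ Proposition. Let $(\Lambda,m_\Lambda)$ be a separated set with multiplicities that is compatible with $\phi$ and sampling for $\mathcal F_\phi$, and suppose that $\sup_{\lambda\in\Lambda}m_\Lambda(\lambda)=n_\Lambda+1\ge2$.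 Then there exists a separated set with multiplicities $(\tilde\Lambda,m_{\tilde\Lambda})$ that is sampling for $\mathcal F_\phi$ and satisfies $\sup_{\lambda\in\tilde\Lambda}m_{\tilde\Lambda}(\lambda)=n_\Lambda$, $D^-_\phi(\tilde\Lambda,m_{\tilde\Lambda})=D^-_\phi(\Lambda,m_\Lambda)$ and $D^+_\phi(\tilde\Lambda,m_{\tilde\Lambda})=D^+_\phi(\Lambda,m_\Lambda)$. More precisely, let $\Lambda_{\max}=\{\lambda\in\Lambda:m_\Lambda(\lambda)=n_\Lambda+1\}$. There is $\varepsilon_0>0$ such that for every $\varepsilon\in(0,\varepsilon_0)$ and every choice of points $\lambda'\in\mathbb C$ with $|\lambda-\lambda'|=\varepsilon$, one for each $\lambda\in\Lambda_{\max}$, the points $\lambda'$ are pairwise distinct and do not belong to $\Lambda$, and one can take $\tilde\Lambda=\Lambda\cup\{\lambda':\lambda\in\Lambda_{\max}\}$, with $m_{\tilde\Lambda}(\lambda)=m_\Lambda(\lambda)-1$ for $\lambda\in\Lambda_{\max}$, $m_{\tilde\Lambda}(\lambda)=m_\Lambda(\lambda)$ for $\lambda\in\Lambda\setminus\Lambda_{\max}$,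 and $m_{\tilde\Lambda}(\lambda')=1$ for $\lambda\in\Lambda_{\max}$. -/

import Mathlib

open MeasureTheory Filter Topology Set
open scoped ENNReal ContDiff

noncomputable section

namespace WeightedFock

/-! ### Differential operators on the plane -/

/-- The Wirtinger derivative `∂ = (∂ₓ - i ∂_y) / 2`. -/
def wirt (F : ℂ → ℂ) (z : ℂ) : ℂ :=
  (1 / 2 : ℂ) * (fderiv ℝ F z 1 - Complex.I * fderiv ℝ F z Complex.I)

/-- The normalized Laplacian `Δ = (∂ₓ² + ∂_y²) / 4` of a real function of class `C²`. -/
def lap (u : ℂ → ℝ) (z : ℂ) : ℝ :=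
  (1 / 4 : ℝ) * Laplacian.laplacian u z

/-- The operator `f ↦ - e^φ ∂ (e^{-φ} f)`. -/
def dbarStar (φ : ℂ → ℝ) (f : ℂ → ℂ) (z : ℂ) : ℂ :=
  -((Real.exp (φ z) : ℂ) * wirt (fun w => (Real.exp (-φ w) : ℂ) * f w) z)

/-! ### Weights -/

/-- A finite-valued subharmonic function on the plane: upper semicontinuous, with the sub-mean-value
inequality on all circles. (The averages of such a function on circles are finite.) -/
structure IsSubharmonic (φ : ℂ → ℝ) : Prop where
  usc : UpperSemicontinuous φ
  circleIntegrable : ∀ z : ℂ, ∀ r : ℝ, 0 < r → CircleIntegrable φ z r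
  le_circleAverage : ∀ z : ℂ, ∀ r : ℝ, 0 < r → φ z ≤ Real.circleAverage φ z r

/-- The locally integrable function `g` is the (normalized) Laplacian of `φ` in the sense of
distributions. -/
structure IsDistribLaplacian (φ g : ℂ → ℝ) : Prop where
  locInt_left : LocallyIntegrable φ volume
  locInt_right : LocallyIntegrable g volume
  integral_eq : ∀ ψ : ℂ → ℝ, ContDiff ℝ (∞ : WithTop ℕ∞) ψ → HasCompactSupport ψ →
    ∫ z, φ z * lap ψ z = ∫ z, g z * ψ z

/-! ### Sets with multiplicities -/

/-- A set with (bounded, positive) multiplicities. Only the values of `mult` on `carrier` matter. -/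
structure MultSet where
  carrier : Set ℂ
  mult : ℂ → ℕ
  pos : ∀ l ∈ carrier, 1 ≤ mult l
  bdd : ∃ N : ℕ, ∀ l ∈ carrier, mult l ≤ N

namespace MultSet

/-- The maximal multiplicity (`0` for the empty set). -/
def maxMult (L : MultSet) : ℕ := sSup (L.mult '' L.carrier)

/-- The points of maximal multiplicity. -/
def maxPoints (L : MultSet) : Set ℂ := {l | l ∈ L.carrier ∧ L.mult l = L.maxMult}

/-- Uniform separation: the infimum of the distances between distinct points is positive
(the infimum over the empty set being `∞`). -/
def IsSeparated (L : MultSet) : Prop := 0 < L.carrier.einfsep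

/-- The number of points in the open disk `B(z, r)`, counted with multiplicities. -/
def count (L : MultSet) (z : ℂ) (r : ℝ) : ℝ≥0∞ :=
  ∑' l : L.carrier, (Metric.ball z r).indicator (fun w => (L.mult w : ℝ≥0∞)) (l : ℂ)

end MultSet

/-- `φ` is a weight with Laplacian `g` that is compatible with `L`. With `n = maxMult - 1`:
`φ` is subharmonic with Laplacian between two positive constants and, if `n ≥ 2`, `φ` is of class
`C^{n+1}` and `∂^j Δφ` is bounded for `1 ≤ j ≤ n - 1`. -/
structure Compatible (L : MultSet) (φ g : ℂ → ℝ) : Prop where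
  subharmonic : IsSubharmonic φ
  laplacian : IsDistribLaplacian φ g
  bounds : ∃ m M : ℝ, 0 < m ∧ ∀ᵐ z, m < g z ∧ g z < M
  smooth : ∀ n : ℕ, L.maxMult = n + 1 → 2 ≤ n →
    ContDiff ℝ ((n + 1 : ℕ) : WithTop ℕ∞) φ ∧
    ∀ j : ℕ, 1 ≤ j → j + 1 ≤ n →
      ∃ C : ℝ, ∀ z : ℂ, ‖(wirt^[j] (fun w => ((lap φ w : ℝ) : ℂ))) z‖ ≤ C

/-! ### Fock spaces and sampling -/

/-- The square of the weighted norm, `∫ |f|² e^{-φ} dA`. -/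
def normSq (φ : ℂ → ℝ) (f : ℂ → ℂ) : ℝ≥0∞ :=
  ∫⁻ z, ENNReal.ofReal (‖f z‖ ^ 2 * Real.exp (-φ z))

/-- The weighted Fock space of entire functions. -/
def fock (φ : ℂ → ℝ) : Set (ℂ → ℂ) :=
  {f | Differentiable ℂ f ∧ normSq φ f < (⊤ : ℝ≥0∞)}

/-- The sum of `|∂̄*^j f(l)|² e^{-φ(l)}` over `l` in the set and `0 ≤ j < mult l`. -/
def sampleSum (L : MultSet) (φ : ℂ → ℝ) (f : ℂ → ℂ) : ℝ≥0∞ :=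
  ∑' l : L.carrier, ∑ j ∈ Finset.range (L.mult l),
    ENNReal.ofReal (‖((dbarStar φ)^[j] f) l‖ ^ 2 * Real.exp (-φ l))

/-- `L` is a sampling set for the Fock space with weight `φ`. -/
def IsSampling (L : MultSet) (φ : ℂ → ℝ) : Prop :=
  ∃ A B : ℝ, 0 < A ∧ 0 < B ∧ ∀ f ∈ fock φ,
    ENNReal.ofReal A * normSq φ f ≤ sampleSum L φ f ∧
    sampleSum L φ f ≤ ENNReal.ofReal B * normSq φ f

/-! ### Densities -/

/-- The quotient of `count z r` by `∫_{B(z,r)} Δφ dA`, where `g = Δφ`. -/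
def ratio (L : MultSet) (g : ℂ → ℝ) (z : ℂ) (r : ℝ) : ℝ≥0∞ :=
  L.count z r / ∫⁻ w in Metric.ball z r, ENNReal.ofReal (g w)

/-- The lower Beurling density with respect to a weight with Laplacian `g`. -/
def lowerDensity (L : MultSet) (g : ℂ → ℝ) : ℝ≥0∞ :=
  liminf (fun r : ℝ => ⨅ z : ℂ, ratio L g z r) atTop

/-- The upper Beurling density with respect to a weight with Laplacian `g`. -/
def upperDensity (L : MultSet) (g : ℂ → ℝ) : ℝ≥0∞ :=
  limsup (fun r : ℝ => ⨆ z : ℂ, ratio L g z r) atTop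

/-! ### The perturbation -/

/-- `L'` arises from `L` by lowering each maximal multiplicity by one and adding, for each point `l`
of maximal multiplicity, the point `p l` with multiplicity one. -/
structure IsPerturbation (L : MultSet) (p : ℂ → ℂ) (L' : MultSet) : Prop where
  carrier_eq : L'.carrier = L.carrier ∪ p '' L.maxPoints
  mult_max : ∀ l ∈ L.maxPoints, L'.mult l + 1 = L.mult l
  mult_rest : ∀ l ∈ L.carrier, l ∉ L.maxPoints → L'.mult l = L.mult l
  mult_new : ∀ l ∈ L.maxPoints, L'.mult (p l) = 1

end WeightedFock

end

/-! Fix $a\in\Lambda_{\max}$ and let $a'$ be the new point, $|a-a'|=\varepsilon$. The lost sample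
$(\bar\partial^*_\phi)^n f(a)$ is recovered from $f(a')$ and the remaining samples at $a$, up to an
error that is small with $\varepsilon$.

The reduction to ordinary Taylor expansion is a local decomposition $\phi=\psi+2\,\mathrm{Re}\,h$ on
the unit disc about $a$, with $h$ holomorphic, $\psi$ bounded uniformly in $a$, $\psi(a)=0$ and
$\partial^j\psi(a)=0$ for $1\le j\le n$ (`LocallyDecomposable`). For $F=fe^{-h}$ the densities
$|F|^2$ and $|f|^2e^{-\phi}$ are comparable, and
$|F^{(j)}(a)|^2=|(\bar\partial^*_\phi)^jf(a)|^2e^{-\phi(a)}$ holds exactly for $j\le n$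
(`sampleTerm_eq`). Solving the Taylor formula of $F$ at $a'$ for $F^{(n)}(a)$ leaves a remainder
$O(\varepsilon^{n+1})/\varepsilon^n=O(\varepsilon)$ times a local norm (`norm_iteratedDeriv_sq_le`,
`LocallyDecomposable.exists_bounds`). The discs about the points of $\Lambda$ are disjoint, so the
squared errors sum to at most $C\varepsilon^2\|f\|_\phi^2$ with $C$ independent of $\varepsilon$;
for small $\varepsilon$ this is absorbed by the lower sampling bound (`IsPerturbation.isSampling`).
The upper bound follows from the mean value property at the new points.

The decomposition comes from a Cauchy transform $w$ of $\Delta\phi$, cut off near $a$. A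
mollification argument shows that $\partial\phi-w$ is holomorphic
(`hasFDerivAt_of_isDistribLaplacian`). Its primitive gives the main part of $h$, and a polynomial
removes the derivatives $\partial^j$ at $a$ (`exists_locallyDecomposable`). The compatibility
conditions bound $\partial^iw(a)$ for $i<n$.

The densities agree because moving points by $\varepsilon$ changes counts only by a shift of the
radius by $\varepsilon$, and the added annulus has negligible mass as $r\to\infty$. -/

noncomputable section

namespace WeightedFock

/-! ### Wirtinger calculus -/

/-- The Wirtinger derivative `∂̄ = (∂ₓ + i ∂_y) / 2`. -/
def dbar (F : ℂ → ℂ) (z : ℂ) : ℂ :=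
  (1 / 2 : ℂ) * (fderiv ℝ F z 1 + Complex.I * fderiv ℝ F z Complex.I)

lemma wirt_eventuallyEq {F G : ℂ → ℂ} {z : ℂ} (h : F =ᶠ[𝓝 z] G) : wirt F =ᶠ[𝓝 z] wirt G := by
  filter_upwards [h.fderiv (𝕜 := ℝ)] with w hw
  simp only [wirt, hw]

lemma wirt_iterate_eventuallyEq {F G : ℂ → ℂ} {z : ℂ} (h : F =ᶠ[𝓝 z] G) (j : ℕ) :
    wirt^[j] F =ᶠ[𝓝 z] wirt^[j] G := by
  induction j with
  | zero => simpa using h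
  | succ k ih => simpa only [Function.iterate_succ_apply'] using wirt_eventuallyEq ih

lemma wirt_neg (F : ℂ → ℂ) : wirt (-F) = -wirt F := by
  ext z
  simp only [wirt, fderiv_neg, Pi.neg_apply, neg_apply]
  ring

lemma wirt_add {F G : ℂ → ℂ} {z : ℂ} (hF : DifferentiableAt ℝ F z) (hG : DifferentiableAt ℝ G z) :
    wirt (F + G) z = wirt F z + wirt G z := by
  simp only [wirt, fderiv_add hF hG, add_apply]
  ring

lemma wirt_sub {F G : ℂ → ℂ} {z : ℂ} (hF : DifferentiableAt ℝ F z) (hG : DifferentiableAt ℝ G z) :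
    wirt (F - G) z = wirt F z - wirt G z := by
  rw [sub_eq_add_neg, wirt_add hF hG.neg, wirt_neg, Pi.neg_apply, sub_eq_add_neg]

lemma dbar_sub {F G : ℂ → ℂ} {z : ℂ} (hF : DifferentiableAt ℝ F z) (hG : DifferentiableAt ℝ G z) :
    dbar (F - G) z = dbar F z - dbar G z := by
  simp only [dbar, fderiv_sub hF hG, sub_apply]
  ring

lemma wirt_mul {F G : ℂ → ℂ} {z : ℂ} (hF : DifferentiableAt ℝ F z) (hG : DifferentiableAt ℝ G z) :
    wirt (F * G) z = wirt F z * G z + F z * wirt G z := by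
  simp only [wirt, fderiv_mul hF hG, add_apply,
    smul_apply, smul_eq_mul]
  ring

lemma wirt_contDiffAt {F : ℂ → ℂ} {z : ℂ} {n : ℕ} (h : ContDiffAt ℝ ((n + 1 : ℕ)) F z) :
    ContDiffAt ℝ n (wirt F) z := by
  have h1 : ContDiffAt ℝ n (fderiv ℝ F) z := h.fderiv_right (by norm_cast)
  unfold wirt
  exact contDiffAt_const.mul ((h1.clm_apply contDiffAt_const).sub
    (contDiffAt_const.mul (h1.clm_apply contDiffAt_const)))

lemma wirt_contDiff {F : ℂ → ℂ} {n : ℕ} (h : ContDiff ℝ ((n + 1 : ℕ)) F) :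
    ContDiff ℝ n (wirt F) :=
  contDiff_iff_contDiffAt.2 fun _ => wirt_contDiffAt h.contDiffAt

lemma wirt_contDiff_infty {F : ℂ → ℂ} (h : ContDiff ℝ ∞ F) : ContDiff ℝ ∞ (wirt F) :=
  contDiff_infty.2 fun n => wirt_contDiff (h.of_le (by exact_mod_cast le_top))

lemma dbar_contDiff {F : ℂ → ℂ} {n : ℕ} (h : ContDiff ℝ ((n + 1 : ℕ)) F) :
    ContDiff ℝ n (dbar F) := by
  have h1 : ContDiff ℝ n (fderiv ℝ F) := h.fderiv_right (by norm_cast)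
  unfold dbar
  exact contDiff_const.mul ((h1.clm_apply contDiff_const).add
    (contDiff_const.mul (h1.clm_apply contDiff_const)))

lemma dbar_contDiff_infty {F : ℂ → ℂ} (h : ContDiff ℝ ∞ F) : ContDiff ℝ ∞ (dbar F) :=
  contDiff_infty.2 fun n => dbar_contDiff (h.of_le (by exact_mod_cast le_top))

lemma wirt_hasCompactSupport {F : ℂ → ℂ} (h : HasCompactSupport F) : HasCompactSupport (wirt F) := by
  refine (h.fderiv (𝕜 := ℝ)).mono fun z hz => ?_
  contrapose! hz
  simp only [Function.mem_support, not_not] at hz ⊢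
  simp [wirt, hz]

lemma dbar_hasCompactSupport {F : ℂ → ℂ} (h : HasCompactSupport F) : HasCompactSupport (dbar F) := by
  refine (h.fderiv (𝕜 := ℝ)).mono fun z hz => ?_
  contrapose! hz
  simp only [Function.mem_support, not_not] at hz ⊢
  simp [dbar, hz]

lemma wirt_eq_deriv {F : ℂ → ℂ} {z : ℂ} (h : DifferentiableAt ℂ F z) : wirt F z = deriv F z := by
  have h1 : fderiv ℝ F z = (fderiv ℂ F z).restrictScalars ℝ := h.fderiv_restrictScalars ℝ
  have h2 : ∀ v : ℂ, fderiv ℂ F z v = v * deriv F z := fun v => by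
    rw [← fderiv_apply_one_eq_deriv, ← smul_eq_mul, ← map_smul, smul_eq_mul, mul_one]
  simp only [wirt, h1, ContinuousLinearMap.coe_restrictScalars', h2]
  linear_combination (-(1 / 2 : ℂ) * deriv F z) * Complex.I_mul_I

lemma wirt_conj_eq_zero {F : ℂ → ℂ} {z : ℂ} (h : DifferentiableAt ℂ F z) :
    wirt (fun w => (starRingEnd ℂ) (F w)) z = 0 := by
  have h0 : HasFDerivAt (fun w => (starRingEnd ℂ) (F w))
      (Complex.conjCLE.toContinuousLinearMap.comp ((fderiv ℂ F z).restrictScalars ℝ)) z :=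
    Complex.conjCLE.toContinuousLinearMap.hasFDerivAt.comp z
      (h.hasFDerivAt.restrictScalars ℝ)
  have h2 : ∀ v : ℂ, fderiv ℂ F z v = v * deriv F z := fun v => by
    rw [← fderiv_apply_one_eq_deriv, ← smul_eq_mul, ← map_smul, smul_eq_mul, mul_one]
  simp only [wirt, h0.fderiv, ContinuousLinearMap.comp_apply,
    ContinuousLinearMap.coe_restrictScalars', h2, ContinuousLinearEquiv.coe_coe,
    Complex.conjCLE_apply, map_mul, Complex.conj_I, map_one]
  linear_combination ((1 / 2 : ℂ) * (starRingEnd ℂ) (deriv F z)) * Complex.I_mul_I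

lemma wirt_iterate_eq_iteratedDeriv {F : ℂ → ℂ} {z : ℂ} (h : AnalyticAt ℂ F z) (j : ℕ) :
    wirt^[j] F =ᶠ[𝓝 z] iteratedDeriv j F := by
  induction j with
  | zero => simp
  | succ k ih =>
    rw [Function.iterate_succ_apply', iteratedDeriv_succ]
    filter_upwards [wirt_eventuallyEq ih, h.eventually_analyticAt] with w hw hw'
    rw [hw, wirt_eq_deriv]
    rw [iteratedDeriv_eq_iterate]
    exact (hw'.iterated_deriv k).differentiableAt

/-! ### Iterates of $\partial$ and the Leibniz rule. -/

lemma wirt_iterate_contDiffAt {F : ℂ → ℂ} {z : ℂ} {n : ℕ} (j : ℕ)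
    (h : ContDiffAt ℝ ((n + j : ℕ)) F z) : ContDiffAt ℝ n (wirt^[j] F) z := by
  induction j generalizing F with
  | zero => simpa using h
  | succ k ih => exact ih (wirt_contDiffAt (by simpa [add_assoc] using h))

lemma contDiffAt_eventually {F : ℂ → ℂ} {z : ℂ} {n : ℕ} (h : ContDiffAt ℝ n F z) :
    ∀ᶠ w in 𝓝 z, ContDiffAt ℝ n F w :=
  h.eventually (by simp)

lemma differentiableAt_of_contDiffAt_succ {F : ℂ → ℂ} {z : ℂ} {n : ℕ}
    (h : ContDiffAt ℝ ((n + 1 : ℕ)) F z) : DifferentiableAt ℝ F z :=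
  h.differentiableAt (by simp)

lemma wirt_iterate_add {F G : ℂ → ℂ} {z : ℂ} (i : ℕ) (hF : ContDiffAt ℝ i F z)
    (hG : ContDiffAt ℝ i G z) : wirt^[i] (F + G) z = wirt^[i] F z + wirt^[i] G z := by
  induction i generalizing F G with
  | zero => simp
  | succ i ih =>
    simp only [Function.iterate_succ_apply]
    rw [← ih (wirt_contDiffAt hF) (wirt_contDiffAt hG)]
    refine (wirt_iterate_eventuallyEq ?_ i).eq_of_nhds
    filter_upwards [contDiffAt_eventually hF, contDiffAt_eventually hG] with w hF hG
    exact wirt_add (differentiableAt_of_contDiffAt_succ hF) (differentiableAt_of_contDiffAt_succ hG)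

lemma wirt_iterate_succ_mul {F G : ℂ → ℂ} {z : ℂ} (i : ℕ) (hF : ContDiffAt ℝ ((i + 1 : ℕ)) F z)
    (hG : ContDiffAt ℝ ((i + 1 : ℕ)) G z) :
    wirt^[i + 1] (F * G) z = wirt^[i] (wirt F * G) z + wirt^[i] (F * wirt G) z := by
  have hF' : ContDiffAt ℝ i F z := hF.of_le (by norm_cast; omega)
  have hG' : ContDiffAt ℝ i G z := hG.of_le (by norm_cast; omega)
  have hadd := wirt_iterate_add (F := wirt F * G) (G := F * wirt G) i
    ((wirt_contDiffAt hF).mul hG') (hF'.mul (wirt_contDiffAt hG))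
  rw [← hadd, Function.iterate_succ_apply]
  refine (wirt_iterate_eventuallyEq ?_ i).eq_of_nhds
  filter_upwards [contDiffAt_eventually hF, contDiffAt_eventually hG] with w hF hG
  exact wirt_mul (differentiableAt_of_contDiffAt_succ hF) (differentiableAt_of_contDiffAt_succ hG)

/-- In the Leibniz expansion every term contains some $\partial^lF$ with $l\le i$. It is applied to
$F=e^{-\psi}-1$. -/
lemma wirt_iterate_mul_eq_zero {F G : ℂ → ℂ} {z : ℂ} (i : ℕ) (hF : ContDiffAt ℝ i F z)
    (hG : ContDiffAt ℝ i G z) (h : ∀ l ≤ i, wirt^[l] F z = 0) : wirt^[i] (F * G) z = 0 := by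
  induction i generalizing F G with
  | zero => simpa using Or.inl (h 0 le_rfl)
  | succ i ih =>
    have hF' : ContDiffAt ℝ i F z := hF.of_le (by norm_cast; omega)
    have hG' : ContDiffAt ℝ i G z := hG.of_le (by norm_cast; omega)
    rw [wirt_iterate_succ_mul i hF hG, ih (wirt_contDiffAt hF) hG' fun l hl => ?_,
      ih hF' (wirt_contDiffAt hG) fun l hl => h l (by omega), add_zero]
    simpa using h (l + 1) (by omega)

lemma norm_wirt_iterate_mul_le {F G : ℂ → ℂ} {A B : ℝ} {z : ℂ} (i : ℕ) (hF : ContDiffAt ℝ i F z)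
    (hG : ContDiffAt ℝ i G z) (hFA : ∀ l ≤ i, ‖wirt^[l] F z‖ ≤ A)
    (hGB : ∀ l ≤ i, ‖wirt^[l] G z‖ ≤ B) : ‖wirt^[i] (F * G) z‖ ≤ 2 ^ i * A * B := by
  induction i generalizing F G with
  | zero =>
    simp only [Function.iterate_zero, id_eq, Pi.mul_apply, norm_mul, pow_zero, one_mul]
    have := hFA 0 le_rfl
    exact mul_le_mul this (hGB 0 le_rfl) (norm_nonneg _) ((norm_nonneg _).trans this)
  | succ i ih =>
    have hF' : ContDiffAt ℝ i F z := hF.of_le (by norm_cast; omega)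
    have hG' : ContDiffAt ℝ i G z := hG.of_le (by norm_cast; omega)
    rw [wirt_iterate_succ_mul i hF hG]
    have h1 := ih (wirt_contDiffAt hF) hG'
      (fun l hl => by simpa using hFA (l + 1) (by omega)) (fun l hl => hGB l (by omega))
    have h2 := ih hF' (wirt_contDiffAt hG) (fun l hl => hFA l (by omega))
      (fun l hl => by simpa using hGB (l + 1) (by omega))
    refine (norm_add_le _ _).trans ((add_le_add h1 h2).trans (le_of_eq ?_))
    ring

/-- Antiholomorphic factors are constants for $\partial$. This takes $\overline{e^{-h}}$ out of
$\partial^j(e^{-\phi}f)$. -/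
lemma wirt_iterate_conj_mul {F X : ℂ → ℂ} {z : ℂ} {j : ℕ} (hF : AnalyticAt ℂ F z)
    (hX : ContDiffAt ℝ j X z) :
    wirt^[j] (fun w => (starRingEnd ℂ) (F w) * X w) z = (starRingEnd ℂ) (F z) * wirt^[j] X z := by
  induction j generalizing X with
  | zero => simp
  | succ j ih =>
    simp only [Function.iterate_succ_apply]
    rw [← ih (wirt_contDiffAt hX)]
    refine (wirt_iterate_eventuallyEq ?_ j).eq_of_nhds
    filter_upwards [contDiffAt_eventually hX, hF.eventually_analyticAt] with w hX hF
    have h1 : DifferentiableAt ℝ (fun w => (starRingEnd ℂ) (F w)) w :=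
      Complex.conjCLE.differentiableAt.comp w (hF.differentiableAt.restrictScalars ℝ)
    have := wirt_mul h1 (differentiableAt_of_contDiffAt_succ hX)
    rw [wirt_conj_eq_zero hF.differentiableAt, zero_mul, zero_add] at this
    exact this

/-- The real-linear functional `v ↦ 2 Re (c v)`. -/
def twoRe (c : ℂ) : ℂ →L[ℝ] ℝ :=
  (2 : ℝ) • Complex.reCLM.comp (ContinuousLinearMap.mul ℝ ℂ c)

lemma twoRe_apply (c v : ℂ) : twoRe c v = 2 * (c * v).re := by
  simp [twoRe]

lemma twoRe_sub (c d : ℂ) : twoRe (c - d) = twoRe c - twoRe d := by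
  ext v
  simp [twoRe_apply, sub_mul]
  ring

lemma norm_twoRe_le (c : ℂ) : ‖twoRe c‖ ≤ 2 * ‖c‖ := by
  refine ContinuousLinearMap.opNorm_le_bound _ (by positivity) fun v => ?_
  rw [twoRe_apply, norm_mul, Real.norm_eq_abs, Real.norm_eq_abs, abs_two, mul_assoc, ← norm_mul]
  gcongr
  exact Complex.abs_re_le_norm _

lemma hasFDerivAt_ofReal_comp {u : ℂ → ℝ} {L : ℂ →L[ℝ] ℝ} {z : ℂ} (h : HasFDerivAt u L z) :
    HasFDerivAt (fun w => (u w : ℂ)) (Complex.ofRealCLM.comp L) z :=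
  Complex.ofRealCLM.hasFDerivAt.comp z h

lemma wirt_ofReal_eq {u : ℂ → ℝ} {c z : ℂ} (h : HasFDerivAt u (twoRe c) z) :
    wirt (fun w => (u w : ℂ)) z = c := by
  simp only [wirt, (hasFDerivAt_ofReal_comp h).fderiv, ContinuousLinearMap.comp_apply, twoRe_apply,
    Complex.ofRealCLM_apply]
  apply Complex.ext <;> simp

/-- A real differential is determined by $\partial u$ alone, so gradients of weights can be handled
as single complex functions. -/
lemma fderiv_eq_twoRe_wirt {u : ℂ → ℝ} {z : ℂ} (h : DifferentiableAt ℝ u z) :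
    fderiv ℝ u z = twoRe (wirt (fun w => (u w : ℂ)) z) := by
  have h1 := (hasFDerivAt_ofReal_comp h.hasFDerivAt).fderiv
  ext v
  have h2 : fderiv ℝ u z v = v.re * fderiv ℝ u z 1 + v.im * fderiv ℝ u z Complex.I := by
    rw [← smul_eq_mul, ← smul_eq_mul, ← map_smul, ← map_smul, ← map_add]
    congr 1
    apply Complex.ext <;> simp
  rw [h2, twoRe_apply]
  simp only [wirt, h1, ContinuousLinearMap.comp_apply, Complex.ofRealCLM_apply]
  simp
  ring

lemma hasFDerivAt_two_re {h : ℂ → ℂ} {d z : ℂ} (hd : HasDerivAt h d z) :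
    HasFDerivAt (fun w => 2 * (h w).re) (twoRe d) z := by
  have h1 := (Complex.reCLM.hasFDerivAt.comp z (hd.hasFDerivAt.restrictScalars ℝ)).const_smul (2 : ℝ)
  refine (h1.congr_fderiv ?_)
  ext v
  simp [twoRe_apply]
  ring

lemma differentiableAt_complex_of_dbar {F : ℂ → ℂ} {z : ℂ} (hF : DifferentiableAt ℝ F z)
    (h : dbar F z = 0) : DifferentiableAt ℂ F z := by
  rw [differentiableAt_complex_iff_differentiableAt_real]
  refine ⟨hF, ?_⟩
  have : fderiv ℝ F z 1 + Complex.I * fderiv ℝ F z Complex.I = 0 := by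
    simpa [dbar] using h
  rw [smul_eq_mul]
  linear_combination -Complex.I * this + fderiv ℝ F z Complex.I * Complex.I_mul_I

lemma fderiv_fderiv_apply {F : ℂ → ℂ} {z : ℂ} (hF : ContDiffAt ℝ 2 F z) (v w : ℂ) :
    fderiv ℝ (fun x => fderiv ℝ F x v) z w = fderiv ℝ (fderiv ℝ F) z w v := by
  have h1 : DifferentiableAt ℝ (fderiv ℝ F) z :=
    (hF.fderiv_right (m := 1) (by norm_num)).differentiableAt (by norm_num)
  rw [fderiv_clm_apply h1 (differentiableAt_const _)]
  simp

/-- The mixed terms cancel by symmetry of the second derivative, in either order of $\partial$ and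
$\bar\partial$. -/
lemma dbar_wirt_eq_lap {u : ℂ → ℝ} {z : ℂ} (hu : ContDiffAt ℝ 2 u z) :
    dbar (wirt (fun w => (u w : ℂ))) z = (lap u z : ℂ) ∧
    wirt (dbar (fun w => (u w : ℂ))) z = (lap u z : ℂ) := by
  have hF : ContDiffAt ℝ 2 (fun w => (u w : ℂ)) z :=
    Complex.ofRealCLM.contDiff.contDiffAt.comp z hu
  set F : ℂ → ℂ := fun w => (u w : ℂ) with hFdef
  have h1 : DifferentiableAt ℝ (fderiv ℝ F) z :=
    (hF.fderiv_right (m := 1) (by norm_num)).differentiableAt (by norm_num)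
  have hd : ∀ v, DifferentiableAt ℝ (fun x => fderiv ℝ F x v) z := fun v =>
    h1.clm_apply (differentiableAt_const _)
  have hsymm : fderiv ℝ (fderiv ℝ F) z 1 Complex.I = fderiv ℝ (fderiv ℝ F) z Complex.I 1 :=
    (hF.isSymmSndFDerivAt (by simp)).eq _ _
  have hlap : (lap u z : ℂ) = (1 / 4 : ℂ) *
      (fderiv ℝ (fderiv ℝ F) z 1 1 + fderiv ℝ (fderiv ℝ F) z Complex.I Complex.I) := by
    have h3 : Laplacian.laplacian F z = ((Laplacian.laplacian u z : ℝ) : ℂ) :=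
      hu.laplacian_CLM_comp_left (l := Complex.ofRealCLM)
    rw [lap, Complex.ofReal_mul, ← h3,
      InnerProductSpace.laplacian_eq_iteratedFDeriv_complexPlane]
    simp [iteratedFDeriv_two_apply]
  have hw : ∀ (a b c : ℂ), fderiv ℝ (fun x => (1 / 2 : ℂ) * (fderiv ℝ F x 1 + a * fderiv ℝ F x Complex.I)) z b
      = (1 / 2 : ℂ) * (fderiv ℝ (fderiv ℝ F) z b 1 + a * fderiv ℝ (fderiv ℝ F) z b Complex.I) := by
    intro a b c
    rw [fderiv_const_mul ((hd 1).fun_add ((hd Complex.I).const_mul a)), fderiv_fun_add (hd 1) ((hd Complex.I).const_mul a),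
      fderiv_const_mul (hd Complex.I)]
    simp only [smul_apply, add_apply, smul_eq_mul,
      fderiv_fderiv_apply hF]
  constructor
  · have : wirt F = fun x => (1 / 2 : ℂ) * (fderiv ℝ F x 1 + (-Complex.I) * fderiv ℝ F x Complex.I) := by
      ext x; simp only [wirt]; ring
    rw [this]
    simp only [dbar]
    rw [hw _ _ 0, hw _ _ 0, hlap, hsymm]
    linear_combination (-(1 / 4 : ℂ) * fderiv ℝ (fderiv ℝ F) z Complex.I Complex.I) * Complex.I_mul_I
  · have : dbar F = fun x => (1 / 2 : ℂ) * (fderiv ℝ F x 1 + (Complex.I) * fderiv ℝ F x Complex.I) := by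
      ext x; simp only [dbar]
    rw [this]
    simp only [wirt]
    rw [hw _ _ 0, hw _ _ 0, hlap, hsymm]
    linear_combination (-(1 / 4 : ℂ) * fderiv ℝ (fderiv ℝ F) z Complex.I Complex.I) * Complex.I_mul_I

/-! ### Radial averages -/

lemma integrableOn_polarCoord_symm {E : Type*} [NormedAddCommGroup E] [NormedSpace ℝ E] {f : ℂ → E}
    (hf : Integrable f) :
    IntegrableOn (fun p : ℝ × ℝ => p.1 • f (Complex.polarCoord.symm p)) polarCoord.target := by
  have h1 : Integrable (fun p : ℝ × ℝ => f (Complex.measurableEquivRealProd.symm p)) :=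
    (Complex.volume_preserving_equiv_real_prod.symm _).integrable_comp_of_integrable hf
  have h2 := (integrableOn_image_iff_integrableOn_abs_det_fderiv_smul volume
    polarCoord.open_target.measurableSet
    (fun p _ => (hasFDerivAt_polarCoord_symm p).hasFDerivWithinAt)
    polarCoord.symm.injOn (fun p => f (Complex.measurableEquivRealProd.symm p))).1 h1.integrableOn
  refine h2.congr_fun (fun p hp => ?_) polarCoord.open_target.measurableSet
  simp only [det_fderivPolarCoordSymm, Complex.measurableEquivRealProd_symm_polarCoord_symm_apply]
  rw [abs_of_pos hp.1]

lemma integral_Ioo_circle {E : Type*} [NormedAddCommGroup E] [NormedSpace ℝ E] (f : ℂ → E) (r : ℝ) :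
    ∫ θ in Ioo (-Real.pi) Real.pi, r • f (Complex.polarCoord.symm (r, θ)) =
      (2 * Real.pi * r) • Real.circleAverage f 0 r := by
  rw [Real.circleAverage_eq_integral_add (-Real.pi),
    intervalIntegral.integral_comp_add_right (fun θ => f (circleMap 0 r θ)),
    integral_smul, smul_smul, zero_add, show 2 * Real.pi + -Real.pi = Real.pi by ring,
    intervalIntegral.integral_of_le (by linarith [Real.pi_pos]), integral_Ioc_eq_integral_Ioo]
  have hp := Real.pi_ne_zero
  congr 1
  · field_simp
  · refine integral_congr_ae (Eventually.of_forall fun θ => ?_)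
    simp only [Complex.polarCoord_symm_apply, circleMap, zero_add, Complex.exp_mul_I]
    push_cast
    rfl

lemma integral_eq_integral_circleAverage {E : Type*} [NormedAddCommGroup E] [NormedSpace ℝ E]
    {f : ℂ → E} (hf : Integrable f) :
    IntegrableOn (fun r : ℝ => (2 * Real.pi * r) • Real.circleAverage f 0 r) (Ioi 0) ∧
    ∫ z, f z = ∫ r in Ioi (0 : ℝ), (2 * Real.pi * r) • Real.circleAverage f 0 r := by
  have h := integrableOn_polarCoord_symm hf
  have h' : Integrable (fun p : ℝ × ℝ => p.1 • f (Complex.polarCoord.symm p))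
      ((volume.restrict (Ioi (0 : ℝ))).prod (volume.restrict (Ioo (-Real.pi) Real.pi))) := by
    rw [Measure.prod_restrict]; exact h
  simp only [← integral_Ioo_circle]
  refine ⟨h'.integral_prod_left, ?_⟩
  rw [← Complex.integral_comp_polarCoord_symm]
  exact setIntegral_prod _ h

lemma circleAverage_radial {b : ℝ → ℝ} {U : ℂ → ℂ} {r : ℝ} (hr : 0 < r) :
    Real.circleAverage (fun ζ => (b ‖ζ‖ : ℂ) * U ζ) 0 r = (b r : ℂ) * Real.circleAverage U 0 r := by
  rw [← smul_eq_mul, ← Real.circleAverage_fun_smul]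
  refine Real.circleAverage_congr_sphere fun ζ hζ => ?_
  rw [mem_sphere_zero_iff_norm, abs_of_pos hr] at hζ
  simp [hζ]

lemma circleAverage_radial_real {b : ℝ → ℝ} {U : ℂ → ℝ} {r : ℝ} (hr : 0 < r) :
    Real.circleAverage (fun ζ => b ‖ζ‖ * U ζ) 0 r = b r * Real.circleAverage U 0 r := by
  rw [← smul_eq_mul, ← Real.circleAverage_fun_smul]
  refine Real.circleAverage_congr_sphere fun ζ hζ => ?_
  rw [mem_sphere_zero_iff_norm, abs_of_pos hr] at hζ
  simp [hζ]

/-- The profile of a radial bump function. -/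
def bumpProfile (s r : ℝ) : ℝ :=
  (∫ ζ : ℂ, Real.smoothTransition (1 - ‖ζ‖ ^ 2 / s ^ 2))⁻¹ *
    Real.smoothTransition (1 - r ^ 2 / s ^ 2)

/-- A smooth nonnegative radial function supported in the disc of radius `s`, of integral one. -/
def bump (s : ℝ) (z : ℂ) : ℝ := bumpProfile s ‖z‖

lemma bumpProfile_nonneg (s r : ℝ) : 0 ≤ bumpProfile s r :=
  mul_nonneg (inv_nonneg.2 (integral_nonneg fun _ => Real.smoothTransition.nonneg _))
    (Real.smoothTransition.nonneg _)

lemma bump_nonneg (s : ℝ) (z : ℂ) : 0 ≤ bump s z := bumpProfile_nonneg _ _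

lemma smoothTransition_radial_eq_zero {s r : ℝ} (hs : 0 < s) (hr : s ≤ r) :
    Real.smoothTransition (1 - r ^ 2 / s ^ 2) = 0 := by
  apply Real.smoothTransition.zero_of_nonpos
  rw [sub_nonpos, le_div_iff₀ (by positivity), one_mul]
  gcongr

lemma bumpProfile_eq_zero {s r : ℝ} (hs : 0 < s) (hr : s ≤ r) : bumpProfile s r = 0 := by
  rw [bumpProfile, smoothTransition_radial_eq_zero hs hr, mul_zero]

lemma bump_eq_zero {s : ℝ} (hs : 0 < s) {z : ℂ} (hz : s ≤ ‖z‖) : bump s z = 0 :=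
  bumpProfile_eq_zero hs hz

lemma contDiff_smoothTransition_radial (s : ℝ) :
    ContDiff ℝ ∞ (fun ζ : ℂ => Real.smoothTransition (1 - ‖ζ‖ ^ 2 / s ^ 2)) :=
  Real.smoothTransition.contDiff.comp
    (contDiff_const.sub ((contDiff_norm_sq ℝ).div_const _))

lemma bump_contDiff (s : ℝ) : ContDiff ℝ ∞ (bump s) :=
  contDiff_const.mul (contDiff_smoothTransition_radial s)

lemma hasCompactSupport_of_norm_le {E : Type*} [Zero E] {f : ℂ → E} {s : ℝ}
    (h : ∀ z, s ≤ ‖z‖ → f z = 0) : HasCompactSupport f := by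
  refine HasCompactSupport.intro (isCompact_closedBall (0 : ℂ) s) fun z hz => h z ?_
  simp only [Metric.mem_closedBall, dist_zero_right, not_le] at hz
  exact hz.le

lemma bump_hasCompactSupport {s : ℝ} (hs : 0 < s) : HasCompactSupport (bump s) :=
  hasCompactSupport_of_norm_le fun _ => bump_eq_zero hs

lemma bump_integrable {s : ℝ} (hs : 0 < s) : Integrable (bump s) :=
  (bump_contDiff s).continuous.integrable_of_hasCompactSupport (bump_hasCompactSupport hs)

lemma integral_bump {s : ℝ} (hs : 0 < s) : ∫ z, bump s z = 1 := by
  have hpos : 0 < ∫ ζ : ℂ, Real.smoothTransition (1 - ‖ζ‖ ^ 2 / s ^ 2) := by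
    refine (contDiff_smoothTransition_radial s).continuous.integral_pos_of_hasCompactSupport_nonneg_nonzero
      (hasCompactSupport_of_norm_le fun z => smoothTransition_radial_eq_zero hs)
      (fun _ => Real.smoothTransition.nonneg _) (x := 0) ?_
    simp
  simp only [bump, bumpProfile]
  rw [integral_const_mul, inv_mul_cancel₀ hpos.ne']

lemma bump_mul_integrable {s R : ℝ} (hs : 0 < s) (hR : s < R) {U : ℂ → ℂ}
    (hU : ContinuousOn U (Metric.ball 0 R)) : Integrable (fun ζ => (bump s ζ : ℂ) * U ζ) := by
  have h1 : IntegrableOn (fun ζ => (bump s ζ : ℂ) * U ζ) (Metric.closedBall 0 s) :=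
    ContinuousOn.integrableOn_compact (isCompact_closedBall _ _)
      ((Complex.continuous_ofReal.comp (bump_contDiff s).continuous).continuousOn.mul
        (hU.mono (Metric.closedBall_subset_ball hR)))
  refine (integrableOn_iff_integrable_of_support_subset fun z hz => ?_).1 h1
  contrapose! hz
  simp only [Metric.mem_closedBall, dist_zero_right, not_le] at hz
  simp [bump_eq_zero hs hz.le]

lemma integral_bumpProfile {s : ℝ} (hs : 0 < s) :
    IntegrableOn (fun r => 2 * Real.pi * r * bumpProfile s r) (Ioi 0) ∧
    ∫ r in Ioi (0 : ℝ), 2 * Real.pi * r * bumpProfile s r = 1 := by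
  have h := integral_eq_integral_circleAverage (bump_integrable hs)
  have h2 : ∀ r ∈ Ioi (0 : ℝ), (2 * Real.pi * r) • Real.circleAverage (bump s) 0 r =
      2 * Real.pi * r * bumpProfile s r := by
    intro r hr
    rw [smul_eq_mul, ← Real.circleAverage_const (bumpProfile s r) 0 r]
    congr 1
    refine Real.circleAverage_congr_sphere fun ζ hζ => ?_
    rw [mem_sphere_zero_iff_norm, abs_of_pos hr] at hζ
    simp [bump, hζ]
  refine ⟨h.1.congr_fun h2 measurableSet_Ioi, ?_⟩
  rw [← setIntegral_congr_fun measurableSet_Ioi h2, ← h.2, integral_bump hs]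

/-- The mean value property holds on every circle of radius below $s$, and the profile has total
radial mass one. -/
lemma integral_bump_mul_of_differentiableOn {s R : ℝ} (hs : 0 < s) (hR : s < R) {U : ℂ → ℂ}
    (hU : DifferentiableOn ℂ U (Metric.ball 0 R)) : ∫ ζ, (bump s ζ : ℂ) * U ζ = U 0 := by
  have h := integral_eq_integral_circleAverage (bump_mul_integrable hs hR hU.continuousOn)
  rw [h.2]
  have h2 : ∀ r ∈ Ioi (0 : ℝ), (2 * Real.pi * r) •
      Real.circleAverage (fun ζ => (bump s ζ : ℂ) * U ζ) 0 r =
      (2 * Real.pi * r * bumpProfile s r) • U 0 := by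
    intro r hr
    have h3 := circleAverage_radial (b := bumpProfile s) (U := U) (r := r) hr
    simp only [bump]
    rw [h3]
    rcases le_or_gt s r with hsr | hsr
    · simp [bumpProfile_eq_zero hs hsr]
    · have h4 : Real.circleAverage U 0 r = U 0 := by
        refine DiffContOnCl.circleAverage ?_
        rw [abs_of_pos hr]
        exact hU.diffContOnCl_ball (Metric.closedBall_subset_ball (hsr.trans hR))
      rw [h4]
      simp only [Complex.real_smul]
      push_cast
      ring
  rw [setIntegral_congr_fun measurableSet_Ioi h2, integral_smul_const,
    (integral_bumpProfile hs).2, one_smul]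

lemma integral_bump_mul_sub_of_differentiableOn {s R : ℝ} (hs : 0 < s) (hR : s < R) {U : ℂ → ℂ}
    {z : ℂ} (hU : DifferentiableOn ℂ U (Metric.ball z R)) :
    ∫ ζ, (bump s ζ : ℂ) * U (z - ζ) = U z := by
  have := integral_bump_mul_of_differentiableOn hs hR (U := fun ζ => U (z - ζ)) ?_
  · simpa using this
  · refine hU.comp (by fun_prop) fun ζ hζ => ?_
    simpa using hζ

lemma bump_mul_sub_integrable {s : ℝ} (hs : 0 < s) {φ : ℂ → ℝ} (hφ : LocallyIntegrable φ) (z : ℂ) :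
    Integrable (fun ζ => bump s ζ * φ (z - ζ)) := by
  have h := (bump_hasCompactSupport hs).convolutionExists_left (ContinuousLinearMap.mul ℝ ℝ)
    (bump_contDiff s).continuous hφ z
  exact h.integrable

lemma circleAverage_comp_sub (φ : ℂ → ℝ) (z : ℂ) (r : ℝ) :
    Real.circleAverage (fun ζ => φ (z - ζ)) 0 r = Real.circleAverage φ z r := by
  rw [Real.circleAverage_eq_integral_add (f := φ) Real.pi, Real.circleAverage_def]
  congr 2
  ext θ
  congr 1
  simp [circleMap, add_mul, Complex.exp_add, Complex.exp_pi_mul_I]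
  ring

lemma IsSubharmonic.le_integral_bump {φ : ℂ → ℝ} (h : IsSubharmonic φ) (hφ : LocallyIntegrable φ)
    {s : ℝ} (hs : 0 < s) (z : ℂ) : φ z ≤ ∫ ζ, bump s ζ * φ (z - ζ) := by
  obtain ⟨h1, h2⟩ := integral_eq_integral_circleAverage (bump_mul_sub_integrable hs hφ z)
  obtain ⟨h3, h4⟩ := integral_bumpProfile hs
  rw [h2, ← one_mul (φ z), ← h4, ← integral_mul_const]
  refine setIntegral_mono_on (h3.mul_const _) h1 measurableSet_Ioi fun r hr => ?_
  have h5 := circleAverage_radial_real (b := bumpProfile s) (U := fun ζ => φ (z - ζ)) (r := r) hr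
  simp only [bump]
  rw [h5, circleAverage_comp_sub, smul_eq_mul, mul_assoc]
  have : 0 < r := hr
  have := h.le_circleAverage z r hr
  have := bumpProfile_nonneg s r
  gcongr

/-- The averages lie above $\phi(z)$ by the sub-mean-value inequality, and are at most
$\phi(z)+\epsilon$ in the limit by upper semicontinuity. Convergence holds at every point, so the
regularity derived from it belongs to $\phi$ itself and not to an almost-everywhere representative.
-/
lemma IsSubharmonic.tendsto_integral_bump {φ : ℂ → ℝ} (h : IsSubharmonic φ)
    (hφ : LocallyIntegrable φ) {s : ℕ → ℝ} (hs : ∀ k, 0 < s k) (hs0 : Tendsto s atTop (𝓝 0)) (z : ℂ) :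
    Tendsto (fun k => ∫ ζ, bump (s k) ζ * φ (z - ζ)) atTop (𝓝 (φ z)) := by
  rw [Metric.tendsto_atTop']
  intro ε hε
  have h1 := h.usc z (φ z + ε / 2) (by linarith)
  obtain ⟨δ, hδ, h2⟩ := Metric.eventually_nhds_iff.1 h1
  obtain ⟨N, hN⟩ := eventually_atTop.1 (hs0.eventually (gt_mem_nhds hδ))
  refine ⟨N, fun k hk => ?_⟩
  have h3 := h.le_integral_bump hφ (hs k) z
  have h4 : ∫ ζ, bump (s k) ζ * φ (z - ζ) ≤ φ z + ε / 2 := by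
    rw [← one_mul (φ z + ε / 2), ← integral_bump (hs k), ← integral_mul_const]
    refine integral_mono (bump_mul_sub_integrable (hs k) hφ z) ((bump_integrable (hs k)).mul_const _)
      fun ζ => ?_
    rcases le_or_gt (s k) ‖ζ‖ with hζ | hζ
    · simp [bump_eq_zero (hs k) hζ]
    · refine mul_le_mul_of_nonneg_left (h2 ?_).le (bump_nonneg _ _)
      simpa using hζ.trans (hN k hk.le)
  rw [Real.dist_eq, abs_of_nonneg (by linarith)]
  linarith

/-! ### Convolutions and the Cauchy transform -/

/-- The convolution of complex functions on the plane. -/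
def conv (f g : ℂ → ℂ) : ℂ → ℂ :=
  convolution f g (ContinuousLinearMap.mul ℝ ℂ) volume

lemma conv_apply (f g : ℂ → ℂ) (z : ℂ) : conv f g z = ∫ ζ, f ζ * g (z - ζ) := rfl

lemma conv_comm (f g : ℂ → ℂ) : conv f g = conv g f := by
  ext z
  rw [conv_apply, conv_apply, ← integral_sub_left_eq_self _ volume z]
  simp [mul_comm]

lemma conv_integrable {f u : ℂ → ℂ} (hf : LocallyIntegrable f) (hu : Continuous u)
    (hc : HasCompactSupport u) (z : ℂ) : Integrable (fun ζ => f ζ * u (z - ζ)) :=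
  hc.convolutionExists_right (ContinuousLinearMap.mul ℝ ℂ) hf hu z

lemma conv_integrable_of_bounded {f v : ℂ → ℂ} {M : ℝ} (hf : LocallyIntegrable f)
    (hv : Measurable v) (hM : ∀ z, ‖v z‖ ≤ M) (hc : HasCompactSupport v) (z : ℂ) :
    Integrable (fun ζ => f ζ * v (z - ζ)) := by
  have hK : IsCompact ((fun ζ => z - ζ) ⁻¹' tsupport v) := by
    have : (fun ζ => z - ζ) ⁻¹' tsupport v = (fun ζ => z - ζ) '' tsupport v := by
      ext x
      simp only [mem_preimage, mem_image]
      exact ⟨fun h => ⟨_, h, by simp⟩, fun ⟨y, hy, hx⟩ => by simpa [← hx] using hy⟩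
    rw [this]
    exact hc.isCompact.image (by fun_prop)
  refine BddAbove.convolutionExistsAt (ContinuousLinearMap.mul ℝ ℂ)
    (s := (fun ζ => z - ζ) ⁻¹' tsupport v) ?_ hK.measurableSet ?_
    (hf.integrableOn_isCompact hK) hv.aestronglyMeasurable
  · refine ⟨M, ?_⟩
    rintro _ ⟨x, -, rfl⟩
    exact hM x
  · intro ζ hζ
    apply subset_tsupport v
    contrapose! hζ
    simp only [Function.mem_support, not_not] at hζ ⊢
    simp [hζ]

lemma hasFDerivAt_conv {f u : ℂ → ℂ} (hf : LocallyIntegrable f) (hu : ContDiff ℝ 1 u)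
    (hc : HasCompactSupport u) (z : ℂ) :
    DifferentiableAt ℝ (conv f u) z ∧
      ∀ v, fderiv ℝ (conv f u) z v = conv f (fun w => fderiv ℝ u w v) z := by
  have h := hc.hasFDerivAt_convolution_right (ContinuousLinearMap.mul ℝ ℂ) hf hu z
  refine ⟨h.differentiableAt, fun v => ?_⟩
  have h' : HasFDerivAt (conv f u) _ z := h
  rw [h'.fderiv]
  exact convolution_precompR_apply (ContinuousLinearMap.mul ℝ ℂ) hf (hc.fderiv (𝕜 := ℝ))
    (hu.continuous_fderiv one_ne_zero) z v

lemma wirt_conv {f u : ℂ → ℂ} (hf : LocallyIntegrable f) (hu : ContDiff ℝ 1 u)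
    (hc : HasCompactSupport u) : wirt (conv f u) = conv f (wirt u) := by
  ext z
  have hi : ∀ v, Integrable (fun ζ => f ζ * fderiv ℝ u (z - ζ) v) := fun v =>
    conv_integrable hf ((hu.continuous_fderiv one_ne_zero).clm_apply continuous_const)
      (hc.fderiv_apply (𝕜 := ℝ) v) z
  simp only [wirt, (hasFDerivAt_conv hf hu hc z).2, conv_apply]
  rw [← integral_const_mul, ← integral_sub (hi 1) ((hi _).const_mul _), ← integral_const_mul]
  congr 1; ext ζ; ring

lemma dbar_conv {f u : ℂ → ℂ} (hf : LocallyIntegrable f) (hu : ContDiff ℝ 1 u)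
    (hc : HasCompactSupport u) : dbar (conv f u) = conv f (dbar u) := by
  ext z
  have hi : ∀ v, Integrable (fun ζ => f ζ * fderiv ℝ u (z - ζ) v) := fun v =>
    conv_integrable hf ((hu.continuous_fderiv one_ne_zero).clm_apply continuous_const)
      (hc.fderiv_apply (𝕜 := ℝ) v) z
  simp only [dbar, (hasFDerivAt_conv hf hu hc z).2, conv_apply]
  rw [← integral_const_mul, ← integral_add (hi 1) ((hi _).const_mul _), ← integral_const_mul]
  congr 1; ext ζ; ring

lemma conv_contDiff {f u : ℂ → ℂ} {n : ℕ} (hf : LocallyIntegrable f) (hu : ContDiff ℝ n u)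
    (hc : HasCompactSupport u) : ContDiff ℝ n (conv f u) :=
  hc.contDiff_convolution_right (ContinuousLinearMap.mul ℝ ℂ) hf (n := n) hu

lemma conv_contDiff_infty {f u : ℂ → ℂ} (hf : LocallyIntegrable f) (hu : ContDiff ℝ ∞ u)
    (hc : HasCompactSupport u) : ContDiff ℝ ∞ (conv f u) :=
  hc.contDiff_convolution_right (ContinuousLinearMap.mul ℝ ℂ) hf (n := ⊤) hu

lemma conv_hasCompactSupport {f u : ℂ → ℂ} (hf : HasCompactSupport f)
    (hc : HasCompactSupport u) : HasCompactSupport (conv f u) :=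
  hf.convolution _ hc

lemma conv_sub_right {f u v : ℂ → ℂ} {z : ℂ} (hu : Integrable (fun ζ => f ζ * u (z - ζ)))
    (hv : Integrable (fun ζ => f ζ * v (z - ζ))) : conv f (u - v) z = conv f u z - conv f v z := by
  simp only [conv_apply, Pi.sub_apply, mul_sub]
  exact integral_sub hu hv

lemma conv_assoc {f v k : ℂ → ℂ} {M : ℝ} (hf : LocallyIntegrable f)
    (hv : Measurable v) (hM : ∀ z, ‖v z‖ ≤ M) (hvc : HasCompactSupport v) (hk : Continuous k)
    (hkc : HasCompactSupport k) : conv (conv f v) k = conv f (conv v k) := by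
  have hvi : Integrable v := by
    rw [← integrableOn_iff_integrable_of_support_subset (subset_tsupport v)]
    exact Measure.integrableOn_of_bounded hvc.isCompact.measure_lt_top.ne
      hv.aestronglyMeasurable (Eventually.of_forall hM)
  ext z
  refine convolution_assoc _ _ _ _ (fun x y w => ?_) hf.aestronglyMeasurable
    hv.aestronglyMeasurable hk.aestronglyMeasurable
    (Eventually.of_forall fun x => conv_integrable_of_bounded hf hv hM hvc x)
    (Eventually.of_forall fun x => ?_) ?_
  · simp [mul_assoc]
  · exact hkc.norm.convolutionExists_right (ContinuousLinearMap.mul ℝ ℝ)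
      hvi.norm.locallyIntegrable hk.norm x
  · refine HasCompactSupport.convolutionExists_right (ContinuousLinearMap.mul ℝ ℝ)
      (hvc.norm.convolution _ hkc.norm) (fun x => (hf x).norm) ?_ z
    exact hkc.norm.continuous_convolution_right _ hvi.norm.locallyIntegrable hk.norm

/-- Since $v$ is merely bounded and measurable, continuity has to come from $f$: approximating $f$
in $L^1$ by continuous compactly supported functions gives uniform convergence of the convolutions.
-/
lemma conv_continuous_of_integrable {f v : ℂ → ℂ} {M : ℝ} (hf : Integrable f)
    (hv : Measurable v) (hM : ∀ z, ‖v z‖ ≤ M) : Continuous (conv f v) := by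
  have hint : ∀ k : ℂ → ℂ, Integrable k → ∀ z, Integrable (fun ζ => k ζ * v (z - ζ)) := by
    intro k hk z
    exact hk.mul_bdd (c := M) (hv.comp (measurable_const.sub measurable_id)).aestronglyMeasurable
      (Eventually.of_forall fun ζ => hM _)
  have hM0 : 0 ≤ M := (norm_nonneg _).trans (hM 0)
  choose k hkc hk hkcont hki using fun n : ℕ =>
    hf.exists_hasCompactSupport_integral_sub_le (ε := 1 / ((n : ℝ) + 1)) (by positivity)
  have hlv : LocallyIntegrable v := fun x => ⟨Metric.ball x 1, Metric.ball_mem_nhds _ one_pos,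
    Measure.integrableOn_of_bounded measure_ball_lt_top.ne hv.aestronglyMeasurable
      (Eventually.of_forall hM)⟩
  have hu : TendstoUniformly (fun n => conv (k n) v) (conv f v) atTop := by
    rw [Metric.tendstoUniformly_iff]
    intro ε hε
    have h1 : Tendsto (fun n : ℕ => 1 / ((n : ℝ) + 1) * M) atTop (𝓝 0) := by
      simpa using (tendsto_one_div_add_atTop_nhds_zero_nat (𝕜 := ℝ)).mul_const M
    filter_upwards [h1.eventually (gt_mem_nhds hε)] with n hn z
    refine lt_of_le_of_lt ?_ hn
    rw [dist_eq_norm, conv_apply, conv_apply, ← integral_sub (hint f hf z) (hint (k n) (hki n) z)]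
    refine (norm_integral_le_integral_norm _).trans ?_
    refine le_trans (integral_mono (g := fun ζ => ‖f ζ - k n ζ‖ * M)
      ((hint f hf z).sub (hint (k n) (hki n) z)).norm
      ((hf.sub (hki n)).norm.mul_const M) fun ζ => ?_) ?_
    · simp only [← sub_mul, norm_mul]
      gcongr
      exact hM _
    · rw [integral_mul_const]
      gcongr
      exact hk n
  exact hu.continuous (Frequently.of_forall fun n =>
    (hkc n).continuous_convolution_left _ (hkcont n) hlv)

lemma conv_eq_conv_indicator {f v : ℂ → ℂ} {z : ℂ} {s : Set ℂ}
    (h : ∀ ζ, ζ ∉ s → v (z - ζ) = 0) : conv f v z = conv (s.indicator f) v z := by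
  simp only [conv_apply]
  congr 1; ext ζ
  by_cases hζ : ζ ∈ s
  · simp [hζ]
  · simp [h ζ hζ]

lemma conv_continuous {f v : ℂ → ℂ} {M : ℝ} (hf : LocallyIntegrable f)
    (hv : Measurable v) (hM : ∀ z, ‖v z‖ ≤ M) (hc : HasCompactSupport v) :
    Continuous (conv f v) := by
  rw [continuous_iff_continuousAt]
  intro z
  -- For points within distance one of $z$ only the values of $f$ on one fixed disc enter, so $f$
  -- may be truncated to an integrable function.
  obtain ⟨R, hR⟩ := hc.isCompact.isBounded.subset_closedBall 0
  set s := Metric.closedBall (0 : ℂ) (‖z‖ + 1 + R)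
  have h1 : Continuous (conv (s.indicator f) v) := by
    refine conv_continuous_of_integrable ?_ hv hM
    rw [integrable_indicator_iff Metric.isClosed_closedBall.measurableSet]
    exact hf.integrableOn_isCompact (isCompact_closedBall _ _)
  refine h1.continuousAt.congr ?_
  filter_upwards [Metric.ball_mem_nhds z one_pos] with w hw
  refine (conv_eq_conv_indicator fun ζ hζ => ?_).symm
  by_contra hne
  have h2 := hR (subset_tsupport v hne)
  simp only [s, Metric.mem_closedBall, dist_zero_right, not_le] at h2 hζ
  have h3 : ‖ζ‖ ≤ ‖w - ζ‖ + ‖w - z‖ + ‖z‖ := by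
    have e : ζ = -(w - ζ) + (w - z) + z := by ring
    calc ‖ζ‖ = ‖-(w - ζ) + (w - z) + z‖ := by rw [← e]
      _ ≤ _ := norm_add₃_le.trans (by rw [norm_neg])
  rw [Metric.mem_ball, dist_eq_norm] at hw
  linarith

/-! ### The Cauchy transform and the Cauchy–Pompeiu formula. -/

/-- The Cauchy kernel, the fundamental solution of `∂̄`. -/
def cauchyKernel (z : ℂ) : ℂ := ((Real.pi : ℂ) * z)⁻¹

lemma cauchyKernel_locallyIntegrable : LocallyIntegrable cauchyKernel := by
  refine locallyIntegrable_of_norm_le_rpow (C := Real.pi⁻¹) (α := 1) (by simp)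
    (by simp) (Eventually.of_forall fun z => le_of_eq ?_) ?_
  · rw [cauchyKernel, mul_inv, norm_mul, norm_inv, norm_inv, Real.rpow_neg_one]
    simp [abs_of_pos Real.pi_pos]
  · unfold cauchyKernel
    exact (by fun_prop : Measurable fun z : ℂ => ((Real.pi : ℂ) * z)⁻¹).aestronglyMeasurable

/-- The bound depends only on the radius and on the sup norm of $v$; this is the source of
uniformity in the centre $a$ later on. -/
lemma norm_conv_cauchyKernel_le {v : ℂ → ℂ} {M R : ℝ} {z : ℂ} (hM : ∀ z, ‖v z‖ ≤ M)
    (h : ∀ ζ, R ≤ ‖ζ‖ → v (z - ζ) = 0) :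
    ‖conv cauchyKernel v z‖ ≤ (∫ ζ in Metric.ball 0 R, ‖cauchyKernel ζ‖) * M := by
  have hint : IntegrableOn (fun ζ => ‖cauchyKernel ζ‖) (Metric.ball 0 R) :=
    ((cauchyKernel_locallyIntegrable.integrableOn_isCompact (isCompact_closedBall 0 R)).mono_set
      Metric.ball_subset_closedBall).norm
  have hs : ∀ ζ, ζ ∉ Metric.ball (0 : ℂ) R → v (z - ζ) = 0 := fun ζ hζ => h ζ (by simpa using hζ)
  rw [conv_eq_conv_indicator hs, conv_apply]
  rw [← integral_mul_const, ← integral_indicator Metric.isOpen_ball.measurableSet]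
  refine norm_integral_le_of_norm_le
    ((integrable_indicator_iff Metric.isOpen_ball.measurableSet).2 (hint.mul_const M))
    (Eventually.of_forall fun ζ => ?_)
  by_cases hζ : ζ ∈ Metric.ball (0 : ℂ) R
  · simp only [hζ, indicator_of_mem, norm_mul]
    gcongr
    exact hM _
  · simp [hζ]

lemma integrableOn_polar_target {G : ℝ × ℝ → ℂ} {R : ℝ} (hG : Continuous G)
    (h : ∀ r θ, R ≤ r → G (r, θ) = 0) : IntegrableOn G polarCoord.target := by
  have h1 : IntegrableOn G (Icc 0 R ×ˢ Icc (-Real.pi) Real.pi) :=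
    hG.continuousOn.integrableOn_compact (isCompact_Icc.prod isCompact_Icc)
  refine h1.of_forall_sdiff_eq_zero polarCoord.open_target.measurableSet fun p hp => ?_
  obtain ⟨⟨hp1, hp2⟩, hp3⟩ := hp
  refine h p.1 p.2 ?_
  by_contra hlt
  exact hp3 ⟨⟨le_of_lt hp1, by linarith⟩, ⟨hp2.1.le, hp2.2.le⟩⟩

/-- In polar coordinates the Jacobian cancels the singularity of the kernel, and the integrand
becomes $\frac1{2\pi}(\partial_rU+\frac ir\partial_\theta U)$. The radial part integrates to $-U(0)$
along each ray, the angular part to zero on each circle. -/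
lemma integral_cauchyKernel_mul_dbar {U : ℂ → ℂ} (hU : ContDiff ℝ 1 U) (hc : HasCompactSupport U) :
    ∫ ζ, cauchyKernel ζ * dbar U ζ = -U 0 := by
  obtain ⟨R, hR⟩ := (hc.fderiv (𝕜 := ℝ)).isCompact.isBounded.subset_closedBall 0
  set R' := |R| + 1 with hR'
  have hD0 : ∀ r θ : ℝ, R' ≤ r → fderiv ℝ U (r * Complex.exp (θ * Complex.I)) = 0 := by
    intro r θ hr
    by_contra hne
    have h2 := hR (subset_tsupport _ hne)
    have h0 : 0 ≤ r := by linarith [abs_nonneg R]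
    simp only [Metric.mem_closedBall, dist_zero_right, norm_mul, Complex.norm_exp_ofReal_mul_I,
      mul_one, Complex.norm_real, Real.norm_eq_abs, abs_of_nonneg h0] at h2
    linarith [le_abs_self R]
  have hDc : Continuous (fderiv ℝ U) := hU.continuous_fderiv one_ne_zero
  set e : ℝ → ℂ := fun θ => Complex.exp (θ * Complex.I) with he
  have hec : Continuous e := by fun_prop
  -- `G₁` is $\partial_rU$ and `G₂` is $r^{-1}\partial_\theta U$, both at $re^{i\theta}$.
  set G₁ : ℝ × ℝ → ℂ := fun p => fderiv ℝ U (p.1 * e p.2) (e p.2) with hG₁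
  set G₂ : ℝ × ℝ → ℂ := fun p => fderiv ℝ U (p.1 * e p.2) (Complex.I * e p.2) with hG₂
  have hG₁i : IntegrableOn G₁ polarCoord.target := by
    refine integrableOn_polar_target (R := R') ?_ fun r θ hr => by simp [hG₁, he, hD0 r θ hr]
    exact (hDc.comp (by fun_prop)).clm_apply (by fun_prop)
  have hG₂i : IntegrableOn G₂ polarCoord.target := by
    refine integrableOn_polar_target (R := R') ?_ fun r θ hr => by simp [hG₂, he, hD0 r θ hr]
    exact (hDc.comp (by fun_prop)).clm_apply (by fun_prop)
  have hI₁ : ∫ p in polarCoord.target, G₁ p = -(2 * Real.pi * U 0) := by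
    have h1 : ∫ p in polarCoord.target, G₁ p =
        ∫ θ in Ioo (-Real.pi) Real.pi, ∫ r in Ioi (0 : ℝ), G₁ (r, θ) := by
      have hi : Integrable G₁ ((volume.restrict (Ioi (0 : ℝ))).prod
          (volume.restrict (Ioo (-Real.pi) Real.pi))) := by
        rw [Measure.prod_restrict]; exact hG₁i
      rw [← integral_prod_symm _ hi, Measure.prod_restrict]
      rfl
    rw [h1]
    have h2 : ∀ θ : ℝ, ∫ r in Ioi (0 : ℝ), G₁ (r, θ) = -U 0 := by
      intro θ
      have hd : ∀ r : ℝ, HasDerivAt (fun r : ℝ => U (r * e θ)) (G₁ (r, θ)) r := by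
        intro r
        have h3 : HasDerivAt (fun r : ℝ => (r : ℂ) * e θ) (e θ) r := by
          simpa using (Complex.ofRealCLM.hasDerivAt (x := r)).mul_const (e θ)
        exact ((hU.differentiable one_ne_zero) _).hasFDerivAt.comp_hasDerivAt r h3
      have h4 : ContDiff ℝ 1 (fun r : ℝ => U (r * e θ)) :=
        hU.comp (Complex.ofRealCLM.contDiff.mul contDiff_const)
      have h5 : HasCompactSupport (fun r : ℝ => U (r * e θ)) := by
        obtain ⟨S, hS⟩ := hc.isCompact.isBounded.subset_closedBall 0
        refine HasCompactSupport.intro (isCompact_Icc (a := -S) (b := S)) fun r hr => ?_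
        by_contra hne
        have h6 := hS (subset_tsupport _ hne)
        simp only [he, Metric.mem_closedBall, dist_zero_right, norm_mul,
          Complex.norm_exp_ofReal_mul_I, mul_one, Complex.norm_real, Real.norm_eq_abs] at h6
        exact hr (abs_le.1 h6)
      have h7 := h5.integral_Ioi_deriv_eq h4 0
      simpa [fun r => (hd r).deriv] using h7
    simp only [h2, integral_const]
    simp only [MeasurableSet.univ, measureReal_restrict_apply, univ_inter, Real.volume_real_Ioo,
      sub_neg_eq_add, Complex.real_smul]
    rw [max_eq_left (by linarith [Real.pi_pos])]
    push_cast; ring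
  have hI₂ : ∫ p in polarCoord.target, G₂ p = 0 := by
    have h1 : ∫ p in polarCoord.target, G₂ p =
        ∫ r in Ioi (0 : ℝ), ∫ θ in Ioo (-Real.pi) Real.pi, G₂ (r, θ) := setIntegral_prod _ hG₂i
    rw [h1]
    refine setIntegral_eq_zero_of_forall_eq_zero fun r hr => ?_
    have hd : ∀ θ : ℝ, HasDerivAt (fun θ : ℝ => U (r * e θ)) ((r : ℂ) * G₂ (r, θ)) θ := by
      intro θ
      have h3 : HasDerivAt (fun θ : ℝ => (r : ℂ) * e θ) (r • (Complex.I * e θ)) θ := by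
        have h4 : HasDerivAt (fun θ : ℝ => (θ : ℂ) * Complex.I) Complex.I θ := by
          simpa using (Complex.ofRealCLM.hasDerivAt (x := θ)).mul_const Complex.I
        have h5 := (h4.cexp).const_mul (r : ℂ)
        refine h5.congr_deriv ?_
        rw [Complex.real_smul]
        simp only [he]; ring
      have h6 := ((hU.differentiable one_ne_zero) _).hasFDerivAt.comp_hasDerivAt θ h3
      rw [map_smul, Complex.real_smul] at h6
      exact h6
    have hcont : Continuous fun θ : ℝ => (r : ℂ) * G₂ (r, θ) :=
      continuous_const.mul ((hDc.comp (by fun_prop)).clm_apply (by fun_prop))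
    have h8 := intervalIntegral.integral_eq_sub_of_hasDerivAt (a := -Real.pi) (b := Real.pi)
      (fun θ _ => hd θ) (hcont.intervalIntegrable _ _)
    have h9 : e Real.pi = e (-Real.pi) := by
      simp only [he, Complex.ofReal_neg, neg_mul, Complex.exp_neg, Complex.exp_pi_mul_I]
      norm_num
    rw [h9, sub_self, intervalIntegral.integral_of_le (by linarith [Real.pi_pos]),
      integral_Ioc_eq_integral_Ioo, integral_const_mul] at h8
    have hr0 : (r : ℂ) ≠ 0 := by
      have : 0 < r := hr
      exact_mod_cast this.ne'
    exact (mul_eq_zero.1 h8).resolve_left hr0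
  rw [← Complex.integral_comp_polarCoord_symm]
  have hp : ∀ p ∈ polarCoord.target,
      p.1 • (cauchyKernel (Complex.polarCoord.symm p) * dbar U (Complex.polarCoord.symm p)) =
      (2 * Real.pi : ℂ)⁻¹ * (G₁ p + Complex.I * G₂ p) := by
    intro p hp
    have hp1 : (p.1 : ℂ) ≠ 0 := by
      have : 0 < p.1 := hp.1
      exact_mod_cast this.ne'
    have hpi : (Real.pi : ℂ) ≠ 0 := by exact_mod_cast Real.pi_ne_zero
    have h1 : Complex.polarCoord.symm p = p.1 * e p.2 := by
      rw [Complex.polarCoord_symm_apply]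
      simp only [he, Complex.exp_mul_I]
      push_cast; rfl
    have hlin : ∀ v : ℂ, fderiv ℝ U (p.1 * e p.2) v = v.re * fderiv ℝ U (p.1 * e p.2) 1 +
        v.im * fderiv ℝ U (p.1 * e p.2) Complex.I := by
      intro v
      generalize fderiv ℝ U (p.1 * e p.2) = D
      rw [← Complex.real_smul, ← Complex.real_smul, ← map_smul, ← map_smul, ← map_add]
      congr 1
      apply Complex.ext <;> simp
    have hee : e p.2 = Real.cos p.2 + Real.sin p.2 * Complex.I := by
      simp only [he, Complex.exp_mul_I]; push_cast; rfl
    have hne : e p.2 ≠ 0 := Complex.exp_ne_zero _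
    have hsq : ((Real.cos p.2 : ℂ)) ^ 2 + (Real.sin p.2 : ℂ) ^ 2 = 1 := by
      exact_mod_cast Real.cos_sq_add_sin_sq p.2
    have hinv : (e p.2)⁻¹ = Real.cos p.2 - Real.sin p.2 * Complex.I := by
      refine inv_eq_of_mul_eq_one_right ?_
      rw [hee]
      linear_combination hsq - (Real.sin p.2 : ℂ) ^ 2 * Complex.I_mul_I
    rw [h1]
    have hre : (e p.2).re = Real.cos p.2 := Complex.exp_ofReal_mul_I_re _
    have him : (e p.2).im = Real.sin p.2 := Complex.exp_ofReal_mul_I_im _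
    have hG1 : G₁ p = Real.cos p.2 * fderiv ℝ U (p.1 * e p.2) 1 +
        Real.sin p.2 * fderiv ℝ U (p.1 * e p.2) Complex.I := by
      simp only [hG₁]; rw [hlin (e p.2), hre, him]
    have hG2 : G₂ p = -Real.sin p.2 * fderiv ℝ U (p.1 * e p.2) 1 +
        Real.cos p.2 * fderiv ℝ U (p.1 * e p.2) Complex.I := by
      simp only [hG₂]; rw [hlin (Complex.I * e p.2)]
      simp only [Complex.mul_re, Complex.mul_im, Complex.I_re, Complex.I_im, hre, him]
      push_cast; ring
    rw [hG1, hG2, Complex.real_smul, cauchyKernel, dbar, mul_inv, mul_inv, hinv, mul_inv]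
    set a := fderiv ℝ U (p.1 * e p.2) 1
    set b := fderiv ℝ U (p.1 * e p.2) Complex.I
    field_simp
    linear_combination (-(Real.sin p.2 : ℂ) * b) * Complex.I_mul_I
  rw [setIntegral_congr_fun polarCoord.open_target.measurableSet hp, integral_const_mul,
    integral_add hG₁i (hG₂i.const_mul _), integral_const_mul, hI₁, hI₂]
  have hpi : (Real.pi : ℂ) ≠ 0 := by exact_mod_cast Real.pi_ne_zero
  field_simp
  ring

lemma fderiv_comp_const_sub_apply {u : ℂ → ℂ} (z ζ v : ℂ) (hu : DifferentiableAt ℝ u (z - ζ)) :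
    fderiv ℝ (fun w => u (z - w)) ζ v = -fderiv ℝ u (z - ζ) v := by
  have h := hu.hasFDerivAt.comp ζ ((hasFDerivAt_id (𝕜 := ℝ) ζ).const_sub z)
  have h' : HasFDerivAt (fun w => u (z - w)) _ ζ := h
  rw [h'.fderiv]
  simp

lemma dbar_comp_const_sub {u : ℂ → ℂ} (z ζ : ℂ) (hu : DifferentiableAt ℝ u (z - ζ)) :
    dbar (fun w => u (z - w)) ζ = -dbar u (z - ζ) := by
  simp only [dbar, fderiv_comp_const_sub_apply z ζ _ hu]
  ring

lemma wirt_comp_const_sub {u : ℂ → ℂ} (z ζ : ℂ) (hu : DifferentiableAt ℝ u (z - ζ)) :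
    wirt (fun w => u (z - w)) ζ = -wirt u (z - ζ) := by
  simp only [wirt, fderiv_comp_const_sub_apply z ζ _ hu]
  ring

/-- The Cauchy-Pompeiu formula for compactly supported functions. -/
lemma conv_cauchyKernel_dbar {u : ℂ → ℂ} (hu : ContDiff ℝ 1 u) (hc : HasCompactSupport u) :
    conv cauchyKernel (dbar u) = u := by
  ext z
  have h := integral_cauchyKernel_mul_dbar (U := fun w => u (z - w))
    (hu.comp (contDiff_const.sub contDiff_id)) (hc.comp_homeomorph (Homeomorph.subLeft z))
  simp only [fun ζ => dbar_comp_const_sub z ζ (hu.differentiable one_ne_zero _), mul_neg, integral_neg, neg_inj, sub_zero] at h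
  exact h

lemma dbar_conv_cauchyKernel {u : ℂ → ℂ} (hu : ContDiff ℝ 1 u) (hc : HasCompactSupport u) :
    dbar (conv cauchyKernel u) = u := by
  rw [dbar_conv cauchyKernel_locallyIntegrable hu hc, conv_cauchyKernel_dbar hu hc]

/-! ### Weights with bounded Laplacian are of class `C¹` -/

lemma natCast_le_infty (n : ℕ) : (n : WithTop ℕ∞) ≤ (∞ : WithTop ℕ∞) := by
  exact_mod_cast le_top

lemma one_le_infty : (1 : WithTop ℕ∞) ≤ (∞ : WithTop ℕ∞) := natCast_le_infty 1

lemma two_le_infty : (2 : WithTop ℕ∞) ≤ (∞ : WithTop ℕ∞) := natCast_le_infty 2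

lemma LocallyIntegrable.ofReal_complex {f : ℂ → ℝ} (h : LocallyIntegrable f) :
    LocallyIntegrable (fun z => (f z : ℂ)) := fun x => by
  obtain ⟨s, hs, hi⟩ := h x
  exact ⟨s, hs, hi.ofReal⟩

lemma wirt_add_I_mul {A B : ℂ → ℂ} {z : ℂ} (hA : DifferentiableAt ℝ A z)
    (hB : DifferentiableAt ℝ B z) :
    wirt (fun w => A w + Complex.I * B w) z = wirt A z + Complex.I * wirt B z := by
  simp only [wirt, fderiv_fun_add hA (hB.const_mul Complex.I), fderiv_const_mul hB,
    add_apply, smul_apply, smul_eq_mul]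
  ring

lemma dbar_add_I_mul {A B : ℂ → ℂ} {z : ℂ} (hA : DifferentiableAt ℝ A z)
    (hB : DifferentiableAt ℝ B z) :
    dbar (fun w => A w + Complex.I * B w) z = dbar A z + Complex.I * dbar B z := by
  simp only [dbar, fderiv_fun_add hA (hB.const_mul Complex.I), fderiv_const_mul hB,
    add_apply, smul_apply, smul_eq_mul]
  ring

lemma wirt_dbar_eq_lap_re_im {u : ℂ → ℂ} (hu : ContDiff ℝ ∞ u) (z : ℂ) :
    wirt (dbar u) z = (lap (fun w => (u w).re) z : ℂ) +
      Complex.I * (lap (fun w => (u w).im) z : ℂ) := by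
  have hre : ContDiff ℝ ∞ (fun w => (u w).re) := Complex.reCLM.contDiff.comp hu
  have him : ContDiff ℝ ∞ (fun w => (u w).im) := Complex.imCLM.contDiff.comp hu
  have hre' : ContDiff ℝ ∞ (fun w => ((u w).re : ℂ)) := Complex.ofRealCLM.contDiff.comp hre
  have him' : ContDiff ℝ ∞ (fun w => ((u w).im : ℂ)) := Complex.ofRealCLM.contDiff.comp him
  have h1 : u = fun w => ((u w).re : ℂ) + Complex.I * ((u w).im : ℂ) := by
    ext w
    rw [mul_comm, Complex.re_add_im]
  have h2 : dbar u = fun w => dbar (fun w => ((u w).re : ℂ)) w +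
      Complex.I * dbar (fun w => ((u w).im : ℂ)) w := by
    ext w
    conv_lhs => rw [h1]
    exact dbar_add_I_mul (hre'.differentiable (by simp) w) (him'.differentiable (by simp) w)
  rw [h2, wirt_add_I_mul ((dbar_contDiff_infty hre').differentiable (by simp) z)
    ((dbar_contDiff_infty him').differentiable (by simp) z),
    (dbar_wirt_eq_lap (hre.contDiffAt.of_le two_le_infty)).2,
    (dbar_wirt_eq_lap (him.contDiffAt.of_le two_le_infty)).2]

lemma lap_continuous {u : ℂ → ℝ} (hu : ContDiff ℝ 2 u) : Continuous (lap u) := by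
  have h1 : ContDiff ℝ ((1 + 1 : ℕ)) (fun w => (u w : ℂ)) :=
    Complex.ofRealCLM.contDiff.comp (hu.of_le (by norm_num))
  have h2 := (dbar_contDiff (n := 0) (wirt_contDiff (n := 1) h1)).continuous
  have h3 : lap u = fun z => (dbar (wirt fun w => (u w : ℂ)) z).re := by
    ext z
    rw [(dbar_wirt_eq_lap hu.contDiffAt).1, Complex.ofReal_re]
  rw [h3]
  exact Complex.continuous_re.comp h2

lemma lap_hasCompactSupport {u : ℂ → ℝ} (hu : ContDiff ℝ 2 u) (hc : HasCompactSupport u) :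
    HasCompactSupport (lap u) := by
  have h1 : HasCompactSupport (fun w => (u w : ℂ)) := hc.comp_left Complex.ofReal_zero
  have h2 := dbar_hasCompactSupport (wirt_hasCompactSupport h1)
  have h3 : lap u = fun z => (dbar (wirt fun w => (u w : ℂ)) z).re := by
    ext z
    rw [(dbar_wirt_eq_lap hu.contDiffAt).1, Complex.ofReal_re]
  rw [h3]
  exact h2.comp_left Complex.zero_re

lemma IsDistribLaplacian.integral_wirt_dbar {φ g : ℂ → ℝ} (h : IsDistribLaplacian φ g) {u : ℂ → ℂ}
    (hu : ContDiff ℝ ∞ u) (hc : HasCompactSupport u) :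
    ∫ z, (φ z : ℂ) * wirt (dbar u) z = ∫ z, (g z : ℂ) * u z := by
  have hre : ContDiff ℝ ∞ (fun w => (u w).re) := Complex.reCLM.contDiff.comp hu
  have him : ContDiff ℝ ∞ (fun w => (u w).im) := Complex.imCLM.contDiff.comp hu
  have hrc : HasCompactSupport (fun w => (u w).re) := hc.comp_left Complex.zero_re
  have hic : HasCompactSupport (fun w => (u w).im) := hc.comp_left Complex.zero_im
  have e2 := two_le_infty
  have key : ∀ f : ℂ → ℝ, LocallyIntegrable f → ∀ k : ℂ → ℝ, Continuous k → HasCompactSupport k →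
      Integrable (fun z => ((f z * k z : ℝ) : ℂ)) := by
    intro f hf k hk hkc
    exact (hf.integrable_smul_right_of_hasCompactSupport hk hkc).ofReal
  have h1 : ∀ z, (φ z : ℂ) * wirt (dbar u) z =
      ((φ z * lap (fun w => (u w).re) z : ℝ) : ℂ) +
      Complex.I * ((φ z * lap (fun w => (u w).im) z : ℝ) : ℂ) := by
    intro z
    rw [wirt_dbar_eq_lap_re_im hu]
    push_cast; ring
  have h2 : ∀ z, (g z : ℂ) * u z = ((g z * (u z).re : ℝ) : ℂ) +
      Complex.I * ((g z * (u z).im : ℝ) : ℂ) := by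
    intro z
    conv_lhs => rw [← Complex.re_add_im (u z)]
    push_cast; ring
  simp only [h1, h2]
  rw [integral_add (key φ h.locInt_left _ (lap_continuous (hre.of_le e2))
      (lap_hasCompactSupport (hre.of_le e2) hrc))
    ((key φ h.locInt_left _ (lap_continuous (him.of_le e2))
      (lap_hasCompactSupport (him.of_le e2) hic)).const_mul _),
    integral_add (key g h.locInt_right _ hre.continuous hrc)
      ((key g h.locInt_right _ him.continuous hic).const_mul _),
    integral_const_mul, integral_const_mul, integral_complex_ofReal, integral_complex_ofReal,
    integral_complex_ofReal, integral_complex_ofReal, h.integral_eq _ hre hrc,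
    h.integral_eq _ him hic]

lemma IsDistribLaplacian.conv_wirt_dbar {φ g : ℂ → ℝ} (h : IsDistribLaplacian φ g) {u : ℂ → ℂ}
    (hu : ContDiff ℝ ∞ u) (hc : HasCompactSupport u) (z : ℂ) :
    conv (fun w => (φ w : ℂ)) (wirt (dbar u)) z = conv (fun w => (g w : ℂ)) u z := by
  have h1 := h.integral_wirt_dbar (u := fun w => u (z - w))
    (hu.comp (contDiff_const.sub contDiff_id)) (hc.comp_homeomorph (Homeomorph.subLeft z))
  have h2 : dbar (fun w => u (z - w)) = -fun w => dbar u (z - w) := by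
    ext w
    exact dbar_comp_const_sub z w (hu.differentiable (by simp) _)
  have h3 : wirt (dbar (fun w => u (z - w))) = fun w => wirt (dbar u) (z - w) := by
    ext w
    rw [h2, wirt_neg, Pi.neg_apply,
      wirt_comp_const_sub z w ((dbar_contDiff_infty hu).differentiable (by simp) _), neg_neg]
  rw [h3] at h1
  exact h1

/-! ### Local solutions of $\bar\partial w=\Delta\phi$ and the mollified gradient of the weight. -/

/-- A smooth cutoff function, equal to one on the disc of radius two and vanishing outside the disc
of radius three. -/
def cutoff (z : ℂ) : ℝ := Real.smoothTransition ((9 - ‖z‖ ^ 2) / 5)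

lemma cutoff_contDiff : ContDiff ℝ ∞ cutoff :=
  Real.smoothTransition.contDiff.comp ((contDiff_const.sub (contDiff_norm_sq ℝ)).div_const _)

lemma cutoff_eq_one {z : ℂ} (hz : ‖z‖ ≤ 2) : cutoff z = 1 := by
  apply Real.smoothTransition.one_of_one_le
  have := norm_nonneg z
  rw [le_div_iff₀ (by norm_num)]
  nlinarith

lemma cutoff_eq_zero {z : ℂ} (hz : 3 ≤ ‖z‖) : cutoff z = 0 := by
  apply Real.smoothTransition.zero_of_nonpos
  apply div_nonpos_of_nonpos_of_nonneg _ (by norm_num)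
  nlinarith

lemma abs_cutoff_le (z : ℂ) : |cutoff z| ≤ 1 := by
  rw [cutoff, abs_of_nonneg (Real.smoothTransition.nonneg _)]
  exact Real.smoothTransition.le_one _

lemma cutoff_hasCompactSupport : HasCompactSupport cutoff :=
  hasCompactSupport_of_norm_le fun _ => cutoff_eq_zero

/-- The function `g`, cut off around the point `a`. -/
def localize (g : ℂ → ℝ) (a z : ℂ) : ℂ := (cutoff (z - a) : ℂ) * (g z : ℂ)

lemma localize_eq {g : ℂ → ℝ} {a z : ℂ} (hz : ‖z - a‖ ≤ 2) : localize g a z = g z := by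
  simp [localize, cutoff_eq_one hz]

lemma localize_eq_zero {g : ℂ → ℝ} {a z : ℂ} (hz : 3 ≤ ‖z - a‖) : localize g a z = 0 := by
  simp [localize, cutoff_eq_zero hz]

lemma norm_localize_le {g : ℂ → ℝ} {M : ℝ} (hM : ∀ z, |g z| ≤ M) (a z : ℂ) :
    ‖localize g a z‖ ≤ M := by
  rw [localize, norm_mul, Complex.norm_real, Complex.norm_real, Real.norm_eq_abs, Real.norm_eq_abs]
  calc |cutoff (z - a)| * |g z| ≤ 1 * M :=
      mul_le_mul (abs_cutoff_le _) (hM z) (abs_nonneg _) zero_le_one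
    _ = M := one_mul M

lemma localize_measurable {g : ℂ → ℝ} (hg : Measurable g) (a : ℂ) : Measurable (localize g a) := by
  have : Measurable cutoff := cutoff_contDiff.continuous.measurable
  unfold localize
  fun_prop

lemma cutoff_sub_hasCompactSupport (a : ℂ) :
    HasCompactSupport (fun z => (cutoff (z - a) : ℂ)) :=
  (cutoff_hasCompactSupport.comp_homeomorph (Homeomorph.subRight a)).comp_left Complex.ofReal_zero

lemma localize_hasCompactSupport (g : ℂ → ℝ) (a : ℂ) : HasCompactSupport (localize g a) :=
  (cutoff_sub_hasCompactSupport a).mul_right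

/-- A bounded solution of `∂̄ w = g` near the point `a`. -/
def cauchyLocal (g : ℂ → ℝ) (a : ℂ) : ℂ → ℂ := conv cauchyKernel (localize g a)

lemma cauchyLocal_continuous {g : ℂ → ℝ} {M : ℝ} (hg : Measurable g) (hM : ∀ z, |g z| ≤ M) (a : ℂ) :
    Continuous (cauchyLocal g a) :=
  conv_continuous cauchyKernel_locallyIntegrable (localize_measurable hg a) (norm_localize_le hM a)
    (localize_hasCompactSupport g a)

/-- The complex-valued radial bump function. -/
def cbump (s : ℝ) (z : ℂ) : ℂ := bump s z

lemma cbump_contDiff (s : ℝ) : ContDiff ℝ ∞ (cbump s) :=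
  Complex.ofRealCLM.contDiff.comp (bump_contDiff s)

lemma cbump_hasCompactSupport {s : ℝ} (hs : 0 < s) : HasCompactSupport (cbump s) :=
  (bump_hasCompactSupport hs).comp_left Complex.ofReal_zero

lemma cbump_eq_zero {s : ℝ} (hs : 0 < s) {z : ℂ} (hz : s ≤ ‖z‖) : cbump s z = 0 := by
  simp [cbump, bump_eq_zero hs hz]

/-- A `∂̄`-primitive of the difference of two radial bump functions. -/
def bumpPrimitive (s t : ℝ) : ℂ → ℂ := conv cauchyKernel (cbump s - cbump t)

/-- The kernel is holomorphic on the disc of radius $|z|$ about $z$, so averaging it radially over a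
smaller radius changes nothing. -/
lemma conv_cauchyKernel_cbump {s : ℝ} (hs : 0 < s) {z : ℂ} (hz : s < ‖z‖) :
    conv cauchyKernel (cbump s) z = cauchyKernel z := by
  rw [conv_comm]
  refine integral_bump_mul_sub_of_differentiableOn hs hz ?_
  intro ζ hζ
  have h0 : ζ ≠ 0 := by
    rintro rfl
    simp at hζ
  have hpi : (Real.pi : ℂ) ≠ 0 := by exact_mod_cast Real.pi_ne_zero
  unfold cauchyKernel
  exact ((differentiableAt_id.const_mul _).inv (mul_ne_zero hpi h0)).differentiableWithinAt

/-- Outside both supports the two transforms equal the same kernel and cancel. The primitive is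
therefore compactly supported and can serve as a test function. -/
lemma bumpPrimitive_eq_zero {s t R : ℝ} (hs : 0 < s) (ht : 0 < t) (hsR : s < R) (htR : t < R) {z : ℂ}
    (hz : R ≤ ‖z‖) : bumpPrimitive s t z = 0 := by
  rw [bumpPrimitive, conv_sub_right, conv_cauchyKernel_cbump hs (hsR.trans_le hz),
    conv_cauchyKernel_cbump ht (htR.trans_le hz), sub_self]
  · exact conv_integrable cauchyKernel_locallyIntegrable (cbump_contDiff s).continuous
      (cbump_hasCompactSupport hs) z
  · exact conv_integrable cauchyKernel_locallyIntegrable (cbump_contDiff t).continuous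
      (cbump_hasCompactSupport ht) z

lemma cbump_sub_hasCompactSupport {s t : ℝ} (hs : 0 < s) (ht : 0 < t) :
    HasCompactSupport (cbump s - cbump t) :=
  (cbump_hasCompactSupport hs).sub (cbump_hasCompactSupport ht)

lemma bumpPrimitive_contDiff {s t : ℝ} (hs : 0 < s) (ht : 0 < t) :
    ContDiff ℝ ∞ (bumpPrimitive s t) :=
  conv_contDiff_infty cauchyKernel_locallyIntegrable ((cbump_contDiff s).sub (cbump_contDiff t))
    (cbump_sub_hasCompactSupport hs ht)

lemma dbar_bumpPrimitive {s t : ℝ} (hs : 0 < s) (ht : 0 < t) :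
    dbar (bumpPrimitive s t) = cbump s - cbump t :=
  dbar_conv_cauchyKernel (((cbump_contDiff s).sub (cbump_contDiff t)).of_le
    (by exact_mod_cast le_top)) (cbump_sub_hasCompactSupport hs ht)

lemma bumpPrimitive_hasCompactSupport {s t : ℝ} (hs : 0 < s) (ht : 0 < t) :
    HasCompactSupport (bumpPrimitive s t) :=
  hasCompactSupport_of_norm_le (s := max s t + 1) fun _ hz => bumpPrimitive_eq_zero hs ht
    (by linarith [le_max_left s t]) (by linarith [le_max_right s t]) hz

/-- With $|z-a|<1$ and $u$ vanishing outside the unit disc, only points within distance two of $a$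
contribute, where the cutoff is one. -/
lemma conv_localize_eq {g : ℂ → ℝ} {u : ℂ → ℂ} {a z : ℂ} (hz : z ∈ Metric.ball a 1)
    (hu : ∀ ζ, 1 ≤ ‖ζ‖ → u ζ = 0) :
    conv (localize g a) u z = conv (fun w => (g w : ℂ)) u z := by
  simp only [conv_apply]
  congr 1; ext ζ
  rcases le_or_gt 1 ‖z - ζ‖ with h | h
  · simp [hu _ h]
  · rw [localize_eq]
    rw [Metric.mem_ball, dist_eq_norm] at hz
    have : ζ - a = (z - a) - (z - ζ) := by ring
    rw [this]
    linarith [norm_sub_le (z - a) (z - ζ)]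

/-- This is the weak form of $\bar\partial w=v$ for the cut-off Laplacian $v$ and $w=K*v$, with $K$
the Cauchy kernel: $(K*v)*\bar\partial u=K*\bar\partial(v*u)=v*u$ by associativity and
Cauchy–Pompeiu. -/
lemma conv_cauchyLocal_dbar {g : ℂ → ℝ} {M : ℝ} (hg : Measurable g) (hM : ∀ z, |g z| ≤ M)
    {u : ℂ → ℂ} (hu : ContDiff ℝ ∞ u) (hc : HasCompactSupport u) (a : ℂ) :
    conv (cauchyLocal g a) (dbar u) = conv (localize g a) u := by
  have hu1 : ContDiff ℝ ((1 : ℕ)) u := hu.of_le (by exact_mod_cast le_top)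
  have hl : LocallyIntegrable (localize g a) := fun x => ⟨Metric.ball x 1,
    Metric.ball_mem_nhds _ one_pos, Measure.integrableOn_of_bounded measure_ball_lt_top.ne
      (localize_measurable hg a).aestronglyMeasurable (Eventually.of_forall (norm_localize_le hM a))⟩
  rw [cauchyLocal, conv_assoc cauchyKernel_locallyIntegrable (localize_measurable hg a)
    (norm_localize_le hM a) (localize_hasCompactSupport g a) (dbar_contDiff_infty hu).continuous
    (dbar_hasCompactSupport hc), ← dbar_conv hl (by exact_mod_cast hu1) hc, conv_cauchyKernel_dbar]
  · exact_mod_cast conv_contDiff hl hu1 hc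
  · exact conv_hasCompactSupport (localize_hasCompactSupport g a) hc

/-- The holomorphic part of `∂ φ` near `a`, obtained by averaging. -/
def holPart (φ g : ℂ → ℝ) (a : ℂ) (s : ℝ) : ℂ → ℂ :=
  conv (fun w => (φ w : ℂ)) (wirt (cbump s)) - conv (cauchyLocal g a) (cbump s)

section
variable {φ g : ℂ → ℝ} {M : ℝ}

/-- The difference of two bumps is $\bar\partial\beta$ with $\beta$ supported in the unit disc. Then
$\phi*\partial\bar\partial\beta=g*\beta=w*\bar\partial\beta$ near $a$, so the change in the two
terms of `holPart` cancels. -/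
lemma holPart_eq (h : IsDistribLaplacian φ g) (hg : Measurable g) (hM : ∀ z, |g z| ≤ M)
    {s t : ℝ} (hs : 0 < s) (ht : 0 < t) (hs1 : s < 1) (ht1 : t < 1) {a z : ℂ}
    (hz : z ∈ Metric.ball a 1) : holPart φ g a s z = holPart φ g a t z := by
  have hφ := LocallyIntegrable.ofReal_complex h.locInt_left
  have hw := (cauchyLocal_continuous hg hM a).locallyIntegrable (μ := volume)
  set β := bumpPrimitive s t
  have h1 : conv (fun w => (φ w : ℂ)) (wirt (dbar β)) z = conv (cauchyLocal g a) (dbar β) z := by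
    rw [h.conv_wirt_dbar (bumpPrimitive_contDiff hs ht) (bumpPrimitive_hasCompactSupport hs ht),
      conv_cauchyLocal_dbar hg hM (bumpPrimitive_contDiff hs ht)
        (bumpPrimitive_hasCompactSupport hs ht), conv_localize_eq hz]
    exact fun ζ hζ => bumpPrimitive_eq_zero hs ht hs1 ht1 hζ
  have h2 : wirt (dbar β) = wirt (cbump s) - wirt (cbump t) := by
    rw [dbar_bumpPrimitive hs ht]
    ext w
    exact wirt_sub ((cbump_contDiff s).differentiable (by simp) w)
      ((cbump_contDiff t).differentiable (by simp) w)
  rw [h2, dbar_bumpPrimitive hs ht, conv_sub_right, conv_sub_right] at h1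
  · simp only [holPart, Pi.sub_apply]
    linear_combination h1
  · exact conv_integrable hw (cbump_contDiff s).continuous (cbump_hasCompactSupport hs) z
  · exact conv_integrable hw (cbump_contDiff t).continuous (cbump_hasCompactSupport ht) z
  · exact conv_integrable hφ (wirt_contDiff_infty (cbump_contDiff s)).continuous
      (wirt_hasCompactSupport (cbump_hasCompactSupport hs)) z
  · exact conv_integrable hφ (wirt_contDiff_infty (cbump_contDiff t)).continuous
      (wirt_hasCompactSupport (cbump_hasCompactSupport ht)) z

/-- Applying $\bar\partial$ to both terms yields $g*\eta-g*\eta=0$ near $a$, where $\eta$ is the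
bump. -/
lemma holPart_differentiableOn (h : IsDistribLaplacian φ g) (hg : Measurable g)
    (hM : ∀ z, |g z| ≤ M) {s : ℝ} (hs : 0 < s) (hs1 : s < 1) (a : ℂ) :
    DifferentiableOn ℂ (holPart φ g a s) (Metric.ball a 1) := by
  intro z hz
  have hφ := LocallyIntegrable.ofReal_complex h.locInt_left
  have hw := (cauchyLocal_continuous hg hM a).locallyIntegrable (μ := volume)
  have hη := cbump_contDiff s
  have hηc := cbump_hasCompactSupport hs
  have e1 := one_le_infty
  have hd1 := (hasFDerivAt_conv hφ ((wirt_contDiff_infty hη).of_le e1)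
    (wirt_hasCompactSupport hηc) z).1
  have hd2 := (hasFDerivAt_conv hw (hη.of_le e1) hηc z).1
  refine (differentiableAt_complex_of_dbar (hd1.sub hd2) ?_).differentiableWithinAt
  rw [dbar_sub hd1 hd2, dbar_conv hφ ((wirt_contDiff_infty hη).of_le e1)
    (wirt_hasCompactSupport hηc), dbar_conv hw (hη.of_le e1) hηc,
    conv_cauchyLocal_dbar hg hM hη hηc, conv_localize_eq hz fun ζ hζ =>
      cbump_eq_zero hs (hs1.le.trans hζ), ← h.conv_wirt_dbar hη hηc]
  have h3 : dbar (wirt (cbump s)) = wirt (dbar (cbump s)) := by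
    ext w
    have hb : ContDiffAt ℝ 2 (bump s) w :=
      (bump_contDiff s).contDiffAt.of_le two_le_infty
    exact (dbar_wirt_eq_lap hb).1.trans (dbar_wirt_eq_lap hb).2.symm
  rw [h3, sub_self]

lemma conv_cbump_tendstoUniformlyOn {w : ℂ → ℂ} (hw : Continuous w) {s : ℕ → ℝ}
    (hs : ∀ k, 0 < s k) (hs0 : Tendsto s atTop (𝓝 0)) (a : ℂ) :
    TendstoUniformlyOn (fun k => conv w (cbump (s k))) w atTop (Metric.ball a 1) := by
  have hu := (isCompact_closedBall a 2).uniformContinuousOn_of_continuous hw.continuousOn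
  rw [Metric.uniformContinuousOn_iff] at hu
  rw [Metric.tendstoUniformlyOn_iff]
  intro ε hε
  obtain ⟨δ, hδ, hd⟩ := hu (ε / 2) (by positivity)
  filter_upwards [hs0.eventually (gt_mem_nhds hδ), hs0.eventually (gt_mem_nhds one_pos)]
    with k hk hk1 z hz
  rw [Metric.mem_ball] at hz
  have h1 : Integrable (fun ζ => cbump (s k) ζ * w z) :=
    ((bump_integrable (hs k)).ofReal).mul_const _
  have h2 : Integrable (fun ζ => cbump (s k) ζ * w (z - ζ)) :=
    (cbump_hasCompactSupport (hs k)).convolutionExists_left (ContinuousLinearMap.mul ℝ ℂ)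
      (cbump_contDiff _).continuous (hw.locallyIntegrable) z
  have h3 : ∫ ζ, cbump (s k) ζ * w z = w z := by
    rw [integral_mul_const]
    simp only [cbump]
    rw [integral_complex_ofReal, integral_bump (hs k), Complex.ofReal_one, one_mul]
  rw [conv_comm, conv_apply, ← h3, dist_eq_norm, ← integral_sub h1 h2]
  refine lt_of_le_of_lt ((norm_integral_le_of_norm_le
    ((bump_integrable (hs k)).mul_const (ε / 2)) (Eventually.of_forall fun ζ => ?_)).trans
    (le_of_eq ?_)) (half_lt_self hε)
  · rcases le_or_gt (s k) ‖ζ‖ with hζ | hζ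
    · simp [cbump_eq_zero (hs k) hζ, bump_eq_zero (hs k) hζ]
    · rw [← mul_sub, norm_mul, cbump, Complex.norm_real, Real.norm_of_nonneg (bump_nonneg _ _)]
      refine mul_le_mul_of_nonneg_left ?_ (bump_nonneg _ _)
      rw [← dist_eq_norm]
      refine (hd _ ?_ _ ?_ ?_).le
      · rw [Metric.mem_closedBall]; linarith
      · rw [Metric.mem_closedBall]
        have : dist (z - ζ) a ≤ dist (z - ζ) z + dist z a := dist_triangle _ _ _
        have h4 : dist (z - ζ) z = ‖ζ‖ := by simp
        linarith
      · simpa using hζ.trans hk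
  · rw [integral_mul_const, integral_bump (hs k), one_mul]

/-- The mollifications of $\phi$ have $\partial$-derivative $H+w*\eta_s$, where $H$ does not depend
on $s$ and $w*\eta_s\to w$ uniformly on the disc. Together with pointwise convergence to $\phi$ this
allows differentiation of the limit. -/
lemma hasFDerivAt_of_isDistribLaplacian (hsub : IsSubharmonic φ) (h : IsDistribLaplacian φ g)
    (hg : Measurable g) (hM : ∀ z, |g z| ≤ M) {a z : ℂ} (hz : z ∈ Metric.ball a 1) :
    HasFDerivAt φ (twoRe (holPart φ g a (1 / 2) z + cauchyLocal g a z)) z := by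
  -- The extra factor one half keeps every radius strictly below one, as `holPart_eq` requires.
  set s : ℕ → ℝ := fun k => 1 / ((k : ℝ) + 1) / 2 with hsdef
  have hs : ∀ k, 0 < s k := fun k => by positivity
  have hs1 : ∀ k, s k < 1 := fun k => by
    have : 1 / ((k : ℝ) + 1) ≤ 1 := by
      rw [div_le_one (by positivity)]
      linarith [(Nat.cast_nonneg k : (0 : ℝ) ≤ k)]
    simp only [hsdef]
    linarith
  have hs0 : Tendsto s atTop (𝓝 0) := by
    simpa only [zero_div] using (tendsto_one_div_add_atTop_nhds_zero_nat (𝕜 := ℝ)).div_const 2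
  have hφ := LocallyIntegrable.ofReal_complex h.locInt_left
  have e1 := one_le_infty
  set w := cauchyLocal g a
  have hreal : ∀ k x, conv (fun w => (φ w : ℂ)) (cbump (s k)) x =
      ((∫ ζ, bump (s k) ζ * φ (x - ζ) : ℝ) : ℂ) := by
    intro k x
    rw [conv_comm, conv_apply, ← integral_complex_ofReal]
    simp [cbump]
  have hder : ∀ k, ∀ x ∈ Metric.ball a 1, HasFDerivAt (fun x => ∫ ζ, bump (s k) ζ * φ (x - ζ))
      (twoRe (holPart φ g a (1 / 2) x + conv w (cbump (s k)) x)) x := by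
    intro k x hx
    have h1 := (hasFDerivAt_conv hφ ((cbump_contDiff (s k)).of_le e1)
      (cbump_hasCompactSupport (hs k)) x).1
    have h2 : DifferentiableAt ℝ (fun x => ∫ ζ, bump (s k) ζ * φ (x - ζ)) x := by
      have := Complex.reCLM.differentiableAt.comp x h1
      refine this.congr_of_eventuallyEq (Eventually.of_forall fun y => ?_)
      simp [hreal]
    have h3 := h2.hasFDerivAt
    rw [fderiv_eq_twoRe_wirt h2] at h3
    have h4 : (fun x => ((∫ ζ, bump (s k) ζ * φ (x - ζ) : ℝ) : ℂ)) =
        conv (fun w => (φ w : ℂ)) (cbump (s k)) := by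
      ext x
      rw [hreal]
    rw [h4, wirt_conv hφ ((cbump_contDiff (s k)).of_le e1) (cbump_hasCompactSupport (hs k))] at h3
    rw [holPart_eq h hg hM (by norm_num) (hs k) (by norm_num) (hs1 k) hx]
    simpa only [holPart, Pi.sub_apply, w, sub_add_cancel] using h3
  refine hasFDerivAt_of_tendstoUniformlyOn (l := atTop)
    (g' := fun x => twoRe (holPart φ g a (1 / 2) x + w x)) Metric.isOpen_ball ?_ (fun k x hx => hder k x hx)
    (fun x _ => hsub.tendsto_integral_bump h.locInt_left hs hs0 x) hz
  have hw := conv_cbump_tendstoUniformlyOn (cauchyLocal_continuous hg hM a) hs hs0 a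
  rw [Metric.tendstoUniformlyOn_iff] at hw ⊢
  intro ε hε
  filter_upwards [hw (ε / 2) (by positivity)] with k hk x hx
  have := hk x hx
  rw [dist_eq_norm] at this ⊢
  rw [← twoRe_sub, add_sub_add_left_eq_sub]
  linarith [norm_twoRe_le (w x - conv w (cbump (s k)) x)]

end

/-! ### Regularity of weights and local decompositions -/

lemma twoRe_continuous : Continuous twoRe := by
  refine LipschitzWith.continuous (K := 2) (LipschitzWith.of_dist_le_mul fun c d => ?_)
  rw [dist_eq_norm, dist_eq_norm, ← twoRe_sub]
  exact norm_twoRe_le _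

lemma contDiff_one_of_isDistribLaplacian {φ g : ℂ → ℝ} {M : ℝ} (hsub : IsSubharmonic φ)
    (h : IsDistribLaplacian φ g) (hg : Measurable g) (hM : ∀ z, |g z| ≤ M) : ContDiff ℝ 1 φ := by
  have hd : ∀ a : ℂ, ∀ z ∈ Metric.ball a 1, _ := fun a z hz =>
    hasFDerivAt_of_isDistribLaplacian hsub h hg hM hz
  rw [contDiff_one_iff_fderiv]
  refine ⟨fun a => (hd a a (Metric.mem_ball_self one_pos)).differentiableAt, ?_⟩
  rw [continuous_iff_continuousAt]
  intro a
  have hball := Metric.ball_mem_nhds a one_pos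
  have h1 : ContinuousAt (fun z => twoRe (holPart φ g a (1 / 2) z + cauchyLocal g a z)) a := by
    refine twoRe_continuous.continuousAt.comp (ContinuousAt.add ?_ ?_)
    · exact (holPart_differentiableOn h hg hM (by norm_num) (by norm_num) a).continuousOn.continuousAt
        hball
    · exact (cauchyLocal_continuous hg hM a).continuousAt
  refine h1.congr ?_
  filter_upwards [hball] with z hz
  exact (hd a z hz).fderiv.symm

lemma norm_cauchyLocal_le {g : ℂ → ℝ} {M : ℝ} (hM : ∀ z, |g z| ≤ M) {a z : ℂ}
    (hz : z ∈ Metric.ball a 1) :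
    ‖cauchyLocal g a z‖ ≤ (∫ ζ in Metric.ball 0 4, ‖cauchyKernel ζ‖) * M := by
  refine norm_conv_cauchyKernel_le (norm_localize_le hM a) fun ζ hζ => localize_eq_zero ?_
  rw [Metric.mem_ball, dist_eq_norm] at hz
  have h1 : ζ = (z - a) - (z - ζ - a) := by ring
  have h2 := norm_sub_le (z - a) (z - ζ - a)
  rw [← h1] at h2
  linarith

/-- This polynomial cancels the derivatives $\partial^{i+1}$ of the remainder at the centre, since
$\partial^{i+1}(2\,\mathrm{Re}\,P)=P^{(i+1)}$. The coefficients are divided by factorials, whence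
the bound $nB$ on the unit disc. -/
lemma exists_polynomial_iteratedDeriv (n : ℕ) (c : ℕ → ℂ) {B : ℝ} (hB : ∀ i < n, ‖c i‖ ≤ B) (a : ℂ) :
    ∃ P : ℂ → ℂ, Differentiable ℂ P ∧ P a = 0 ∧ (∀ i < n, iteratedDeriv (i + 1) P a = c i) ∧
      ∀ z ∈ Metric.ball a 1, ‖P z‖ ≤ n * B := by
  refine ⟨fun z => ∑ i ∈ Finset.range n, c i / (Nat.factorial (i + 1) : ℂ) * (z - a) ^ (i + 1),
    by fun_prop, by simp, fun i hi => ?_, fun z hz => ?_⟩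
  · have h1 := congrFun (iteratedDeriv_comp_sub_const (n := i + 1) (s := a) (f := fun z =>
      ∑ i ∈ Finset.range n, c i / (Nat.factorial (i + 1) : ℂ) * z ^ (i + 1))) a
    rw [sub_self] at h1
    rw [h1, iteratedDeriv_fun_sum fun j _ => by fun_prop, Finset.sum_eq_single i]
    · rw [iteratedDeriv_const_mul_field, iteratedDeriv_fun_pow_zero]
      have : ((Nat.factorial (i + 1) : ℕ) : ℂ) ≠ 0 := by exact_mod_cast Nat.factorial_ne_zero _
      simp only [if_true]
      field_simp
    · intro j _ hj
      rw [iteratedDeriv_const_mul_field, iteratedDeriv_fun_pow_zero, if_neg (by omega), Nat.cast_zero, mul_zero]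
    · intro h
      exact absurd (Finset.mem_range.2 hi) h
  · rw [Metric.mem_ball, dist_eq_norm] at hz
    refine (norm_sum_le_of_le (f := fun i => c i / (Nat.factorial (i + 1) : ℂ) * (z - a) ^ (i + 1))
      (n := fun _ => B) _ fun i hi => ?_).trans (by simp)
    have hi' := hB i (Finset.mem_range.1 hi)
    rw [norm_mul, norm_div, norm_pow, Complex.norm_natCast]
    have h1 : (1 : ℝ) ≤ (Nat.factorial (i + 1) : ℝ) := by exact_mod_cast Nat.factorial_pos _
    calc ‖c i‖ / (Nat.factorial (i + 1) : ℝ) * ‖z - a‖ ^ (i + 1) ≤ ‖c i‖ * 1 := by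
          gcongr
          · exact div_le_self (norm_nonneg _) h1
          · exact pow_le_one₀ (norm_nonneg _) hz.le
      _ ≤ B := by rwa [mul_one]

/-- A weight is, near every point, the sum of a bounded function, whose derivatives `∂^j` at the
point vanish for `j ≤ n`, and of the real part of a holomorphic function, with uniform bounds. -/
def LocallyDecomposable (φ : ℂ → ℝ) (n : ℕ) (C : ℝ) : Prop :=
  ∀ a : ℂ, ∃ h : ℂ → ℂ, DifferentiableOn ℂ h (Metric.ball a 1) ∧
    (∀ z ∈ Metric.ball a 1, |φ z - 2 * (h z).re| ≤ C) ∧ φ a = 2 * (h a).re ∧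
    ∀ j, 1 ≤ j → j ≤ n → wirt^[j] (fun z => ((φ z - 2 * (h z).re : ℝ) : ℂ)) a = 0

/-- Here $\partial\phi=H+w$ with $H$ holomorphic and $w$ bounded. With $h_0'=H$, the function
$\phi-2\,\mathrm{Re}\,h_0$ has $\partial$-derivative $w$; subtracting $2\,\mathrm{Re}\,P$ with
$P^{(i+1)}(a)=\partial^iw(a)$ makes the required derivatives vanish. -/
lemma exists_locallyDecomposable {φ g : ℂ → ℝ} {M B : ℝ} {n : ℕ} (hsub : IsSubharmonic φ)
    (h : IsDistribLaplacian φ g) (hg : Measurable g) (hM : ∀ z, |g z| ≤ M)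
    (hC : ∀ a, ContDiff ℝ ((n - 1 : ℕ)) (cauchyLocal g a))
    (hB : ∀ a, ∀ i < n, ‖wirt^[i] (cauchyLocal g a) a‖ ≤ B) :
    ∃ C : ℝ, LocallyDecomposable φ n C := by
  set κ := (∫ ζ in Metric.ball (0 : ℂ) 4, ‖cauchyKernel ζ‖) * M with hκ
  -- The term $2\kappa$ is the mean value inequality for $\phi-2\,\mathrm{Re}\,h_0$ on the unit
  -- disc, and $2nB$ bounds $2\,\mathrm{Re}\,P$.
  refine ⟨2 * κ + 2 * (n * B), fun a => ?_⟩
  set w := cauchyLocal g a with hw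
  set H := holPart φ g a (1 / 2) with hH
  obtain ⟨h₀, h₀a, hh₀⟩ := (holPart_differentiableOn h hg hM (s := 1 / 2) (by norm_num)
    (by norm_num) a).isExactOn_ball.with_val_at a ((φ a / 2 : ℝ) : ℂ)
  obtain ⟨P, hP, hPa, hPd, hPb⟩ := exists_polynomial_iteratedDeriv n (fun i => wirt^[i] w a)
    (hB a) a
  have hφd : ∀ z ∈ Metric.ball a 1, HasFDerivAt φ (twoRe (H z + w z)) z := fun z hz =>
    hasFDerivAt_of_isDistribLaplacian hsub h hg hM hz
  have hψ : ∀ z ∈ Metric.ball a 1,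
      HasFDerivAt (fun z => φ z - 2 * (h₀ z).re) (twoRe (w z)) z := by
    intro z hz
    refine ((hφd z hz).sub (hasFDerivAt_two_re (hh₀ z hz))).congr_fderiv ?_
    rw [← twoRe_sub, add_sub_cancel_left]
  have hψ' : ∀ z ∈ Metric.ball a 1,
      HasFDerivAt (fun z => φ z - 2 * ((h₀ z + P z).re)) (twoRe (w z - deriv P z)) z := by
    intro z hz
    refine ((hφd z hz).sub (hasFDerivAt_two_re ((hh₀ z hz).add
      (hP z).hasDerivAt))).congr_fderiv ?_
    rw [← twoRe_sub]
    congr 1; ring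
  have hψ0 : φ a - 2 * (h₀ a).re = 0 := by
    rw [h₀a, Complex.ofReal_re]; ring
  have hball := Metric.ball_mem_nhds a one_pos
  refine ⟨fun z => h₀ z + P z, fun z hz =>
    ((hh₀ z hz).differentiableAt.add (hP z)).differentiableWithinAt, fun z hz => ?_, ?_, ?_⟩
  · have h1 := (convex_ball a 1).norm_image_sub_le_of_norm_hasFDerivWithin_le (C := 2 * κ)
      (fun x hx => (hψ x hx).hasFDerivWithinAt) (fun x hx => (norm_twoRe_le _).trans
        (mul_le_mul_of_nonneg_left (norm_cauchyLocal_le hM hx) zero_le_two))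
      (Metric.mem_ball_self one_pos) hz
    rw [hψ0, sub_zero, Real.norm_eq_abs] at h1
    have hκ0 : 0 ≤ κ := (norm_nonneg _).trans (norm_cauchyLocal_le hM (Metric.mem_ball_self one_pos
      (x := a)))
    have hz1 : ‖z - a‖ ≤ 1 := by
      rw [Metric.mem_ball, dist_eq_norm] at hz
      exact hz.le
    have h2 : |(P z).re| ≤ n * B := (Complex.abs_re_le_norm _).trans (hPb z hz)
    have h3 : φ z - 2 * (h₀ z + P z).re = (φ z - 2 * (h₀ z).re) - 2 * (P z).re := by
      rw [Complex.add_re]; ring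
    rw [h3]
    refine (abs_sub _ _).trans (add_le_add (h1.trans ?_) ?_)
    · exact mul_le_of_le_one_right (by positivity) hz1
    · rw [abs_mul, abs_two]
      linarith
  · simp only [hPa, add_zero]
    linarith
  · intro j hj hjn
    obtain ⟨i, rfl⟩ := Nat.exists_eq_add_of_le' hj
    rw [Function.iterate_succ_apply]
    have h1 : wirt (fun z => ((φ z - 2 * (h₀ z + P z).re : ℝ) : ℂ)) =ᶠ[𝓝 a] w - deriv P := by
      filter_upwards [hball] with z hz
      exact wirt_ofReal_eq (hψ' z hz)
    rw [(wirt_iterate_eventuallyEq h1 i).eq_of_nhds]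
    have hPan : AnalyticAt ℂ (deriv P) a := (hP.analyticAt a).deriv
    have hwc : ContDiffAt ℝ i w a := (hC a).contDiffAt.of_le (by norm_cast; omega)
    have hPc : ContDiffAt ℝ i (-deriv P) a :=
      ((hPan.contDiffAt (n := i)).restrict_scalars ℝ).neg
    have h2 : wirt^[i] (-deriv P) a = -wirt^[i] (deriv P) a := by
      clear hwc hPc h1 hj hjn
      have : ∀ F : ℂ → ℂ, wirt^[i] (-F) = -wirt^[i] F := by
        induction i with
        | zero => simp
        | succ k ih =>
          intro F
          rw [Function.iterate_succ_apply', ih, wirt_neg, Function.iterate_succ_apply']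
      rw [this, Pi.neg_apply]
    rw [sub_eq_add_neg, wirt_iterate_add i hwc hPc, h2,
      (wirt_iterate_eq_iteratedDeriv hPan i).eq_of_nhds, ← iteratedDeriv_succ', hPd i (by omega),
      add_neg_cancel]

/-! ### Integration by parts, and the classical Laplacian as a distributional one. -/

/-- Convolving with the constant one gives the constant function $\int u$, whose derivative
vanishes. -/
lemma integral_wirt_eq_zero {u : ℂ → ℂ} (hu : ContDiff ℝ 1 u) (hc : HasCompactSupport u) :
    ∫ z, wirt u z = 0 := by
  have hl : LocallyIntegrable (fun _ : ℂ => (1 : ℂ)) :=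
    continuous_const.locallyIntegrable
  have h1 : ∀ v z, conv (fun _ => 1) v z = ∫ ζ, v ζ := by
    intro v z
    rw [conv_comm, conv_apply]
    simp
  have h2 := congrFun (wirt_conv hl hu hc) 0
  rw [h1] at h2
  rw [← h2, funext (h1 u)]
  simp [wirt]

lemma integral_dbar_eq_zero {u : ℂ → ℂ} (hu : ContDiff ℝ 1 u) (hc : HasCompactSupport u) :
    ∫ z, dbar u z = 0 := by
  have hl : LocallyIntegrable (fun _ : ℂ => (1 : ℂ)) :=
    continuous_const.locallyIntegrable
  have h1 : ∀ v z, conv (fun _ => 1) v z = ∫ ζ, v ζ := by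
    intro v z
    rw [conv_comm, conv_apply]
    simp
  have h2 := congrFun (dbar_conv hl hu hc) 0
  rw [h1] at h2
  rw [← h2, funext (h1 u)]
  simp [dbar]

lemma dbar_mul {F G : ℂ → ℂ} {z : ℂ} (hF : DifferentiableAt ℝ F z) (hG : DifferentiableAt ℝ G z) :
    dbar (F * G) z = dbar F z * G z + F z * dbar G z := by
  simp only [dbar, fderiv_mul hF hG, add_apply, smul_apply, smul_eq_mul]
  ring

lemma integral_mul_wirt {F u : ℂ → ℂ} (hF : ContDiff ℝ 1 F) (hu : ContDiff ℝ 1 u)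
    (hc : HasCompactSupport u) : ∫ z, F z * wirt u z = -∫ z, wirt F z * u z := by
  have h1 := integral_wirt_eq_zero (hF.mul hu) hc.mul_left
  have h2 : wirt (F * u) = fun z => wirt F z * u z + F z * wirt u z := by
    ext z
    exact wirt_mul (hF.differentiable one_ne_zero z) (hu.differentiable one_ne_zero z)
  have hF' := (wirt_contDiff (n := 0) (by simpa using hF)).continuous
  have hu' := (wirt_contDiff (n := 0) (by simpa using hu)).continuous
  have h3 : ∫ z, wirt (F * u) z = 0 := h1
  rw [h2, integral_add] at h3
  · linear_combination h3
  · exact (hF'.mul hu.continuous).integrable_of_hasCompactSupport hc.mul_left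
  · exact (hF.continuous.mul hu').integrable_of_hasCompactSupport (wirt_hasCompactSupport hc).mul_left

lemma integral_mul_dbar {F u : ℂ → ℂ} (hF : ContDiff ℝ 1 F) (hu : ContDiff ℝ 1 u)
    (hc : HasCompactSupport u) : ∫ z, F z * dbar u z = -∫ z, dbar F z * u z := by
  have h1 := integral_dbar_eq_zero (hF.mul hu) hc.mul_left
  have h2 : dbar (F * u) = fun z => dbar F z * u z + F z * dbar u z := by
    ext z
    exact dbar_mul (hF.differentiable one_ne_zero z) (hu.differentiable one_ne_zero z)
  have hF' := (dbar_contDiff (n := 0) (by simpa using hF)).continuous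
  have hu' := (dbar_contDiff (n := 0) (by simpa using hu)).continuous
  have h3 : ∫ z, dbar (F * u) z = 0 := h1
  rw [h2, integral_add] at h3
  · linear_combination h3
  · exact (hF'.mul hu.continuous).integrable_of_hasCompactSupport hc.mul_left
  · exact (hF.continuous.mul hu').integrable_of_hasCompactSupport (dbar_hasCompactSupport hc).mul_left

lemma isDistribLaplacian_lap {φ : ℂ → ℝ} (hφ : ContDiff ℝ 2 φ) : IsDistribLaplacian φ (lap φ) where
  locInt_left := hφ.continuous.locallyIntegrable
  locInt_right := (lap_continuous hφ).locallyIntegrable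
  integral_eq := by
    intro ψ hψ hc
    have hφ' : ContDiff ℝ ((1 + 1 : ℕ)) (fun w => (φ w : ℂ)) :=
      Complex.ofRealCLM.contDiff.comp (hφ.of_le (by norm_num))
    have hψ' : ContDiff ℝ ∞ (fun w => (ψ w : ℂ)) := Complex.ofRealCLM.contDiff.comp hψ
    have hc' : HasCompactSupport (fun w => (ψ w : ℂ)) := hc.comp_left Complex.ofReal_zero
    have h1 := integral_mul_dbar (hφ'.of_le (by norm_cast))
      ((wirt_contDiff_infty hψ').of_le one_le_infty) (wirt_hasCompactSupport hc')
    have h2 := integral_mul_wirt (F := dbar fun w => (φ w : ℂ)) (by exact_mod_cast dbar_contDiff hφ')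
      (hψ'.of_le one_le_infty) hc'
    rw [h2, neg_neg] at h1
    simp only [(dbar_wirt_eq_lap (hψ.contDiffAt.of_le two_le_infty)).1,
      (dbar_wirt_eq_lap hφ.contDiffAt).2, ← Complex.ofReal_mul, integral_complex_ofReal] at h1
    exact_mod_cast h1

/-- For smooth weights this identifies the given $g$ with the classical Laplacian, so that the
bounds assumed for $g$ pass to `lap φ`. -/
lemma IsDistribLaplacian.ae_eq {φ g g' : ℂ → ℝ} (h : IsDistribLaplacian φ g)
    (h' : IsDistribLaplacian φ g') : g =ᵐ[volume] g' := by
  refine ae_eq_of_integral_contDiff_smul_eq h.locInt_right h'.locInt_right fun ψ hψ hc => ?_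
  simp only [smul_eq_mul, mul_comm (ψ _)]
  rw [← h.integral_eq ψ hψ hc, h'.integral_eq ψ hψ hc]

/-! ### Uniform derivative bounds for the cut-off Laplacian. -/

lemma wirt_iterate_hasCompactSupport {u : ℂ → ℂ} (hc : HasCompactSupport u) (j : ℕ) :
    HasCompactSupport (wirt^[j] u) := by
  induction j with
  | zero => simpa using hc
  | succ k ih => simpa only [Function.iterate_succ_apply'] using wirt_hasCompactSupport ih

lemma wirt_iterate_contDiff {F : ℂ → ℂ} {n : ℕ} (j : ℕ)
    (h : ContDiff ℝ ((n + j : ℕ)) F) : ContDiff ℝ n (wirt^[j] F) :=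
  contDiff_iff_contDiffAt.2 fun _ => wirt_iterate_contDiffAt j h.contDiffAt

lemma wirt_iterate_conv {f u : ℂ → ℂ} (hf : LocallyIntegrable f) (j : ℕ) (hu : ContDiff ℝ j u)
    (hc : HasCompactSupport u) : wirt^[j] (conv f u) = conv f (wirt^[j] u) := by
  induction j generalizing u with
  | zero => simp
  | succ k ih =>
    rw [Function.iterate_succ_apply, Function.iterate_succ_apply,
      wirt_conv hf (hu.of_le (by norm_cast; omega)) hc,
      ih (wirt_contDiff hu) (wirt_hasCompactSupport hc)]

lemma wirt_iterate_comp_sub (u : ℂ → ℂ) (a : ℂ) (j : ℕ) :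
    wirt^[j] (fun z => u (z - a)) = fun z => wirt^[j] u (z - a) := by
  induction j with
  | zero => simp
  | succ k ih =>
    rw [Function.iterate_succ_apply', ih, Function.iterate_succ_apply']
    ext z
    simp only [wirt]
    rw [fderiv_comp_sub]

/-- By the Leibniz rule; the cutoffs are translates of one function, so their derivative bounds do
not depend on $a$. -/
lemma exists_bound_wirt_iterate_localize {φ : ℂ → ℝ} {n : ℕ} {K : ℝ}
    (hφ : ContDiff ℝ ((n + 2 : ℕ)) φ)
    (hK : ∀ j ≤ n, ∀ z, ‖wirt^[j] (fun w => ((lap φ w : ℝ) : ℂ)) z‖ ≤ K) :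
    ∃ C, ∀ a z, ∀ i ≤ n, ‖wirt^[i] (localize (lap φ) a) z‖ ≤ C := by
  have hcut : ContDiff ℝ ∞ (fun z => (cutoff z : ℂ)) :=
    Complex.ofRealCLM.contDiff.comp cutoff_contDiff
  have h1 : ∀ j : ℕ, ∃ A, ∀ z, ‖wirt^[j] (fun z => (cutoff z : ℂ)) z‖ ≤ A := by
    intro j
    have hc : Continuous (wirt^[j] (fun z => (cutoff z : ℂ))) :=
      (wirt_iterate_contDiff (n := 0) j (hcut.of_le (natCast_le_infty _))).continuous
    exact hc.bounded_above_of_compact_support (wirt_iterate_hasCompactSupport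
      (cutoff_hasCompactSupport.comp_left Complex.ofReal_zero) j)
  choose A hA using h1
  have hA0 : ∀ j, 0 ≤ A j := fun j => (norm_nonneg _).trans (hA j 0)
  have hK0 : 0 ≤ K := (norm_nonneg _).trans (hK 0 (Nat.zero_le _) 0)
  refine ⟨2 ^ n * (∑ j ∈ Finset.range (n + 1), A j) * K, fun a z i hi => ?_⟩
  have hlapc : ContDiff ℝ n (fun w => ((lap φ w : ℝ) : ℂ)) := by
    have e : (fun w => ((lap φ w : ℝ) : ℂ)) = dbar (wirt fun w => (φ w : ℂ)) := by
      ext w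
      exact (dbar_wirt_eq_lap (hφ.contDiffAt.of_le (by norm_cast; omega))).1.symm
    rw [e]
    exact dbar_contDiff (wirt_contDiff (n := n + 1) (Complex.ofRealCLM.contDiff.comp hφ))
  have hcut' : ContDiff ℝ n (fun z => (cutoff (z - a) : ℂ)) :=
    (hcut.of_le (natCast_le_infty n)).comp (contDiff_id.sub contDiff_const)
  have e : localize (lap φ) a = (fun z => (cutoff (z - a) : ℂ)) * fun w => ((lap φ w : ℝ) : ℂ) := rfl
  have hin : (i : WithTop ℕ∞) ≤ n := by exact_mod_cast hi
  rw [e]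
  refine (norm_wirt_iterate_mul_le (A := ∑ j ∈ Finset.range (n + 1), A j) (B := K) i
    (hcut'.contDiffAt.of_le hin) (hlapc.contDiffAt.of_le hin)
    (fun l hl => ?_) (fun l hl => hK l (hl.trans hi) z)).trans ?_
  · rw [wirt_iterate_comp_sub (fun z => (cutoff z : ℂ))]
    exact (hA l _).trans (Finset.single_le_sum (fun j _ => hA0 j) (Finset.mem_range.2 (by omega)))
  · have : 0 ≤ ∑ j ∈ Finset.range (n + 1), A j := Finset.sum_nonneg fun j _ => hA0 j
    gcongr
    · norm_num

lemma localize_lap_contDiff {φ : ℂ → ℝ} {n : ℕ} (hφ : ContDiff ℝ ((n + 2 : ℕ)) φ) (a : ℂ) :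
    ContDiff ℝ n (localize (lap φ) a) := by
  have hcut : ContDiff ℝ ∞ (fun z => (cutoff z : ℂ)) :=
    Complex.ofRealCLM.contDiff.comp cutoff_contDiff
  have e : (fun w => ((lap φ w : ℝ) : ℂ)) = dbar (wirt fun w => (φ w : ℂ)) := by
    ext w
    exact (dbar_wirt_eq_lap (hφ.contDiffAt.of_le (by norm_cast; omega))).1.symm
  have hlapc : ContDiff ℝ n (fun w => ((lap φ w : ℝ) : ℂ)) := by
    rw [e]
    exact dbar_contDiff (wirt_contDiff (n := n + 1) (Complex.ofRealCLM.contDiff.comp hφ))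
  exact ((hcut.of_le (natCast_le_infty n)).comp (contDiff_id.sub contDiff_const)).mul hlapc

/-- For $n=1$ only the sup bound on $w$ is needed, which the bounded Laplacian supplies. For $n\ge2$
the derivatives $\partial^iw$ are Cauchy transforms of $\partial^i$ of the cut-off Laplacian, which
the compatibility hypotheses bound for $i\le n-1$. -/
lemma Compatible.exists_locallyDecomposable {L : MultSet} {φ g : ℂ → ℝ} {n : ℕ} (hn : 1 ≤ n)
    (hmax : L.maxMult = n + 1) (h : Compatible L φ g) :
    ContDiff ℝ n φ ∧ ∃ C, LocallyDecomposable φ n C := by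
  obtain ⟨m, M, hm, hb⟩ := h.bounds
  rcases Nat.lt_or_ge n 2 with h2 | h2
  · obtain rfl : n = 1 := by omega
    -- A measurable representative is clamped to $[-|M|,|M|]$, because the bounds on $g$ hold only
    -- almost everywhere while the convolution estimates use them everywhere.
    set g' : ℂ → ℝ := fun z =>
      max (-|M|) (min |M| (h.laplacian.locInt_right.aestronglyMeasurable.mk g z)) with hg'
    have hmeas : Measurable g' :=
      measurable_const.max (measurable_const.min
        h.laplacian.locInt_right.aestronglyMeasurable.stronglyMeasurable_mk.measurable)
    have hM : ∀ z, |g' z| ≤ |M| := fun z => by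
      rw [abs_le]
      exact ⟨le_max_left _ _, max_le (by linarith [abs_nonneg M]) (min_le_left _ _)⟩
    have hae : g =ᵐ[volume] g' := by
      filter_upwards [hb, h.laplacian.locInt_right.aestronglyMeasurable.ae_eq_mk] with z hz hz'
      simp only [hg', ← hz']
      rw [min_eq_right (by linarith [le_abs_self M]), max_eq_right]
      linarith [abs_nonneg M]
    have hlap : IsDistribLaplacian φ g' :=
      ⟨h.laplacian.locInt_left, h.laplacian.locInt_right.congr hae, fun ψ hψ hc => by
        rw [h.laplacian.integral_eq ψ hψ hc]
        refine integral_congr_ae ?_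
        filter_upwards [hae] with z hz
        rw [hz]⟩
    refine ⟨by exact_mod_cast contDiff_one_of_isDistribLaplacian h.subharmonic hlap hmeas hM,
      WeightedFock.exists_locallyDecomposable
      (B := (∫ ζ in Metric.ball (0 : ℂ) 4, ‖cauchyKernel ζ‖) * |M|)
      h.subharmonic hlap hmeas hM (fun a => ?_)
        (fun a i hi => ?_)⟩
    · exact contDiff_zero.2 (cauchyLocal_continuous hmeas hM a)
    · obtain rfl : i = 0 := by omega
      exact norm_cauchyLocal_le hM (Metric.mem_ball_self one_pos)
  · obtain ⟨hφ, hj⟩ := h.smooth n hmax h2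
    obtain ⟨k, rfl⟩ : ∃ k, n = k + 1 := ⟨n - 1, by omega⟩
    have hφ2 : ContDiff ℝ 2 φ := hφ.of_le (by norm_cast; omega)
    have hlap := isDistribLaplacian_lap hφ2
    have hae := h.laplacian.ae_eq hlap
    have hM : ∀ z, |lap φ z| ≤ |M| := by
      -- An almost-everywhere bound holds on a dense set, and continuity of the Laplacian extends it
      -- to every point.
      have hcl : IsClosed {z | |lap φ z| ≤ |M|} :=
        isClosed_le (lap_continuous hφ2).abs continuous_const
      have hd : Dense {z | |lap φ z| ≤ |M|} := by
        refine Measure.dense_of_ae (μ := volume) ?_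
        filter_upwards [hb, hae] with z hz hz'
        rw [← hz', abs_of_pos (hm.trans hz.1)]
        exact hz.2.le.trans (le_abs_self M)
      intro z
      have := hcl.closure_eq ▸ hd z
      exact this
    have hK : ∃ K : ℝ, ∀ j ≤ k, ∀ z, ‖wirt^[j] (fun w => ((lap φ w : ℝ) : ℂ)) z‖ ≤ K := by
      have : ∀ j, ∃ K : ℝ, j ≤ k → ∀ z, ‖wirt^[j] (fun w => ((lap φ w : ℝ) : ℂ)) z‖ ≤ K := by
        intro j
        rcases Nat.eq_zero_or_pos j with rfl | hj0
        · refine ⟨|M|, fun _ z => ?_⟩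
          simpa using hM z
        · by_cases hjk : j ≤ k
          · obtain ⟨C, hC⟩ := hj j hj0 (by omega)
            exact ⟨C, fun _ => hC⟩
          · exact ⟨0, fun h => absurd h hjk⟩
      choose K hK using this
      refine ⟨∑ j ∈ Finset.range (k + 1), |K j|, fun j hjk z => ?_⟩
      exact ((hK j hjk z).trans (le_abs_self _)).trans
        (Finset.single_le_sum (f := fun j => |K j|) (fun _ _ => abs_nonneg _)
          (Finset.mem_range.2 (by omega)))
    obtain ⟨K, hK⟩ := hK
    obtain ⟨C, hC⟩ := exists_bound_wirt_iterate_localize (n := k) hφ hK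
    have hls := localize_lap_contDiff (n := k) hφ
    refine ⟨hφ.of_le (by norm_cast; omega), WeightedFock.exists_locallyDecomposable
      (B := (∫ ζ in Metric.ball (0 : ℂ) 4, ‖cauchyKernel ζ‖) * C)
      h.subharmonic hlap (lap_continuous hφ2).measurable hM (fun a => ?_) (fun a i hi => ?_)⟩
    · exact conv_contDiff cauchyKernel_locallyIntegrable (hls a) (localize_hasCompactSupport _ a)
    · have hi' : i ≤ k := by omega
      rw [cauchyLocal, wirt_iterate_conv cauchyKernel_locallyIntegrable i
        ((hls a).of_le (by exact_mod_cast hi')) (localize_hasCompactSupport _ a)]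
      refine norm_conv_cauchyKernel_le (fun z => hC a z i hi') fun ζ hζ => ?_
      by_contra hne
      -- Differentiation does not enlarge the closed support, which stays in the closed disc of
      -- radius three; the radius four of the integral leaves room.
      have hsub : tsupport (wirt^[i] (localize (lap φ) a)) ⊆ Metric.closedBall a 3 := by
        have : ∀ j, tsupport (wirt^[j] (localize (lap φ) a)) ⊆ Metric.closedBall a 3 := by
          intro j
          induction j with
          | zero =>
            refine closure_minimal (fun x hx => ?_) Metric.isClosed_closedBall
            rw [Metric.mem_closedBall, dist_eq_norm]
            by_contra hlt
            exact hx (localize_eq_zero (not_le.1 hlt).le)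
          | succ j ih =>
            refine Subset.trans ?_ ih
            rw [Function.iterate_succ_apply']
            refine closure_minimal (fun x hx => ?_) (isClosed_tsupport _)
            refine support_fderiv_subset ℝ ?_
            contrapose! hx
            simp only [Function.mem_support, not_not] at hx ⊢
            simp [wirt, hx]
        exact this i
      have h3 := hsub (subset_tsupport _ hne)
      rw [Metric.mem_closedBall, dist_eq_norm] at h3
      have h4 : a - ζ - a = -ζ := by ring
      rw [h4, norm_neg] at h3
      linarith

/-! ### Local estimates for holomorphic functions -/

/-- Cauchy's estimates on the circle of radius $r/4$ bound the $k$-th term by $Sq^k$ with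
$q=4|z-a|/r\le\frac12$; the geometric tail costs the factor two. -/
lemma norm_sub_taylor_le {F : ℂ → ℂ} {a z : ℂ} {r S : ℝ} (hr : 0 < r) (n : ℕ)
    (hF : DifferentiableOn ℂ F (Metric.ball a r))
    (hS : ∀ w ∈ Metric.ball a (r / 2), ‖F w‖ ≤ S) (hz : ‖z - a‖ ≤ r / 8) :
    ‖F z - ∑ k ∈ Finset.range (n + 1),
      (Nat.factorial k : ℂ)⁻¹ • (z - a) ^ k • iteratedDeriv k F a‖ ≤
        2 * S * (4 * ‖z - a‖ / r) ^ (n + 1) := by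
  have hzb : z ∈ Metric.ball a r := by
    rw [Metric.mem_ball, dist_eq_norm]
    linarith
  have hsum := Complex.hasSum_taylorSeries_on_ball hF hzb
  set q := 4 * ‖z - a‖ / r with hq
  have hq0 : 0 ≤ q := by positivity
  have hq1 : q ≤ 1 / 2 := by
    rw [hq, div_le_iff₀ hr]
    linarith
  have hS0 : 0 ≤ S := (norm_nonneg _).trans (hS a (Metric.mem_ball_self (by positivity)))
  have hterm : ∀ k, ‖(Nat.factorial k : ℂ)⁻¹ • (z - a) ^ k • iteratedDeriv k F a‖ ≤ S * q ^ k := by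
    intro k
    have h1 := Complex.norm_iteratedDeriv_le_of_forall_mem_sphere_norm_le k
      (R := r / 4) (C := S) (by positivity)
      (hF.diffContOnCl_ball (Metric.closedBall_subset_ball (by linarith)))
      (fun w hw => hS w (by
        rw [mem_sphere_iff_norm] at hw
        rw [Metric.mem_ball, dist_eq_norm]
        linarith))
    rw [norm_smul, norm_smul, norm_inv, Complex.norm_natCast, norm_pow]
    have hk : (0 : ℝ) < Nat.factorial k := by exact_mod_cast Nat.factorial_pos k
    calc (Nat.factorial k : ℝ)⁻¹ * (‖z - a‖ ^ k * ‖iteratedDeriv k F a‖)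
        ≤ (Nat.factorial k : ℝ)⁻¹ * (‖z - a‖ ^ k * (Nat.factorial k * S / (r / 4) ^ k)) := by gcongr
      _ = S * q ^ k := by
        rw [hq]
        field_simp
        simp only [div_pow, mul_pow]
        field_simp
  have htail := (hasSum_nat_add_iff' (n + 1)).2 hsum
  have hgeo : HasSum (fun k => S * q ^ (n + 1) * q ^ k) (S * q ^ (n + 1) * (1 - q)⁻¹) :=
    (hasSum_geometric_of_lt_one hq0 (by linarith)).mul_left _
  have h2 := htail.norm_le_of_bounded hgeo fun k => by
    refine (hterm (k + (n + 1))).trans (le_of_eq ?_)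
    rw [pow_add]; ring
  refine h2.trans ?_
  have h3 : (1 - q)⁻¹ ≤ 2 := by
    rw [inv_le_comm₀ (by linarith) (by norm_num)]
    linarith
  calc S * q ^ (n + 1) * (1 - q)⁻¹ ≤ S * q ^ (n + 1) * 2 := by gcongr
    _ = _ := by ring

/-- The Taylor formula is solved for its $n$-th coefficient. Division by $|z-a|^n$ makes the first
constant blow up as $z\to a$, but the remainder of order $n+1$ keeps one factor $|z-a|$, which is
what makes the error absorbable. -/
lemma norm_iteratedDeriv_sq_le {F : ℂ → ℂ} {a z : ℂ} {r S : ℝ} (hr : 0 < r) (hr1 : r ≤ 1) (n : ℕ)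
    (hF : DifferentiableOn ℂ F (Metric.ball a r))
    (hS : ∀ w ∈ Metric.ball a (r / 2), ‖F w‖ ≤ S) (hz0 : 0 < ‖z - a‖) (hz : ‖z - a‖ ≤ r / 8) :
    ‖iteratedDeriv n F a‖ ^ 2 ≤
      (4 * (n + 1) * (Nat.factorial n / ‖z - a‖ ^ n) ^ 2) *
        (‖F z‖ ^ 2 + ∑ k ∈ Finset.range n, ‖iteratedDeriv k F a‖ ^ 2) +
      (8 * (Nat.factorial n * (4 / r) ^ (n + 1)) ^ 2) * ‖z - a‖ ^ 2 * S ^ 2 := by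
  have h1 := norm_sub_taylor_le hr n hF hS hz
  set ε := ‖z - a‖ with hε
  have hε1 : ε ≤ 1 := by linarith
  have hn : (0 : ℝ) < Nat.factorial n := by exact_mod_cast Nat.factorial_pos n
  have hS0 : 0 ≤ S := (norm_nonneg _).trans (hS a (Metric.mem_ball_self (by positivity)))
  rw [Finset.sum_range_succ] at h1
  set P := ∑ k ∈ Finset.range n, (Nat.factorial k : ℂ)⁻¹ • (z - a) ^ k • iteratedDeriv k F a with hP
  set T := (Nat.factorial n : ℂ)⁻¹ • (z - a) ^ n • iteratedDeriv n F a with hT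
  set y := ‖F z‖
  set x : ℕ → ℝ := fun k => ‖iteratedDeriv k F a‖ with hx
  have hPle : ‖P‖ ≤ ∑ k ∈ Finset.range n, x k := by
    refine norm_sum_le_of_le _ fun k _ => ?_
    rw [norm_smul, norm_smul, norm_inv, Complex.norm_natCast, norm_pow]
    have hk : (1 : ℝ) ≤ Nat.factorial k := by exact_mod_cast Nat.factorial_pos k
    have h2 : (Nat.factorial k : ℝ)⁻¹ ≤ 1 := inv_le_one_of_one_le₀ hk
    have h3 : ε ^ k ≤ 1 := pow_le_one₀ hz0.le hε1
    calc (Nat.factorial k : ℝ)⁻¹ * (ε ^ k * ‖iteratedDeriv k F a‖) ≤ 1 * (1 * x k) := by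
          simp only [hx]; gcongr
      _ = x k := by ring
  have hTn : ‖T‖ = ε ^ n / Nat.factorial n * x n := by
    rw [hT, norm_smul, norm_smul, norm_inv, Complex.norm_natCast, norm_pow]
    ring
  have hTle : ‖T‖ ≤ y + ∑ k ∈ Finset.range n, x k + 2 * S * (4 * ε / r) ^ (n + 1) := by
    have h2 : T = F z - P - (F z - (P + T)) := by ring
    rw [h2]
    refine (norm_sub_le _ _).trans (add_le_add ((norm_sub_le _ _).trans ?_) h1)
    gcongr
  have hxn : x n ≤ Nat.factorial n / ε ^ n * (y + ∑ k ∈ Finset.range n, x k) +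
      2 * (Nat.factorial n * (4 / r) ^ (n + 1)) * ε * S := by
    have h2 : x n = Nat.factorial n / ε ^ n * ‖T‖ := by
      rw [hTn]; field_simp
    rw [h2]
    refine (mul_le_mul_of_nonneg_left hTle (by positivity)).trans (le_of_eq ?_)
    rw [show 4 * ε / r = 4 / r * ε by ring, mul_pow]
    field_simp
    ring
  -- Cauchy–Schwarz for the $n$ derivative terms, then $(u+v)^2\le2u^2+2v^2$.
  have hsq : (y + ∑ k ∈ Finset.range n, x k) ^ 2 ≤
      2 * (n + 1) * (y ^ 2 + ∑ k ∈ Finset.range n, x k ^ 2) := by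
    have h2 := sq_sum_le_card_mul_sum_sq (s := Finset.range n) (f := x)
    rw [Finset.card_range] at h2
    have h3 : 0 ≤ ∑ k ∈ Finset.range n, x k ^ 2 := Finset.sum_nonneg fun _ _ => sq_nonneg _
    have h4 : (0 : ℝ) ≤ n := Nat.cast_nonneg n
    nlinarith [sq_nonneg (y - ∑ k ∈ Finset.range n, x k), mul_nonneg h4 (sq_nonneg y)]
  have hx0 : 0 ≤ x n := norm_nonneg _
  set α := (Nat.factorial n : ℝ) / ε ^ n with hα
  set β := (Nat.factorial n : ℝ) * (4 / r) ^ (n + 1) with hβ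
  set Y := y + ∑ k ∈ Finset.range n, x k
  calc x n ^ 2 ≤ (α * Y + 2 * β * ε * S) ^ 2 := by gcongr
    _ ≤ 2 * α ^ 2 * Y ^ 2 + 8 * β ^ 2 * ε ^ 2 * S ^ 2 := by
      nlinarith [sq_nonneg (α * Y - 2 * β * ε * S)]
    _ ≤ 2 * α ^ 2 * (2 * (n + 1) * (y ^ 2 + ∑ k ∈ Finset.range n, x k ^ 2)) +
        8 * β ^ 2 * ε ^ 2 * S ^ 2 := by gcongr
    _ = _ := by ring

/-- The mean value property is applied to the holomorphic function $F^2$ with a bump of radius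
$r/4$, which stays inside the large disc for centres in the half disc. -/
lemma exists_norm_sq_le_lintegral {r : ℝ} (hr : 0 < r) :
    ∃ C : ℝ, 0 ≤ C ∧ ∀ (F : ℂ → ℂ) (a : ℂ), DifferentiableOn ℂ F (Metric.ball a r) →
      ∀ z ∈ Metric.ball a (r / 2), ENNReal.ofReal (‖F z‖ ^ 2) ≤
        ENNReal.ofReal C * ∫⁻ w in Metric.ball a r, ENNReal.ofReal (‖F w‖ ^ 2) := by
  have hs : 0 < r / 4 := by positivity
  obtain ⟨C, hC⟩ := (bump_contDiff (r / 4)).continuous.bounded_above_of_compact_support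
    (bump_hasCompactSupport hs)
  have hC0 : 0 ≤ C := (norm_nonneg _).trans (hC 0)
  refine ⟨C, hC0, fun F a hF z hz => ?_⟩
  have hsub : Metric.ball z (r / 2) ⊆ Metric.ball a r :=
    Metric.ball_subset_ball' (by rw [Metric.mem_ball] at hz; linarith)
  have h1 := integral_bump_mul_sub_of_differentiableOn hs (show r / 4 < r / 2 by linarith)
    (U := fun w => F w ^ 2) (z := z) ((hF.mono hsub).pow 2)
  have h2 : ENNReal.ofReal (‖F z‖ ^ 2) = ‖F z ^ 2‖ₑ := by
    rw [← norm_pow, ofReal_norm]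
  rw [h2, ← h1]
  refine (enorm_integral_le_lintegral_enorm _).trans ?_
  rw [← lintegral_indicator Metric.isOpen_ball.measurableSet,
    ← lintegral_sub_left_eq_self (fun w => (Metric.ball a r).indicator
      (fun w => ENNReal.ofReal (‖F w‖ ^ 2)) w) z,
    ← lintegral_const_mul' _ _ ENNReal.ofReal_ne_top]
  refine lintegral_mono fun ζ => ?_
  rcases le_or_gt (r / 4) ‖ζ‖ with hζ | hζ
  · simp [bump_eq_zero hs hζ]
  · have hm : z - ζ ∈ Metric.ball a r := hsub (by
      rw [Metric.mem_ball, dist_eq_norm, sub_sub_cancel_left, norm_neg]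
      linarith)
    rw [indicator_of_mem hm, enorm_mul]
    gcongr
    · rw [← ofReal_norm, Complex.norm_real]
      exact ENNReal.ofReal_le_ofReal (hC ζ)
    · rw [← norm_pow, ofReal_norm]

/-! ### Local estimates in weighted Fock spaces -/

/-- The operator is $-\partial$ conjugated by multiplication with $e^{-\phi}$, so the inner
exponentials telescope; no regularity of $\phi$ is involved. -/
lemma dbarStar_iterate (φ : ℂ → ℝ) (f : ℂ → ℂ) (j : ℕ) :
    (dbarStar φ)^[j] f = fun z => (-1) ^ j * ((Real.exp (φ z) : ℂ) *
      wirt^[j] (fun w => (Real.exp (-φ w) : ℂ) * f w) z) := by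
  have hexp : ∀ w, (Real.exp (-φ w) : ℂ) * (Real.exp (φ w) : ℂ) = 1 := fun w => by
    rw [← Complex.ofReal_mul, ← Real.exp_add, neg_add_cancel, Real.exp_zero, Complex.ofReal_one]
  induction j with
  | zero =>
    ext z
    simp only [Function.iterate_zero, id_eq, pow_zero, one_mul]
    linear_combination -f z * hexp z
  | succ k ih =>
    rw [Function.iterate_succ_apply', Function.iterate_succ_apply', ih]
    ext z
    have h1 : (fun w => (Real.exp (-φ w) : ℂ) * ((-1) ^ k * ((Real.exp (φ w) : ℂ) *
        wirt^[k] (fun w => (Real.exp (-φ w) : ℂ) * f w) w))) =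
        fun w => (-1) ^ k * wirt^[k] (fun w => (Real.exp (-φ w) : ℂ) * f w) w := by
      ext w
      linear_combination ((-1) ^ k * wirt^[k] (fun w => (Real.exp (-φ w) : ℂ) * f w) w) * hexp w
    simp only [dbarStar]
    rw [h1]
    have h2 : ∀ G : ℂ → ℂ, wirt (fun w => (-1) ^ k * G w) z = (-1) ^ k * wirt G z := by
      intro G
      rcases neg_one_pow_eq_or ℂ k with h | h
      · simp [h]
      · simp only [h, neg_mul, one_mul]
        exact congrFun (wirt_neg G) z
    rw [h2, pow_succ]
    ring

/-- The summand `|∂̄*^j f(z)|² e^{-φ(z)}` of the sampling sum. -/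
def sampleTerm (φ : ℂ → ℝ) (f : ℂ → ℂ) (j : ℕ) (z : ℂ) : ℝ :=
  ‖((dbarStar φ)^[j] f) z‖ ^ 2 * Real.exp (-φ z)

lemma sampleTerm_nonneg (φ : ℂ → ℝ) (f : ℂ → ℂ) (j : ℕ) (z : ℂ) : 0 ≤ sampleTerm φ f j z :=
  mul_nonneg (sq_nonneg _) (Real.exp_nonneg _)

/-- Since $\partial e^{-\psi}=-e^{-\psi}\partial\psi$, vanishing of the $\partial$-derivatives
passes from $\psi$ to $e^{-\psi}-1$ by the Leibniz rule. -/
lemma wirt_iterate_exp_neg_sub_one {ψ : ℂ → ℝ} {a : ℂ} {l : ℕ} (hψ : ContDiffAt ℝ l ψ a)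
    (h0 : ψ a = 0) (h : ∀ i, 1 ≤ i → i ≤ l → wirt^[i] (fun z => (ψ z : ℂ)) a = 0) :
    wirt^[l] (fun z => (Real.exp (-ψ z) : ℂ) - 1) a = 0 := by
  rcases Nat.eq_zero_or_pos l with rfl | hl
  · simp [h0]
  obtain ⟨k, rfl⟩ := Nat.exists_eq_add_of_le' hl
  have hc : ContDiffAt ℝ ((k + 1 : ℕ)) (fun z => (ψ z : ℂ)) a :=
    Complex.ofRealCLM.contDiff.contDiffAt.comp a hψ
  have hE : ContDiffAt ℝ ((k + 1 : ℕ)) (fun z => (Real.exp (-ψ z) : ℂ)) a :=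
    Complex.ofRealCLM.contDiff.contDiffAt.comp a hψ.neg.exp
  have h1 : wirt (fun z => (Real.exp (-ψ z) : ℂ) - 1) =ᶠ[𝓝 a]
      wirt (fun z => (ψ z : ℂ)) * fun z => -(Real.exp (-ψ z) : ℂ) := by
    filter_upwards [hψ.eventually (by simp)] with z hz
    have hd : DifferentiableAt ℝ ψ z := hz.differentiableAt (by simp)
    have hdc := hasFDerivAt_ofReal_comp hd.hasFDerivAt
    have he : HasFDerivAt (fun z => (Real.exp (-ψ z) : ℂ) - 1)
        (Complex.ofRealCLM.comp (Real.exp (-ψ z) • (-fderiv ℝ ψ z))) z :=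
      (hasFDerivAt_ofReal_comp hd.hasFDerivAt.neg.exp).sub_const 1
    simp only [Pi.mul_apply, wirt, he.fderiv, hdc.fderiv, ContinuousLinearMap.comp_apply,
      smul_apply, neg_apply, Complex.ofRealCLM_apply, smul_eq_mul]
    push_cast
    ring
  rw [Function.iterate_succ_apply, (wirt_iterate_eventuallyEq h1 k).eq_of_nhds]
  refine wirt_iterate_mul_eq_zero k (wirt_contDiffAt hc)
    (hE.neg.of_le (by norm_cast; omega)) fun i hi => ?_
  simpa using h (i + 1) (by omega) (by omega)

/-- One has $e^{-\phi}f=\overline{e^{-h}}\,(F+(e^{-\psi}-1)F)$. The first factor is constant for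
$\partial$, and $(e^{-\psi}-1)F$ contributes nothing at $a$ up to order $n$. The exponential weights
then cancel exactly. -/
lemma sampleTerm_eq {φ : ℂ → ℝ} {f h : ℂ → ℂ} {a : ℂ} {n j : ℕ} (hφ : ContDiff ℝ n φ)
    (hf : Differentiable ℂ f) (hh : AnalyticAt ℂ h a) (h0 : φ a = 2 * (h a).re)
    (hd : ∀ j, 1 ≤ j → j ≤ n → wirt^[j] (fun z => ((φ z - 2 * (h z).re : ℝ) : ℂ)) a = 0)
    (hj : j ≤ n) :
    sampleTerm φ f j a = ‖iteratedDeriv j (fun z => f z * Complex.exp (-h z)) a‖ ^ 2 := by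
  set ψ : ℂ → ℝ := fun z => φ z - 2 * (h z).re with hψ
  set F : ℂ → ℂ := fun z => f z * Complex.exp (-h z) with hF
  have hjn : (j : WithTop ℕ∞) ≤ n := by exact_mod_cast hj
  have hhr : ContDiffAt ℝ j h a := (hh.contDiffAt (n := j)).restrict_scalars ℝ
  have hψc : ContDiffAt ℝ j ψ a :=
    (hφ.contDiffAt.of_le hjn).sub
      (contDiffAt_const.mul (Complex.reCLM.contDiff.contDiffAt.comp a hhr))
  have hψa : ψ a = 0 := by simp only [hψ]; linarith
  have hFan : AnalyticAt ℂ F a := (hf.analyticAt a).mul hh.neg.cexp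
  have hFc : ContDiffAt ℝ j F a := (hFan.contDiffAt (n := j)).restrict_scalars ℝ
  set E : ℂ → ℂ := fun z => (Real.exp (-ψ z) : ℂ) - 1 with hE
  have hEc : ContDiffAt ℝ j E a :=
    (Complex.ofRealCLM.contDiff.contDiffAt.comp a hψc.neg.exp).sub contDiffAt_const
  have h1 : (fun w => (Real.exp (-φ w) : ℂ) * f w) =
      fun w => (starRingEnd ℂ) (Complex.exp (-h w)) * (F + E * F) w := by
    ext w
    have h2 : (Real.exp (-φ w) : ℂ) = (starRingEnd ℂ) (Complex.exp (-h w)) *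
        Complex.exp (-h w) * (Real.exp (-ψ w) : ℂ) := by
      rw [mul_comm ((starRingEnd ℂ) _), Complex.mul_conj, Complex.normSq_eq_norm_sq,
        Complex.norm_exp, ← Complex.ofReal_mul, ← Real.exp_nat_mul, ← Real.exp_add]
      congr 2
      simp only [hψ, Complex.neg_re]
      push_cast; ring
    simp only [Pi.add_apply, Pi.mul_apply, hE, hF, h2]
    ring
  have hz : wirt^[j] (E * F) a = 0 := by
    refine wirt_iterate_mul_eq_zero j hEc hFc fun l hl => ?_
    exact wirt_iterate_exp_neg_sub_one (hψc.of_le (by exact_mod_cast hl)) hψa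
      fun i hi hil => hd i hi (by omega)
  have h3 : wirt^[j] (fun w => (Real.exp (-φ w) : ℂ) * f w) a =
      (starRingEnd ℂ) (Complex.exp (-h a)) * iteratedDeriv j F a := by
    have h2 := wirt_iterate_conj_mul (F := fun w => Complex.exp (-h w)) (X := F + E * F)
      hh.neg.cexp (hFc.add (hEc.mul hFc))
    have h4 := wirt_iterate_add (F := F) (G := E * F) j hFc (hEc.mul hFc)
    rw [h1, h2, h4, hz, add_zero,
      (wirt_iterate_eq_iteratedDeriv hFan j).eq_of_nhds]
  have hconj : ‖(starRingEnd ℂ) (Complex.exp (-h a))‖ = Real.exp (-φ a / 2) := by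
    rw [RCLike.norm_conj, Complex.norm_exp, Complex.neg_re, h0]
    congr 1; ring
  rw [sampleTerm, dbarStar_iterate]
  beta_reduce
  rw [h3]
  simp only [norm_mul, norm_pow, norm_neg, norm_one, one_pow, one_mul, hconj, Complex.norm_real,
    Real.norm_eq_abs, Real.abs_exp]
  rw [mul_pow, mul_pow, ← Real.exp_nat_mul, ← Real.exp_nat_mul]
  have h4 : Real.exp (((2 : ℕ) : ℝ) * φ a) * (Real.exp (((2 : ℕ) : ℝ) * (-φ a / 2))) *
      Real.exp (-φ a) = 1 := by
    rw [← Real.exp_add, ← Real.exp_add, Real.exp_eq_one_iff]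
    push_cast; ring
  linear_combination ‖iteratedDeriv j F a‖ ^ 2 * h4

lemma norm_sq_mul_exp_neg {φ : ℂ → ℝ} {f h : ℂ → ℂ} (z : ℂ) :
    ‖f z * Complex.exp (-h z)‖ ^ 2 =
      Real.exp (φ z - 2 * (h z).re) * (‖f z‖ ^ 2 * Real.exp (-φ z)) := by
  rw [norm_mul, Complex.norm_exp, mul_pow, ← Real.exp_nat_mul, mul_left_comm, ← Real.exp_add]
  congr 2
  rw [Complex.neg_re]
  push_cast; ring

/-- The order of quantifiers is essential: $C$ is fixed before $\varepsilon$, so that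
$C\varepsilon^2$ can be made small, whereas $D$ may depend on $\varepsilon$. -/
lemma LocallyDecomposable.exists_bounds {φ : ℂ → ℝ} {n : ℕ} {C₀ r : ℝ} (hφ : ContDiff ℝ n φ)
    (hdec : LocallyDecomposable φ n C₀) (hr : 0 < r) (hr1 : r ≤ 1) :
    ∃ C : ℝ, 0 ≤ C ∧ ∀ ε : ℝ, 0 < ε → ε ≤ r / 8 → ∃ D : ℝ, 0 ≤ D ∧
      ∀ f ∈ fock φ, ∀ a z : ℂ, dist a z = ε →
        ENNReal.ofReal (sampleTerm φ f 0 z) ≤ ENNReal.ofReal C *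
          ∫⁻ w in Metric.ball a r, ENNReal.ofReal (‖f w‖ ^ 2 * Real.exp (-φ w)) ∧
        ENNReal.ofReal (sampleTerm φ f n a) ≤
          ENNReal.ofReal D * (ENNReal.ofReal (sampleTerm φ f 0 z) +
            ∑ k ∈ Finset.range n, ENNReal.ofReal (sampleTerm φ f k a)) +
          ENNReal.ofReal (C * ε ^ 2) *
            ∫⁻ w in Metric.ball a r, ENNReal.ofReal (‖f w‖ ^ 2 * Real.exp (-φ w)) := by
  obtain ⟨K, hK0, hK⟩ := exists_norm_sq_le_lintegral hr
  set β := 8 * (Nat.factorial n * (4 / r) ^ (n + 1)) ^ 2 with hβ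
  have hβ0 : 0 ≤ β := by positivity
  set e := Real.exp C₀ with he
  have he0 : 0 < e := Real.exp_pos _
  -- The first summand serves the point evaluation at $z$, the second the Taylor remainder. Each
  -- factor `e` is the price of passing between $|F|^2$ and $|f|^2e^{-\phi}$.
  refine ⟨e * (K * e) + β * (K * e), by positivity, fun ε hε hεr => ?_⟩
  set α := 4 * (n + 1) * (Nat.factorial n / ε ^ n) ^ 2 with hα
  have hα0 : 0 ≤ α := by positivity
  -- The factor `e` converts $|F(z)|^2$; the derivative terms at $a$ agree exactly and need only the
  -- one.
  refine ⟨α * (e + 1), by positivity, fun f hf a z haz => ?_⟩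
  obtain ⟨h, hh, hb, h0, hd⟩ := hdec a
  have hz : ‖z - a‖ = ε := by rw [← haz, dist_comm, dist_eq_norm]
  have hzr : z ∈ Metric.ball a (r / 2) := by
    rw [Metric.mem_ball, dist_eq_norm]; linarith
  have hsub : Metric.ball a r ⊆ Metric.ball a 1 := Metric.ball_subset_ball hr1
  have hha : AnalyticAt ℂ h a := hh.analyticAt (Metric.ball_mem_nhds a one_pos)
  set F : ℂ → ℂ := fun w => f w * Complex.exp (-h w) with hF
  have hFd : DifferentiableOn ℂ F (Metric.ball a r) :=
    hf.1.differentiableOn.mul ((hh.mono hsub).neg.cexp)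
  set I := ∫⁻ w in Metric.ball a r, ENNReal.ofReal (‖f w‖ ^ 2 * Real.exp (-φ w)) with hI
  have hItop : I ≠ ⊤ := ((setLIntegral_le_lintegral _ _).trans_lt hf.2).ne
  have hJ : ∫⁻ w in Metric.ball a r, ENNReal.ofReal (‖F w‖ ^ 2) ≤ ENNReal.ofReal e * I := by
    rw [hI, ← lintegral_const_mul' _ _ ENNReal.ofReal_ne_top]
    refine setLIntegral_mono' Metric.isOpen_ball.measurableSet fun w hw => ?_
    rw [← ENNReal.ofReal_mul he0.le, hF, norm_sq_mul_exp_neg (φ := φ)]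
    gcongr
    exact Real.exp_le_exp.2 ((le_abs_self _).trans (hb w (hsub hw)))
  have hIr : I = ENNReal.ofReal I.toReal := (ENNReal.ofReal_toReal hItop).symm
  set T := I.toReal with hT
  have hT0 : 0 ≤ T := ENNReal.toReal_nonneg
  have hFle : ∀ w ∈ Metric.ball a (r / 2), ‖F w‖ ^ 2 ≤ K * e * T := by
    intro w hw
    have h1 := (hK F a hFd w hw).trans (mul_le_mul_right hJ _)
    rw [hIr, ← ENNReal.ofReal_mul he0.le, ← ENNReal.ofReal_mul hK0,
      ENNReal.ofReal_le_ofReal_iff (by positivity)] at h1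
    linarith
  have hz0 : sampleTerm φ f 0 z = ‖f z‖ ^ 2 * Real.exp (-φ z) := rfl
  have hzF : sampleTerm φ f 0 z ≤ e * ‖F z‖ ^ 2 := by
    have h1 : sampleTerm φ f 0 z = Real.exp (-(φ z - 2 * (h z).re)) * ‖F z‖ ^ 2 := by
      rw [hz0, hF, norm_sq_mul_exp_neg (φ := φ), ← mul_assoc, ← Real.exp_add, neg_add_cancel,
        Real.exp_zero, one_mul]
    rw [h1]
    gcongr
    exact Real.exp_le_exp.2 ((neg_le_abs _).trans
      (hb z (hsub (Metric.ball_subset_ball (by linarith) hzr))))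
  have hFz : ‖F z‖ ^ 2 ≤ e * sampleTerm φ f 0 z := by
    rw [hz0, hF, norm_sq_mul_exp_neg (φ := φ)]
    gcongr
    exact Real.exp_le_exp.2 ((le_abs_self _).trans
      (hb z (hsub (Metric.ball_subset_ball (by linarith) hzr))))
  have hterm : ∀ k ≤ n, sampleTerm φ f k a = ‖iteratedDeriv k F a‖ ^ 2 := fun k hk =>
    sampleTerm_eq hφ hf.1 hha h0 hd hk
  have hmain := norm_iteratedDeriv_sq_le (S := Real.sqrt (K * e * T)) hr hr1 n hFd
    (fun w hw => Real.le_sqrt_of_sq_le (hFle w hw)) (by rw [hz]; exact hε) (by rw [hz]; exact hεr)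
  rw [hz, Real.sq_sqrt (by positivity), ← hterm n le_rfl,
    Finset.sum_congr rfl fun k hk => (hterm k (Finset.mem_range.1 hk).le).symm] at hmain
  have hKe : 0 ≤ K * e * T := by positivity
  constructor
  · rw [hIr, ← ENNReal.ofReal_mul (by positivity)]
    refine ENNReal.ofReal_le_ofReal (hzF.trans ?_)
    have h1 := hFle z hzr
    nlinarith [mul_nonneg hβ0 hKe]
  · rw [hIr, ← ENNReal.ofReal_sum_of_nonneg fun k _ => sampleTerm_nonneg φ f k a,
      ← ENNReal.ofReal_add (sampleTerm_nonneg φ f 0 z)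
        (Finset.sum_nonneg fun k _ => sampleTerm_nonneg φ f k a),
      ← ENNReal.ofReal_mul (by positivity), ← ENNReal.ofReal_mul (by positivity),
      ← ENNReal.ofReal_add (mul_nonneg (by positivity) (add_nonneg (sampleTerm_nonneg φ f 0 z)
        (Finset.sum_nonneg fun k _ => sampleTerm_nonneg φ f k a))) (by positivity)]
    refine ENNReal.ofReal_le_ofReal (hmain.trans ?_)
    have hs := sampleTerm_nonneg φ f 0 z
    have hS : 0 ≤ ∑ k ∈ Finset.range n, sampleTerm φ f k a :=
      Finset.sum_nonneg fun k _ => sampleTerm_nonneg φ f k a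
    refine add_le_add ?_ ?_
    · rw [mul_assoc α]
      refine mul_le_mul_of_nonneg_left ?_ hα0
      nlinarith [mul_nonneg he0.le hS]
    · have : 0 ≤ e * (K * e) * ε ^ 2 * T := by positivity
      nlinarith

/-! ### Sums over a perturbed set -/

lemma MultSet.maxPoints_subset (L : MultSet) : L.maxPoints ⊆ L.carrier := fun _ hl => hl.1

lemma MultSet.mult_le_maxMult (L : MultSet) {l : ℂ} (hl : l ∈ L.carrier) :
    L.mult l ≤ L.maxMult := by
  obtain ⟨N, hN⟩ := L.bdd
  exact le_csSup ⟨N, by rintro _ ⟨x, hx, rfl⟩; exact hN x hx⟩ ⟨l, hl, rfl⟩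

lemma MultSet.maxPoints_nonempty (L : MultSet) (h : L.carrier.Nonempty) :
    L.maxPoints.Nonempty := by
  obtain ⟨N, hN⟩ := L.bdd
  obtain ⟨l, hl, h⟩ := Nat.sSup_mem (h.image L.mult)
    ⟨N, by rintro _ ⟨x, hx, rfl⟩; exact hN x hx⟩
  exact ⟨l, hl, h⟩

/-- `G m l` is the contribution of a point `l` of multiplicity `m`. Keeping it general serves both
the sampling sums and the point counts. -/
lemma IsPerturbation.tsum_eq_add {L L' : MultSet} {p : ℂ → ℂ} (hp : IsPerturbation L p L')
    (G : ℕ → ℂ → ℝ≥0∞) (H : ℂ → ℝ≥0∞)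
    (hG : ∀ l ∈ L.maxPoints, G (L.mult l) l = G (L'.mult l) l + H l) :
    ∑' l : L.carrier, G (L.mult l) l =
      ∑' l : L.carrier, G (L'.mult l) l + ∑' l : L.maxPoints, H l := by
  have h1 : ∑' l : L.maxPoints, H l = ∑' l : L.carrier, L.maxPoints.indicator H l := by
    rw [tsum_subtype, tsum_subtype, Set.indicator_indicator,
      Set.inter_eq_right.2 L.maxPoints_subset]
  rw [h1, ← ENNReal.tsum_add]
  refine tsum_congr fun l => ?_
  by_cases hl : (l : ℂ) ∈ L.maxPoints
  · simp [hl, hG]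
  · simp [hl, hp.mult_rest l l.2 hl]

lemma IsPerturbation.tsum_carrier {L L' : MultSet} {p : ℂ → ℂ} (hp : IsPerturbation L p L')
    (hdisj : p '' L.maxPoints ∩ L.carrier = ∅) (hinj : InjOn p L.maxPoints)
    (G : ℕ → ℂ → ℝ≥0∞) :
    ∑' l : L'.carrier, G (L'.mult l) l =
      ∑' l : L.carrier, G (L'.mult l) l + ∑' l : L.maxPoints, G 1 (p l) := by
  have h1 : ∑' l : L'.carrier, G (L'.mult l) l =
      ∑' l : (L.carrier ∪ p '' L.maxPoints : Set ℂ), G (L'.mult l) l := by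
    rw [hp.carrier_eq]
  rw [h1, ENNReal.summable.tsum_union_disjoint (f := fun l => G (L'.mult l) l)
    (Set.disjoint_iff_inter_eq_empty.2 (by rwa [Set.inter_comm])) ENNReal.summable,
    tsum_image (fun l => G (L'.mult l) l) hinj]
  congr 1
  exact tsum_congr fun l => by rw [hp.mult_new l l.2]

/-! ### Densities -/

lemma MultSet.count_eq (L : MultSet) (z : ℂ) (r : ℝ) :
    L.count z r = ∑' l : L.carrier, (Metric.ball z r).indicator
      (fun _ => (L.mult l : ℝ≥0∞)) (l : ℂ) := rfl

lemma indicator_ball_le {ε : ℝ} {a b : ℂ} (h : dist a b = ε) (z : ℂ) (r : ℝ) :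
    (Metric.ball z r).indicator (fun _ => (1 : ℝ≥0∞)) a ≤
      (Metric.ball z (r + ε)).indicator (fun _ => (1 : ℝ≥0∞)) b := by
  by_cases ha : a ∈ Metric.ball z r
  · have hb : b ∈ Metric.ball z (r + ε) := by
      rw [Metric.mem_ball] at ha ⊢
      have := dist_triangle b a z
      rw [dist_comm b a] at this
      linarith
    simp [ha, hb]
  · simp [ha]

lemma indicator_ball_add (k : ℕ) (s : Set ℂ) (l : ℂ) :
    s.indicator (fun _ => ((k + 1 : ℕ) : ℝ≥0∞)) l =
      s.indicator (fun _ => (k : ℝ≥0∞)) l + s.indicator (fun _ => (1 : ℝ≥0∞)) l := by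
  by_cases h : l ∈ s <;> simp [h]

/-- Up to moving one unit of multiplicity from each maximal point over a distance $\varepsilon$,
both sets are the same, so their counts interlace after enlarging the radius by $\varepsilon$. -/
lemma IsPerturbation.count_le {L L' : MultSet} {p : ℂ → ℂ} (hp : IsPerturbation L p L')
    (hdisj : p '' L.maxPoints ∩ L.carrier = ∅) (hinj : InjOn p L.maxPoints) {ε : ℝ}
    (hε : 0 ≤ ε) (hdist : ∀ l ∈ L.maxPoints, dist l (p l) = ε) (z : ℂ) (r : ℝ) :
    L'.count z r ≤ L.count z (r + ε) ∧ L.count z r ≤ L'.count z (r + ε) := by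
  have key : ∀ s, L.count z s = ∑' l : L.carrier, (Metric.ball z s).indicator
      (fun _ => (L'.mult l : ℝ≥0∞)) (l : ℂ) + ∑' l : L.maxPoints,
        (Metric.ball z s).indicator (fun _ => (1 : ℝ≥0∞)) (l : ℂ) := fun s =>
    hp.tsum_eq_add (fun m => (Metric.ball z s).indicator (fun _ => (m : ℝ≥0∞))) _ fun l hl => by
      rw [← hp.mult_max l hl, indicator_ball_add]
  have key' : ∀ s, L'.count z s = ∑' l : L.carrier, (Metric.ball z s).indicator
      (fun _ => (L'.mult l : ℝ≥0∞)) (l : ℂ) + ∑' l : L.maxPoints,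
        (Metric.ball z s).indicator (fun _ => (1 : ℝ≥0∞)) (p l) := fun s => by
    have := hp.tsum_carrier hdisj hinj
      (fun m => (Metric.ball z s).indicator (fun _ => (m : ℝ≥0∞)))
    simpa [MultSet.count_eq] using this
  have hmono : ∑' l : L.carrier, (Metric.ball z r).indicator
      (fun _ => (L'.mult l : ℝ≥0∞)) (l : ℂ) ≤ ∑' l : L.carrier, (Metric.ball z (r + ε)).indicator
      (fun _ => (L'.mult l : ℝ≥0∞)) (l : ℂ) :=
    ENNReal.tsum_le_tsum fun l => Set.indicator_le_indicator_of_subset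
      (Metric.ball_subset_ball (by linarith)) (fun _ => bot_le) _
  rw [key, key', key, key']
  exact ⟨add_le_add hmono (ENNReal.tsum_le_tsum fun l =>
      indicator_ball_le (by rw [dist_comm, hdist l l.2]) z r),
    add_le_add hmono (ENNReal.tsum_le_tsum fun l => indicator_ball_le (hdist l l.2) z r)⟩

/-- Limits at infinity ignore the shift of $r$, and the factor $1+\eta$ disappears as $\eta\to0$. -/
lemma liminf_limsup_le_of_shift {u v : ℝ → ℝ≥0∞} {ε : ℝ}
    (h : ∀ η : ℝ, 0 < η → ∀ᶠ r in atTop, u r ≤ ENNReal.ofReal (1 + η) * v (r + ε)) :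
    liminf u atTop ≤ liminf v atTop ∧ limsup u atTop ≤ limsup v atTop := by
  have hmap : map (fun r : ℝ => r + ε) atTop = atTop := (OrderIso.addRight ε).map_atTop
  have hinf : liminf (fun r => v (r + ε)) atTop = liminf v atTop := by
    conv_rhs => rw [← hmap]
    rfl
  have hsup : limsup (fun r => v (r + ε)) atTop = limsup v atTop := by
    conv_rhs => rw [← hmap]
    rfl
  have hlim : ∀ a b : ℝ≥0∞, (∀ η : ℝ, 0 < η → a ≤ ENNReal.ofReal (1 + η) * b) → a ≤ b := by
    intro a b hab
    rcases eq_or_ne b ⊤ with rfl | hb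
    · exact le_top
    have ht : Tendsto (fun η : ℝ => ENNReal.ofReal (1 + η) * b) (𝓝[>] 0) (𝓝 b) := by
      have h1 : Tendsto (fun η : ℝ => ENNReal.ofReal (1 + η)) (𝓝[>] 0) (𝓝 1) := by
        have : ContinuousAt (fun η : ℝ => ENNReal.ofReal (1 + η)) 0 :=
          (ENNReal.continuous_ofReal.comp (continuous_const.add continuous_id)).continuousAt
        have h2 := this.tendsto.mono_left (nhdsWithin_le_nhds (s := Ioi 0))
        simpa using h2
      simpa using ENNReal.Tendsto.mul_const h1 (Or.inr hb)
    exact ge_of_tendsto ht (by filter_upwards [self_mem_nhdsWithin] with η hη using hab η hη)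
  refine ⟨hlim _ _ fun η hη => ?_, hlim _ _ fun η hη => ?_⟩
  · rw [← hinf, ← ENNReal.liminf_const_mul_of_ne_top ENNReal.ofReal_ne_top]
    exact liminf_le_liminf (h η hη)
  · rw [← hsup, ← ENNReal.limsup_const_mul_of_ne_top ENNReal.ofReal_ne_top]
    exact limsup_le_limsup (h η hη)

/-- The annulus has mass at most $M\pi(2r\varepsilon+\varepsilon^2)$, the disc at least $m\pi r^2$;
the threshold for $r$ does not depend on $z$. -/
lemma eventually_lintegral_ball_add_le {g : ℂ → ℝ} {m M : ℝ} (hm : 0 < m)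
    (hg : ∀ᵐ z, m < g z ∧ g z < M) {ε η : ℝ} (hε : 0 < ε) (hη : 0 < η) :
    ∀ᶠ r in atTop, ∀ z : ℂ,
      ∫⁻ w in Metric.ball z (r + ε), ENNReal.ofReal (g w) ≤
        ENNReal.ofReal (1 + η) * ∫⁻ w in Metric.ball z r, ENNReal.ofReal (g w) := by
  have hM : 0 < M := by
    obtain ⟨z, hz⟩ := hg.exists
    linarith [hz.1, hz.2]
  have hev : ∀ᶠ r : ℝ in atTop, M * (2 * ε + ε ^ 2) / (η * m) ≤ r ∧ 1 ≤ r :=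
    (eventually_ge_atTop _).and (eventually_ge_atTop _)
  filter_upwards [hev] with r hr z
  have hr0 : 0 ≤ r := by linarith [hr.2]
  have hsub : Metric.ball z r ⊆ Metric.ball z (r + ε) := Metric.ball_subset_ball (by linarith)
  have hvol : ∀ s : ℝ, 0 ≤ s → volume (Metric.ball z s) = ENNReal.ofReal (Real.pi * s ^ 2) := by
    intro s hs
    rw [Complex.volume_ball, ENNReal.ofReal_mul Real.pi_pos.le, ENNReal.ofReal_pow hs,
      mul_comm]
    congr 1
    rw [← NNReal.coe_real_pi, ENNReal.ofReal_coe_nnreal]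
  have hdiff : volume (Metric.ball z (r + ε) \ Metric.ball z r) =
      ENNReal.ofReal (Real.pi * (2 * r * ε + ε ^ 2)) := by
    rw [measure_sdiff hsub measurableSet_ball.nullMeasurableSet (by rw [hvol r hr0]; simp),
      hvol r hr0, hvol _ (by linarith), ← ENNReal.ofReal_sub _ (by positivity)]
    congr 1
    ring
  have h1 : ∫⁻ w in Metric.ball z (r + ε) \ Metric.ball z r, ENNReal.ofReal (g w) ≤
      ENNReal.ofReal M * ENNReal.ofReal (Real.pi * (2 * r * ε + ε ^ 2)) := by
    rw [← hdiff, ← setLIntegral_const]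
    refine lintegral_mono_ae (ae_restrict_of_ae ?_)
    filter_upwards [hg] with w hw using ENNReal.ofReal_le_ofReal hw.2.le
  have h2 : ENNReal.ofReal m * ENNReal.ofReal (Real.pi * r ^ 2) ≤
      ∫⁻ w in Metric.ball z r, ENNReal.ofReal (g w) := by
    rw [← hvol r hr0, ← setLIntegral_const]
    refine lintegral_mono_ae (ae_restrict_of_ae ?_)
    filter_upwards [hg] with w hw using ENNReal.ofReal_le_ofReal hw.1.le
  have h3 : M * (Real.pi * (2 * r * ε + ε ^ 2)) ≤ η * (m * (Real.pi * r ^ 2)) := by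
    have h4 := (div_le_iff₀ (by positivity)).1 hr.1
    have h5 : M * (2 * r * ε + ε ^ 2) ≤ η * (m * r ^ 2) := by
      have h6 : M * (2 * r * ε + ε ^ 2) ≤ (M * (2 * ε + ε ^ 2)) * r := by
        have : 0 ≤ M * ε ^ 2 * (r - 1) := by
          have := hr.2
          have : 0 ≤ r - 1 := by linarith
          positivity
        linarith
      have h7 := mul_le_mul_of_nonneg_right h4 hr0
      linarith
    have := mul_le_mul_of_nonneg_left h5 Real.pi_pos.le
    linarith
  calc ∫⁻ w in Metric.ball z (r + ε), ENNReal.ofReal (g w)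
      = (∫⁻ w in Metric.ball z r, ENNReal.ofReal (g w)) +
        ∫⁻ w in Metric.ball z (r + ε) \ Metric.ball z r, ENNReal.ofReal (g w) := by
        rw [← lintegral_inter_add_sdiff _ _ (measurableSet_ball (x := z) (ε := r)),
          Set.inter_eq_right.2 hsub]
    _ ≤ (∫⁻ w in Metric.ball z r, ENNReal.ofReal (g w)) +
        ENNReal.ofReal η * ∫⁻ w in Metric.ball z r, ENNReal.ofReal (g w) := by
        refine add_le_add le_rfl (h1.trans ?_)
        refine le_trans ?_ (mul_le_mul_right h2 (ENNReal.ofReal η))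
        rw [← ENNReal.ofReal_mul hM.le, ← ENNReal.ofReal_mul hm.le, ← ENNReal.ofReal_mul hη.le]
        exact ENNReal.ofReal_le_ofReal h3
    _ = _ := by
        rw [ENNReal.ofReal_add zero_le_one hη.le, add_mul, ENNReal.ofReal_one, one_mul]

lemma density_le_of_count_le {L₁ L₂ : MultSet} {g : ℂ → ℝ} {m M : ℝ} (hm : 0 < m)
    (hg : ∀ᵐ z, m < g z ∧ g z < M) {ε : ℝ} (hε : 0 < ε)
    (hc : ∀ z r, L₁.count z r ≤ L₂.count z (r + ε)) :
    lowerDensity L₁ g ≤ lowerDensity L₂ g ∧ upperDensity L₁ g ≤ upperDensity L₂ g := by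
  have key : ∀ η : ℝ, 0 < η → ∀ᶠ r in atTop, ∀ z : ℂ,
      ratio L₁ g z r ≤ ENNReal.ofReal (1 + η) * ratio L₂ g z (r + ε) := by
    intro η hη
    filter_upwards [eventually_lintegral_ball_add_le hm hg hε hη] with r hr z
    have h0 : ENNReal.ofReal (1 + η) ≠ 0 := by
      rw [Ne, ENNReal.ofReal_eq_zero]
      linarith
    unfold ratio
    calc L₁.count z r / ∫⁻ w in Metric.ball z r, ENNReal.ofReal (g w)
        ≤ L₂.count z (r + ε) / ∫⁻ w in Metric.ball z r, ENNReal.ofReal (g w) :=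
          ENNReal.div_le_div_right (hc z r) _
      _ = ENNReal.ofReal (1 + η) * L₂.count z (r + ε) /
          (ENNReal.ofReal (1 + η) * ∫⁻ w in Metric.ball z r, ENNReal.ofReal (g w)) :=
          (ENNReal.mul_div_mul_left _ _ h0 ENNReal.ofReal_ne_top).symm
      _ ≤ ENNReal.ofReal (1 + η) * L₂.count z (r + ε) /
          ∫⁻ w in Metric.ball z (r + ε), ENNReal.ofReal (g w) :=
          ENNReal.div_le_div_left (hr z) _
      _ = _ := mul_div_assoc _ _ _
  refine ⟨(liminf_limsup_le_of_shift (ε := ε) fun η hη => ?_).1,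
    (liminf_limsup_le_of_shift (ε := ε) fun η hη => ?_).2⟩
  · filter_upwards [key η hη] with r hr
    rw [ENNReal.mul_iInf_of_ne (by rw [Ne, ENNReal.ofReal_eq_zero]; linarith)
      ENNReal.ofReal_ne_top]
    exact iInf_mono hr
  · filter_upwards [key η hη] with r hr
    rw [ENNReal.mul_iSup]
    exact iSup_mono hr

/-! ### The separation -/

lemma MultSet.IsSeparated.exists_dist_le {L : MultSet} (h : L.IsSeparated) :
    ∃ δ : ℝ, 0 < δ ∧ ∀ a ∈ L.carrier, ∀ b ∈ L.carrier, a ≠ b → δ ≤ dist a b := by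
  obtain ⟨δ, -, hδ, hlt⟩ := ENNReal.lt_iff_exists_real_btwn.1 h
  refine ⟨δ, ENNReal.ofReal_pos.1 hδ, fun a ha b hb hab => ?_⟩
  have := Set.le_edist_of_le_einfsep ha hb hab hlt.le
  rw [edist_dist] at this
  exact (ENNReal.ofReal_le_ofReal_iff dist_nonneg).1 this

lemma MultSet.isSeparated_of_le_dist {L : MultSet} {δ : ℝ} (hδ : 0 < δ)
    (h : ∀ a ∈ L.carrier, ∀ b ∈ L.carrier, a ≠ b → δ ≤ dist a b) : L.IsSeparated := by
  refine lt_of_lt_of_le (ENNReal.ofReal_pos.2 hδ) (Set.le_einfsep_iff.2 fun a ha b hb hab => ?_)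
  rw [edist_dist]
  exact ENNReal.ofReal_le_ofReal (h a ha b hb hab)

/-- The discs are disjoint, so their masses for the measure $|f|^2e^{-\phi}dA$ add up to at most the
total mass. -/
lemma tsum_lintegral_ball_le {s : Set ℂ} {r : ℝ}
    (hs : ∀ a ∈ s, ∀ b ∈ s, a ≠ b → 2 * r ≤ dist a b) (φ : ℂ → ℝ) (f : ℂ → ℂ) :
    ∑' a : s, ∫⁻ w in Metric.ball (a : ℂ) r, ENNReal.ofReal (‖f w‖ ^ 2 * Real.exp (-φ w)) ≤
      normSq φ f := by
  set μ := volume.withDensity fun w => ENNReal.ofReal (‖f w‖ ^ 2 * Real.exp (-φ w))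
  have h1 : ∀ a : ℂ, ∫⁻ w in Metric.ball a r, ENNReal.ofReal (‖f w‖ ^ 2 * Real.exp (-φ w)) =
      μ (Metric.ball a r) := fun a => (withDensity_apply _ measurableSet_ball).symm
  have h2 : normSq φ f = μ univ := by
    rw [withDensity_apply _ MeasurableSet.univ, Measure.restrict_univ, normSq]
  rw [h2]
  simp_rw [h1]
  refine (tsum_meas_le_meas_iUnion_of_disjoint μ (fun _ => measurableSet_ball) ?_).trans
    (measure_mono (subset_univ _))
  intro a b hab
  refine Metric.ball_disjoint_ball ?_
  have := hs a a.2 b b.2 (fun h => hab (Subtype.ext h))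
  linarith

/-! ### Existence of the perturbation -/

lemma perturbation_disjoint {L : MultSet} {p : ℂ → ℂ} {δ ε : ℝ} (hε : 0 < ε) (hεδ : 4 * ε ≤ δ)
    (hδ : ∀ a ∈ L.carrier, ∀ b ∈ L.carrier, a ≠ b → δ ≤ dist a b)
    (hp : ∀ l ∈ L.maxPoints, dist l (p l) = ε) :
    (∀ l ∈ L.maxPoints, ∀ a ∈ L.carrier, ε ≤ dist (p l) a) ∧
    (∀ l ∈ L.maxPoints, ∀ l' ∈ L.maxPoints, l ≠ l' → ε ≤ dist (p l) (p l')) := by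
  refine ⟨fun l hl a ha => ?_, fun l hl l' hl' hne => ?_⟩
  · by_cases h : l = a
    · rw [← h, dist_comm, hp l hl]
    · have h1 := hδ l hl.1 a ha h
      have h2 := dist_triangle l (p l) a
      rw [hp l hl] at h2
      linarith
  · have h1 := hδ l hl.1 l' hl'.1 hne
    have h2 := dist_triangle4 l (p l) (p l') l'
    rw [hp l hl, dist_comm (p l') l', hp l' hl'] at h2
    linarith

open Classical in
lemma exists_isPerturbation {L : MultSet} {p : ℂ → ℂ} {n : ℕ} (hn : 1 ≤ n)
    (hmax : L.maxMult = n + 1) (hdisj : p '' L.maxPoints ∩ L.carrier = ∅) :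
    ∃ L' : MultSet, IsPerturbation L p L' ∧ L'.maxMult = n := by
  have hnot : ∀ l ∈ L.maxPoints, p l ∉ L.carrier := fun l hl h =>
    Set.eq_empty_iff_forall_notMem.1 hdisj (p l) ⟨⟨l, hl, rfl⟩, h⟩
  set μ : ℂ → ℕ := fun z => if z ∈ L.maxPoints then n else if z ∈ L.carrier then L.mult z else 1
  have hμ : ∀ z, 1 ≤ μ z ∧ μ z ≤ n := by
    intro z
    by_cases h1 : z ∈ L.maxPoints
    · simp [μ, h1, hn]
    · by_cases h2 : z ∈ L.carrier
      · have h3 := L.mult_le_maxMult h2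
        have h4 : L.mult z ≠ L.maxMult := fun h => h1 ⟨h2, h⟩
        have h5 := L.pos z h2
        simp only [μ, h1, h2, if_false, if_true]
        omega
      · simp [μ, h1, h2, hn]
  refine ⟨⟨L.carrier ∪ p '' L.maxPoints, μ, fun z _ => (hμ z).1, n, fun z _ => (hμ z).2⟩,
    ⟨rfl, fun l hl => ?_, fun l hl h => ?_, fun l hl => ?_⟩, ?_⟩
  · simp [μ, hl, hl.2, hmax]
  · simp [μ, hl, h]
  · have h : p l ∉ L.maxPoints := fun h => hnot l hl (L.maxPoints_subset h)
    simp [μ, hnot l hl, h]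
  -- The maximum $n$ is attained at a former maximal point. Such a point exists because `maxMult` is
  -- zero for an empty set, while here it is $n+1$.
  · have hne : L.carrier.Nonempty := by
      by_contra h
      rw [Set.not_nonempty_iff_eq_empty] at h
      simp [MultSet.maxMult, h] at hmax
    obtain ⟨l, hl⟩ := L.maxPoints_nonempty hne
    refine le_antisymm (csSup_le ⟨_, l, Or.inl hl.1, rfl⟩ ?_)
      (le_csSup ⟨n, ?_⟩ ⟨l, Or.inl hl.1, by simp [μ, hl]⟩)
    · rintro _ ⟨z, -, rfl⟩
      exact (hμ z).2
    · rintro _ ⟨z, -, rfl⟩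
      exact (hμ z).2

/-! ### Sampling is preserved -/

/-- The lost terms are bounded by $D$ times the new sampling sum plus $q$ times disjoint local
norms. As $q\le A/2$, the latter use up at most half of the lower bound $A\|f\|_\phi^2$. -/
lemma IsPerturbation.isSampling {L L' : MultSet} {p : ℂ → ℂ} {φ : ℂ → ℝ} {n : ℕ} {r A B C D q : ℝ}
    (hp : IsPerturbation L p L') (hmax : L.maxMult = n + 1)
    (hdisj : p '' L.maxPoints ∩ L.carrier = ∅) (hinj : InjOn p L.maxPoints)
    (hsep : ∀ a ∈ L.carrier, ∀ b ∈ L.carrier, a ≠ b → 2 * r ≤ dist a b)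
    (hA : 0 < A) (hB : 0 < B) (hC : 0 ≤ C) (hD : 0 ≤ D) (hq : q ≤ A / 2)
    (hsamp : ∀ f ∈ fock φ, ENNReal.ofReal A * normSq φ f ≤ sampleSum L φ f ∧
      sampleSum L φ f ≤ ENNReal.ofReal B * normSq φ f)
    (hbound : ∀ f ∈ fock φ, ∀ l ∈ L.maxPoints,
      ENNReal.ofReal (sampleTerm φ f 0 (p l)) ≤ ENNReal.ofReal C *
        ∫⁻ w in Metric.ball l r, ENNReal.ofReal (‖f w‖ ^ 2 * Real.exp (-φ w)) ∧
      ENNReal.ofReal (sampleTerm φ f n l) ≤ ENNReal.ofReal D *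
          (ENNReal.ofReal (sampleTerm φ f 0 (p l)) +
            ∑ k ∈ Finset.range n, ENNReal.ofReal (sampleTerm φ f k l)) +
        ENNReal.ofReal q *
          ∫⁻ w in Metric.ball l r, ENNReal.ofReal (‖f w‖ ^ 2 * Real.exp (-φ w))) :
    IsSampling L' φ := by
  have hD1 : (0 : ℝ) < 1 + D := by linarith
  refine ⟨A / 2 / (1 + D), B + C, by positivity, by positivity, fun f hf => ?_⟩
  set N := normSq φ f
  set G : ℕ → ℂ → ℝ≥0∞ := fun m l => ∑ j ∈ Finset.range m, ENNReal.ofReal (sampleTerm φ f j l)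
    with hG
  set I : ℂ → ℝ≥0∞ := fun a =>
    ∫⁻ w in Metric.ball a r, ENNReal.ofReal (‖f w‖ ^ 2 * Real.exp (-φ w))
  have hmult : ∀ l ∈ L.maxPoints, L.mult l = n + 1 ∧ L'.mult l = n := fun l hl => by
    have h1 := hp.mult_max l hl
    have h2 : L.mult l = n + 1 := hl.2.trans hmax
    omega
  have hI : ∑' l : L.maxPoints, I l ≤ N := tsum_lintegral_ball_le
    (fun a ha b hb => hsep a (L.maxPoints_subset ha) b (L.maxPoints_subset hb)) φ f
  set S₀ : ℝ≥0∞ := ∑' l : L.carrier, G (L'.mult l) l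
  set S₁ : ℝ≥0∞ := ∑' l : L.maxPoints, ENNReal.ofReal (sampleTerm φ f 0 (p l))
  have hS : sampleSum L φ f =
      S₀ + ∑' l : L.maxPoints, ENNReal.ofReal (sampleTerm φ f n l) :=
    hp.tsum_eq_add G (fun l => ENNReal.ofReal (sampleTerm φ f n l)) fun l hl => by
      rw [(hmult l hl).1, (hmult l hl).2, hG]
      exact Finset.sum_range_succ _ _
  have hS' : sampleSum L' φ f = S₀ + S₁ := by
    refine (hp.tsum_carrier hdisj hinj G).trans ?_
    simp [hG, S₁, S₀]
  have hS₀ : ∑' l : L.maxPoints, G n l ≤ S₀ := by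
    refine le_trans (le_of_eq (tsum_congr fun l => ?_))
      (ENNReal.tsum_mono_subtype (fun l => G (L'.mult l) l) L.maxPoints_subset)
    rw [(hmult l l.2).2]
  obtain ⟨hlow, hup⟩ := hsamp f hf
  constructor
  · have h1 : ENNReal.ofReal (A / 2) * N + ENNReal.ofReal (A / 2) * N ≤
        ENNReal.ofReal (1 + D) * sampleSum L' φ f + ENNReal.ofReal (A / 2) * N := by
      calc ENNReal.ofReal (A / 2) * N + ENNReal.ofReal (A / 2) * N
          = ENNReal.ofReal A * N := by
            rw [← add_mul, ← ENNReal.ofReal_add (by positivity) (by positivity), add_halves]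
        _ ≤ S₀ + ∑' l : L.maxPoints, ENNReal.ofReal (sampleTerm φ f n l) := hlow.trans_eq hS
        _ ≤ S₀ + ∑' l : L.maxPoints, (ENNReal.ofReal D *
              (ENNReal.ofReal (sampleTerm φ f 0 (p l)) + G n l) + ENNReal.ofReal q * I l) :=
            add_le_add le_rfl (ENNReal.tsum_le_tsum fun l => (hbound f hf l l.2).2)
        _ = S₀ + (ENNReal.ofReal D * (S₁ + ∑' l : L.maxPoints, G n l) +
              ENNReal.ofReal q * ∑' l : L.maxPoints, I l) := by
            rw [ENNReal.tsum_add, ENNReal.tsum_mul_left, ENNReal.tsum_mul_left, ENNReal.tsum_add]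
        _ ≤ S₀ + S₁ + (ENNReal.ofReal D * (S₁ + S₀) + ENNReal.ofReal (A / 2) * N) := by
            gcongr
            exact le_self_add
        _ = ENNReal.ofReal (1 + D) * sampleSum L' φ f + ENNReal.ofReal (A / 2) * N := by
            rw [hS', ENNReal.ofReal_add zero_le_one hD, ENNReal.ofReal_one]
            ring
    have h2 := ENNReal.le_of_add_le_add_right
      (ENNReal.mul_ne_top ENNReal.ofReal_ne_top hf.2.ne) h1
    rw [ENNReal.ofReal_div_of_pos hD1, ← ENNReal.mul_div_right_comm]
    exact ENNReal.div_le_of_le_mul' h2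
  · calc sampleSum L' φ f = S₀ + S₁ := hS'
      _ ≤ sampleSum L φ f + ∑' l : L.maxPoints, ENNReal.ofReal C * I l := by
          refine add_le_add (hS ▸ le_self_add) (ENNReal.tsum_le_tsum fun l => ?_)
          exact (hbound f hf l l.2).1
      _ ≤ ENNReal.ofReal B * N + ENNReal.ofReal C * N := by
          rw [ENNReal.tsum_mul_left]
          gcongr
      _ = ENNReal.ofReal (B + C) * N := by rw [← add_mul, ENNReal.ofReal_add hB.le hC]

end WeightedFock

end

theorem mainTheorem4 (L : WeightedFock.MultSet) (φ g : ℂ → ℝ) (n : ℕ) (hn : 1 ≤ n)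
    (hmax : L.maxMult = n + 1) (hsep : L.IsSeparated) (hcompat : WeightedFock.Compatible L φ g)
    (hsamp : WeightedFock.IsSampling L φ) :
    ∃ ε₀ : ℝ, 0 < ε₀ ∧ ∀ ε : ℝ, 0 < ε → ε < ε₀ →
      ∀ p : ℂ → ℂ, (∀ l ∈ L.maxPoints, dist l (p l) = ε) →
        p '' L.maxPoints ∩ L.carrier = ∅ ∧ Set.InjOn p L.maxPoints ∧
        ∃ L' : WeightedFock.MultSet, WeightedFock.IsPerturbation L p L' ∧
          L'.IsSeparated ∧ WeightedFock.IsSampling L' φ ∧ L'.maxMult = n ∧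
          WeightedFock.lowerDensity L' g = WeightedFock.lowerDensity L g ∧
          WeightedFock.upperDensity L' g = WeightedFock.upperDensity L g := by
  obtain ⟨δ, hδ, hδL⟩ := hsep.exists_dist_le
  obtain ⟨A, B, hA, hB, hAB⟩ := hsamp
  obtain ⟨m, M, hm, hg⟩ := hcompat.bounds
  obtain ⟨hφ, C₀, hdec⟩ := hcompat.exists_locallyDecomposable hn hmax
  -- The bound $r\le1$ keeps the discs inside the domains of the local decompositions, and
  -- $2r\le\delta$ makes discs about distinct points of $\Lambda$ disjoint.
  set r : ℝ := min 1 (δ / 2) with hr_def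
  have hr : 0 < r := by positivity
  obtain ⟨C, hC, hbound⟩ := hdec.exists_bounds hφ hr (min_le_left _ _)
  have hrδ : 2 * r ≤ δ := by linarith [min_le_right 1 (δ / 2)]
  -- The bound $r/8$ is the range of the Taylor estimate and also gives $4\varepsilon\le\delta$. The
  -- other two give $C\varepsilon^2\le C\varepsilon\le A/2$; the $C+1$ avoids division by zero.
  refine ⟨min (r / 8) (min 1 (A / (2 * (C + 1)))), by positivity, fun ε hε hlt p hp => ?_⟩
  obtain ⟨hεr, hlt'⟩ := lt_min_iff.1 hlt
  obtain ⟨hε1, hεA⟩ := lt_min_iff.1 hlt'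
  obtain ⟨hnew, hnew'⟩ := WeightedFock.perturbation_disjoint hε (by linarith) hδL hp
  have hdisj : p '' L.maxPoints ∩ L.carrier = ∅ := by
    rw [Set.eq_empty_iff_forall_notMem]
    rintro _ ⟨⟨l, hl, rfl⟩, h⟩
    have := hnew l hl _ h
    rw [dist_self] at this
    linarith
  have hinj : Set.InjOn p L.maxPoints := fun l hl l' hl' h => by
    by_contra hne
    have := hnew' l hl l' hl' hne
    rw [h, dist_self] at this
    linarith
  obtain ⟨L', hL', hmax'⟩ := WeightedFock.exists_isPerturbation hn hmax hdisj
  have hcount := hL'.count_le hdisj hinj hε.le hp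
  have h1 := WeightedFock.density_le_of_count_le hm hg hε fun z s => (hcount z s).1
  have h2 := WeightedFock.density_le_of_count_le hm hg hε fun z s => (hcount z s).2
  refine ⟨hdisj, hinj, L', hL', ?_, ?_, hmax', h1.1.antisymm h2.1, h1.2.antisymm h2.2⟩
  · refine WeightedFock.MultSet.isSeparated_of_le_dist hε fun a ha b hb hab => ?_
    rw [hL'.carrier_eq] at ha hb
    rcases ha with ha | ⟨l, hl, rfl⟩ <;> rcases hb with hb | ⟨l', hl', rfl⟩
    · linarith [hδL a ha b hb hab]
    · rw [dist_comm]
      exact hnew l' hl' a ha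
    · exact hnew l hl b hb
    · exact hnew' l hl l' hl' fun h => hab (by rw [h])
  · obtain ⟨D, hD, hDb⟩ := hbound ε hε hεr.le
    refine hL'.isSampling hmax hdisj hinj
      (fun a ha b hb hab => hrδ.trans (hδL a ha b hb hab)) hA hB hC hD (q := C * ε ^ 2) ?_ hAB
      fun f hf l hl => hDb f hf l (p l) (hp l hl)
    have h3 := (lt_div_iff₀ (by positivity)).1 hεA
    nlinarith [mul_nonneg hC hε.le]
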